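/- Let $v$ be an indeterminate, let $\bar{\ }$ be the field automorphism $v\mapsto v^{-1}$ of $\mathbb Q(v)$, and put $[m]=\frac{v^{2m}-1}{v^2-1}$ for $m\in\mathbb Z$. Let $n\ge 3$ be odd, $n=2r+1$. *The $\jmath$Schur algebras.* For $d\ge 0$ let $H$ be the Iwahori–Hecke algebra over $\mathbb Q(v)$ of the Weyl group $W$ of type $B_d$ (permutations of $\{1,\dots,2d+1\}$ commuting with $k\mapsto 2d+2-k$), with equal parameters $T_s^2=(v^2-1)T_s+v^2$, and with bar involution $v\mapsto v^{-1}$, $T_w\mapsto T_{w^{-1}}^{-1}$. For a composition $\mu=(\mu_1,\dots,\mu_n)$ of $2d+1$ with $\mu_i=\mu_{n+1-i}$ let $W_\mu$ be the corresponding parabolic subgroup and $x_\mu=\sum_{w\in W_\mu}T_w$. The $\jmath$Schur algebra is $\mathbf S^\jmath(n,d)=\mathrm{End}_H(\bigoplus_\mu x_\mu H)$; it is the generic form of the convolution algebra of pairs of $n$-step partial isotropic flags in $\mathbb F_q^{2d+1}$, $v=\sqrt q$. Let $\Xi_d$ be the set of $n\times n$ matrices $M$ over $\mathbb N$ with $m_{ij}=m_{n+1-i,n+1-j}$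 and sum of entries $2d+1$. A matrix $M\in\Xi_d$ with row sums $\lambda$ and column sums $\mu$ labels a double coset $O_M\in W_\lambda\backslash W/W_\mu$. The standard basis element $[M]_d$ is $v^{-\max\ell(O_M)+\max \ell(W_\mu)}$ times the homomorphism $x_\mu H\to x_\lambda H$ with $x_\mu\mapsto\sum_{w\in O_M}T_w$. The bar involution of $\mathbf S^\jmath(n,d)$ is the one induced from $H$. *The algebra $\dot{\mathbf U}^\jmath(\mathfrak{gl}_n)$.* Let $\tilde\Xi$ be the set of $n\times n$ integer matrices $A$ with $a_{ij}\ge0$ for $i\ne j$, $a_{ij}=a_{n+1-i,n+1-j}$ for all $i,j$, and $a_{r+1,r+1}$ odd. Then $\dot{\mathbf U}^\jmath(\mathfrak{gl}_n)$ is the $\mathbb Q(v)$-vector space with standard basis $\{[A] : A\in\tilde\Xi\}$, with multiplication and bar involution obtained by stabilization. That is, if for all large even $p$ and all $d$ one has $[B+pI]_d*[A+pI]_d=\sum_Z G_Z(v,v^{-p})[Z+pI]_d$, a finite sum with $G_Z(v,v')\in\mathbb Q(v)[v',v'^{-1}]$ independent of $p$ and $d$, then $[B]*[A]=\sum_Z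 G_Z(v,1)[Z]$; and $\overline{[A]}$ is obtained from $\overline{[A+pI]_d}$ in the same way. (Here $[M]_d=0$ if $M\notin\Xi_d$.) *The stably canonical basis.* For $A',A\in\tilde\Xi$ write $A'\sqsubseteq A$ if $A'$ and $A$ have the same row sums and the same column sums and $\sum_{k\le i,\,l\ge j}a'_{kl}\le\sum_{k\le i,\,l\ge j}a_{kl}$ for all $i<j$. The stably canonical basis element $\{A\}$ is the unique bar-invariant element of $[A]+\sum_{A'\sqsubset A}v^{-1}\mathbb Z[v^{-1}]\,[A']$. **Proposition.** (1) For every odd $n\ge 3$ the structure constants of the stably canonical basis of $\dot{\mathbf U}^\jmath(\mathfrak{gl}_n)$ are not always positive: there are $A,B\in\tilde\Xi$ such that in the (unique) expansion $\{B\}*\{A\}=\sum_C g_C\{C\}$ some coefficient $g_C$ does not lie in $\mathbb N[v,v^{-1}]$. (2) Let $n=3$ and let $a,b\in\mathbb Z$ with $b$ odd and $a<b\le-2$. Put $$A=\begin{pmatrix}a&1&0\\0&b&0\\0&1&a\end{pmatrix},\quad B=\begin{pmatrix}a&0&0\\1&b&1\\0&0&a\end{pmatrix},\quad C=\begin{pmatrix}a-1&1&0\\1&b&1\\0&1&a-1\end{pmatrix},\quad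 D=\begin{pmatrix}a&0&0\\0&b+2&0\\0&0&a\end{pmatrix}.$$ Then in $\dot{\mathbf U}^\jmath(\mathfrak{gl}_3)$ $$\{B\}*\{A\}=\{C\}+(v^{b+a}+v^{b-a})\,\overline{[b+1]}\,\{D\},\qquad \overline{[b+1]}\in\mathbb Z_{\le0}[v,v^{-1}].$$ -/

import Mathlib

noncomputable section

namespace JSchur

/-! ### The ground field and its bar involution -/

/-- The field `ℚ(v)`. -/
abbrev Qv : Type := RatFunc ℚ

/-- The indeterminate `v`. -/
def v : Qv := RatFunc.X

theorem X_inv_transcendental (K : Type*) [Field K] :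
    Transcendental K ((RatFunc.X : RatFunc K)⁻¹) := by
  intro h
  have h3 := h.inv
  rw [inv_inv] at h3
  exact RatFunc.transcendental_X h3

theorem eval₂_X_inv_ne_zero {K : Type*} [Field K] (f : Polynomial K) (hf : f ≠ 0) :
    f.eval₂ (RatFunc.C : K →+* RatFunc K) (RatFunc.X : RatFunc K)⁻¹ ≠ 0 := by
  intro h0
  apply hf
  apply (transcendental_iff.mp (X_inv_transcendental K)) f
  rw [Polynomial.aeval_def, RatFunc.algebraMap_eq_C]
  exact h0

theorem barQ_aux : nonZeroDivisors (Polynomial ℚ) ≤ (nonZeroDivisors Qv).comap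
    (Polynomial.eval₂RingHom (RatFunc.C : ℚ →+* Qv) v⁻¹) := by
  intro f hf
  rw [Submonoid.mem_comap, mem_nonZeroDivisors_iff_ne_zero]
  exact eval₂_X_inv_ne_zero f (nonZeroDivisors.ne_zero hf)

/-- The bar involution of `ℚ(v)`: the field homomorphism with `v ↦ v⁻¹`. -/
def barQ : Qv →+* Qv :=
  RatFunc.liftRingHom (Polynomial.eval₂RingHom (RatFunc.C : ℚ →+* Qv) v⁻¹) barQ_aux

theorem barQ_v : barQ v = v⁻¹ := by
  simp [barQ, v]

/-- The (not bar-invariant) quantum integer `[m] = (v^{2m} - 1) / (v^2 - 1)`. -/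
def qInt (m : ℤ) : Qv := (v ^ (2 * m) - 1) / (v ^ 2 - 1)

/-- `ℕ[v, v⁻¹]` inside `ℚ(v)`. -/
def NLaurent : Set Qv :=
  {f | ∃ c : ℤ →₀ ℕ, f = c.sum fun k m => (m : Qv) * v ^ k}

/-- `v⁻¹ ℤ[v⁻¹]` inside `ℚ(v)`. -/
def negLattice : Set Qv :=
  {f | ∃ c : ℕ →₀ ℤ, f = c.sum fun k m => (m : Qv) * v ^ (-(k : ℤ) - 1)}

/-! ### The Weyl group of type `B_d` -/

/-- The hyperoctahedral group: permutations of `{0, …, 2d}` which commute with `k ↦ 2d - k`. -/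
abbrev WB (d : ℕ) : Type :=
  ↥(Subgroup.centralizer ({Fin.revPerm} : Set (Equiv.Perm (Fin (2 * d + 1)))))

/-- The underlying permutations of the simple reflections: for `i + 1 < d` the product of the
transposition of `i, i + 1` and its mirror image, and for `i + 1 = d` the transposition of
`d - 1, d + 1`. -/
def simplePerm (d : ℕ) (i : Fin d) : Equiv.Perm (Fin (2 * d + 1)) :=
  let x : Fin (2 * d + 1) := ⟨i, by omega⟩
  let y : Fin (2 * d + 1) := ⟨i + 1, by omega⟩
  if (i : ℕ) + 1 < d then Equiv.swap x y * Equiv.swap x.rev y.rev else Equiv.swap x x.rev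

theorem simplePerm_mem (d : ℕ) (i : Fin d) :
    simplePerm d i ∈
      Subgroup.centralizer ({Fin.revPerm} : Set (Equiv.Perm (Fin (2 * d + 1)))) := by
  have key : ∀ x y : Fin (2 * d + 1),
      Fin.revPerm * Equiv.swap x y = Equiv.swap x.rev y.rev * Fin.revPerm := by
    intro x y
    have h := Equiv.mul_swap_eq_swap_mul (Fin.revPerm : Equiv.Perm (Fin (2 * d + 1))) x y
    simpa using h
  rw [Subgroup.mem_centralizer_singleton_iff]
  unfold simplePerm
  simp only
  split_ifs with h
  · rw [← mul_assoc, key, mul_assoc _ Fin.revPerm, key, ← mul_assoc, Fin.rev_rev, Fin.rev_rev]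
    congr 1
    apply Equiv.Perm.Disjoint.commute
    apply Equiv.Perm.disjoint_swap_swap
    simp [Fin.ext_iff, Fin.val_rev]
    omega
  · rw [key, Fin.rev_rev, Equiv.swap_comm]

/-- The simple reflections of the Weyl group of type `B_d`. -/
def simpleRefl (d : ℕ) (i : Fin d) : WB d := ⟨simplePerm d i, simplePerm_mem d i⟩

/-- The length function: the least length of a word in the simple reflections. -/
def len {d : ℕ} (w : WB d) : ℕ :=
  sInf {k | ∃ l : List (Fin d), l.length = k ∧ (l.map (simpleRefl d)).prod = w}

/-- A reduced word of `w`. -/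
def redWord {d : ℕ} (w : WB d) : List (Fin d) :=
  Classical.epsilon fun l => l.length = len w ∧ (l.map (simpleRefl d)).prod = w

/-! ### The Iwahori-Hecke algebra of type `B_d` (equal parameters `q = v²`) -/

/-- Left multiplication by `T_s` on the free module with basis `T_w` (`w` in the Weyl group):
`T_s T_w = T_{sw}` if `sw` is longer than `w`, and `T_s T_w = (v² - 1) T_w + v² T_{sw}` if not. -/
def heckeGen (d : ℕ) (i : Fin d) : Module.End Qv (WB d →₀ Qv) :=
  Finsupp.linearCombination Qv fun w : WB d =>
    if len w < len (simpleRefl d i * w) then Finsupp.single (simpleRefl d i * w) (1 : Qv)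
    else Finsupp.single w (v ^ 2 - 1) + Finsupp.single (simpleRefl d i * w) (v ^ 2)

/-- The Hecke algebra of type `B_d` over `ℚ(v)`, realized by its left regular representation. -/
abbrev Hecke (d : ℕ) : Type :=
  ↥(Algebra.adjoin Qv (Set.range (heckeGen d)))

/-- The generator `T_s`. -/
def Tgen (d : ℕ) (i : Fin d) : Hecke d :=
  ⟨heckeGen d i, Algebra.subset_adjoin ⟨i, rfl⟩⟩

/-- The standard basis element `T_w`, the product of the `T_s` along a reduced word of `w`. -/
def T {d : ℕ} (w : WB d) : Hecke d := ((redWord w).map (Tgen d)).prod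

/-- `T_s⁻¹ = v⁻² T_s + (v⁻² - 1)`. -/
def TgenInv (d : ℕ) (i : Fin d) : Hecke d :=
  (v ^ (-2 : ℤ)) • Tgen d i + (v ^ (-2 : ℤ) - 1) • (1 : Hecke d)

/-- The image `(T_{w⁻¹})⁻¹` of `T_w` under the bar involution. -/
def Tbar {d : ℕ} (w : WB d) : Hecke d := ((redWord w).map (TgenInv d)).prod

/-- The coefficient of `T_w` in `h` (as `h T_1 = h`). -/
def heckeCoeff {d : ℕ} (h : Hecke d) : WB d →₀ Qv := h.1 (Finsupp.single 1 1)

/-- The bar involution of the Hecke algebra: `v ↦ v⁻¹`, `T_w ↦ (T_{w⁻¹})⁻¹`. -/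
def barHecke {d : ℕ} (h : Hecke d) : Hecke d :=
  (heckeCoeff h).sum fun w c => barQ c • Tbar w

/-! ### The `j`-Schur algebra

For a symmetric composition `μ` of `2d + 1` let `W_μ` be its parabolic subgroup,
`x_μ = ∑_{w ∈ W_μ} T_w`, `P_μ = ∑_{w ∈ W_μ} v^{2 ℓ(w)}` and `e_μ = x_μ / P_μ`, an idempotent.
The `j`-Schur algebra over `ℚ(v)` is `End_H (⊕_μ x_μ H) = ⊕_{λ, μ} e_λ H e_μ`, which is here
the corner, cut out by the diagonal idempotent `diag (e_μ)`, of the algebra of square matrices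
over `H` indexed by the compositions. -/

/-- Symmetric compositions of `2d + 1` with `n` parts. -/
abbrev Wt (n d : ℕ) : Type :=
  ↥((Finset.piAntidiag (Finset.univ : Finset (Fin n)) (2 * d + 1)).filter
    fun μ => ∀ i, μ i.rev = μ i)

/-- Square matrices over the Hecke algebra, indexed by the symmetric compositions; the
`j`-Schur algebra is the span of the elements `std n d M` below. -/
abbrev SchurMat (n d : ℕ) : Type := Matrix (Wt n d) (Wt n d) (Hecke d)

/-- The `i`-th of the consecutive blocks of sizes `μ_1, …, μ_n` of `{0, …, 2d}`. -/
def block {n : ℕ} (d : ℕ) (μ : Fin n → ℕ) (i : Fin n) : Finset (Fin (2 * d + 1)) :=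
  Finset.univ.filter fun k =>
    (∑ j ∈ Finset.Iio i, μ j) ≤ (k : ℕ) ∧ (k : ℕ) < ∑ j ∈ Finset.Iic i, μ j

/-- The matrix which labels the double coset `W_lam w W_μ`: its `(i, j)` entry is the number of
elements of the `j`-th block of `μ` which `w` sends to the `i`-th block of `lam`. -/
def relPos {n d : ℕ} (lam μ : Fin n → ℕ) (w : WB d) : Matrix (Fin n) (Fin n) ℤ :=
  fun i j => (((block d μ j).filter fun k => w.1 k ∈ block d lam i).card : ℤ)

/-- The double coset labelled by `M` (empty unless `M` has nonnegative entries, is centrally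
symmetric, and has row sums `lam` and column sums `μ`). -/
def coset {n d : ℕ} (lam μ : Fin n → ℕ) (M : Matrix (Fin n) (Fin n) ℤ) : Finset (WB d) :=
  (Set.toFinite {w : WB d | relPos lam μ w = M}).toFinset

/-- The parabolic subgroup `W_μ`. -/
def parab {n : ℕ} (d : ℕ) (μ : Fin n → ℕ) : Finset (WB d) :=
  (Set.toFinite {w : WB d | ∀ i, ∀ k ∈ block d μ i, w.1 k ∈ block d μ i}).toFinset

/-- The standard basis element `[M]_d` of the `j`-Schur algebra, for `M` a centrally symmetric
matrix of natural numbers with sum of entries `2d + 1`; it is `0` for other integer matrices.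
With `lam` the row sums, `μ` the column sums, and `O_M` the double coset of `M`, it is
`v^{- dim} e_M`, where `e_M` is the homomorphism `x_μ ↦ ∑_{w ∈ O_M} T_w` from `x_μ H` to `x_lam H`
(the characteristic function of the orbit of `M` in the convolution algebra of pairs of flags),
given by the element `(∑_{w ∈ O_M} T_w) / P_μ` of `e_lam H e_μ`, and where
`dim = max ℓ (O_M) - max ℓ (W_μ)` is the dimension of the fibres of the first projection from the
orbit of `M` to the flags of type `lam`. -/
def std (n d : ℕ) (M : Matrix (Fin n) (Fin n) ℤ) : SchurMat n d := fun lam μ =>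
  (v ^ (((Finset.sup (parab d μ.1) len : ℕ) : ℤ) -
      ((Finset.sup (coset (d := d) lam.1 μ.1 M) len : ℕ) : ℤ)) /
      ∑ w ∈ parab d μ.1, v ^ (2 * len w)) •
    ∑ w ∈ coset (d := d) lam.1 μ.1 M, T w

/-- The bar involution of the `j`-Schur algebra (the idempotents `e_μ` are bar-invariant). -/
def barSchur {n d : ℕ} (X : SchurMat n d) : SchurMat n d := fun lam μ => barHecke (X lam μ)

/-! ### Stabilization: the modified quantum coideal algebra `U̇ʲ(gl_n)`, `n` odd -/

/-- The index set `Ξ̃`: integer matrices with nonnegative off-diagonal entries, odd central entry,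
invariant under rotation by 180 degrees. -/
def TXi (n : ℕ) : Type :=
  {A : Matrix (Fin n) (Fin n) ℤ //
    (∀ i j, i ≠ j → 0 ≤ A i j) ∧ (∀ i, i.rev = i → Odd (A i i)) ∧
      ∀ i j, A i.rev j.rev = A i j}

/-- `A + p I`. -/
def shift {n : ℕ} (p : ℕ) (A : TXi n) : Matrix (Fin n) (Fin n) ℤ :=
  A.1 + (p : ℤ) • (1 : Matrix (Fin n) (Fin n) ℤ)

/-- The value at `v' = x` of a Laurent polynomial in `v'` over `ℚ(v)`. -/
def evalLaurent (g : ℤ →₀ Qv) (x : Qv) : Qv := g.sum fun k c => c * x ^ k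

/-- The elements `F p d` of the `j`-Schur algebras have the stable expansion
`F p d = ∑_Z G_Z(v, v^{-p}) [Z + p I]_d` for all large even `p` and all `d`, with finitely many
`G_Z ∈ ℚ(v)[v', v'⁻¹]` independent of `p` and `d`. -/
def HasStableExpansion {n : ℕ} (F : (p d : ℕ) → SchurMat n d) (G : TXi n →₀ (ℤ →₀ Qv)) : Prop :=
  ∃ p₀ : ℕ, ∀ p ≥ p₀, Even p → ∀ d : ℕ,
    F p d = G.sum fun Z g => evalLaurent g (v ^ (-(p : ℤ))) • std n d (shift p Z)

/-- The vector space `U̇ʲ(gl_n)` over `ℚ(v)`, with the standard basis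
`[A] = Finsupp.single A 1`, `A ∈ Ξ̃`. -/
abbrev Uj (n : ℕ) : Type := TXi n →₀ Qv

open Classical in
/-- The stable limit `∑_Z G_Z(v, 1) [Z]`. -/
def stableLimit {n : ℕ} (F : (p d : ℕ) → SchurMat n d) : Uj n :=
  if h : ∃ G, HasStableExpansion F G then
    h.choose.mapRange (fun g => evalLaurent g 1) (by simp [evalLaurent])
  else 0

/-- The product `[B] * [A]`. -/
def mulStd {n : ℕ} (B A : TXi n) : Uj n :=
  stableLimit fun p d => std n d (shift p B) * std n d (shift p A)

/-- The multiplication of `U̇ʲ(gl_n)`. -/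
def mul {n : ℕ} (x y : Uj n) : Uj n :=
  x.sum fun B b => y.sum fun A a => (b * a) • mulStd B A

/-- The bar conjugate of `[A]`. -/
def barStd {n : ℕ} (A : TXi n) : Uj n :=
  stableLimit fun p d => barSchur (std n d (shift p A))

/-- The bar involution of `U̇ʲ(gl_n)`. -/
def bar {n : ℕ} (x : Uj n) : Uj n := x.sum fun A a => barQ a • barStd A

/-! ### The stably canonical basis -/

/-- The partial order `A' ⊑ A`. -/
def Below {n : ℕ} (A' A : TXi n) : Prop :=
  (∀ i j : Fin n, i < j →
    ∑ r ∈ Finset.Iic i, ∑ s ∈ Finset.Ici j, A'.1 r s ≤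
      ∑ r ∈ Finset.Iic i, ∑ s ∈ Finset.Ici j, A.1 r s) ∧
  (∀ i, ∑ j, A'.1 i j = ∑ j, A.1 i j) ∧
  (∀ j, ∑ i, A'.1 i j = ∑ i, A.1 i j)

/-- `x` is bar-invariant and lies in `[A] + ∑_{A' ⊏ A} v⁻¹ ℤ[v⁻¹] [A']`. -/
def IsStablyCanonical {n : ℕ} (A : TXi n) (x : Uj n) : Prop :=
  bar x = x ∧ x A = 1 ∧
    ∀ A', A' ≠ A → x A' ∈ negLattice ∧ (x A' ≠ 0 → Below A' A)

/-- There is exactly one stably canonical basis element indexed by `A`. -/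
def HasCB {n : ℕ} (A : TXi n) : Prop := ∃! x : Uj n, IsStablyCanonical A x

open Classical in
/-- The stably canonical basis element `{A}`. -/
def cb {n : ℕ} (A : TXi n) : Uj n := if h : HasCB A then h.choose else 0

/-- `g` is the family of structure constants in `{B} * {A} = ∑_C g_C {C}`. -/
def IsStructureConstants {n : ℕ} (B A : TXi n) (g : TXi n →₀ Qv) : Prop :=
  HasCB B ∧ HasCB A ∧ (∀ C, g C ≠ 0 → HasCB C) ∧
    mul (cb B) (cb A) = g.sum fun C c => c • cb C

/-! ### The matrices of the example for `n = 3` -/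

def matA (a b : ℤ) (hb : Odd b) : TXi 3 :=
  ⟨!![a, 1, 0; 0, b, 0; 0, 1, a], by
    refine ⟨?_, ?_, ?_⟩
    · intro i j hij; fin_cases i <;> fin_cases j <;> simp at hij ⊢
    · intro i hi; fin_cases i <;> simp [Fin.ext_iff] at hi ⊢; exact hb
    · intro i j; fin_cases i <;> fin_cases j <;> rfl⟩

def matB (a b : ℤ) (hb : Odd b) : TXi 3 :=
  ⟨!![a, 0, 0; 1, b, 1; 0, 0, a], by
    refine ⟨?_, ?_, ?_⟩
    · intro i j hij; fin_cases i <;> fin_cases j <;> simp at hij ⊢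
    · intro i hi; fin_cases i <;> simp [Fin.ext_iff] at hi ⊢; exact hb
    · intro i j; fin_cases i <;> fin_cases j <;> rfl⟩

def matC (a b : ℤ) (hb : Odd b) : TXi 3 :=
  ⟨!![a - 1, 1, 0; 1, b, 1; 0, 1, a - 1], by
    refine ⟨?_, ?_, ?_⟩
    · intro i j hij; fin_cases i <;> fin_cases j <;> simp at hij ⊢
    · intro i hi; fin_cases i <;> simp [Fin.ext_iff] at hi ⊢; exact hb
    · intro i j; fin_cases i <;> fin_cases j <;> rfl⟩

def matD (a b : ℤ) (hb : Odd b) : TXi 3 :=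
  ⟨!![a, 0, 0; 0, b + 2, 0; 0, 0, a], by
    refine ⟨?_, ?_, ?_⟩
    · intro i j hij; fin_cases i <;> fin_cases j <;> simp at hij ⊢
    · intro i hi
      fin_cases i <;> simp [Fin.ext_iff] at hi ⊢
      exact hb
    · intro i j; fin_cases i <;> fin_cases j <;> rfl⟩

end JSchur

end

noncomputable section

namespace JSchur

section

/-! ### Arithmetic of `ℚ(v)` -/

/-! Write `c = v^{-(a+b)} [b+1]` (`prodCoeff`). Everything rests on the identity `[B] * [A] = [C] +
c [D]` and on the bar-invariance of `[A]`, `[B]`, `[D]`. For general odd `n` the four matrices keep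
the central 3×3 shape and have `a` on the remaining diagonal (`exA`, `exB`, `exC`, `exD`).

At the finite level `a, b > 0`. Let `λ`, `μ` be the row and column compositions of `A`. Then `λ`
arises from `μ` by moving one position (and its mirror image) from the central block into the
neighbouring one, `A` labels the double coset `W_λ W_μ`, and `B` labels `W_μ W_λ`. Each is a union
of left cosets whose minimal representatives form a single chain `1, s, s's, …`, of `a + 1` elements
for `A` and of `b + 1` elements for `B`. Hence `[A]_d` and `[B]_d` are powers of `v` times a chain
sum times an idempotent (`std_left`, `std_mid`). In the product of the two chain sums, the terms
which contain only the `1` of the chain of `A` act on `e_μ` by a scalar and give `c e_μ = c [D]_d`;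
the others give `[C]_d` (`std_mid_mul_std_left`, `exB_mul_exA`).

Bar-invariance holds because `[A]_d` and `[B]_d` are multiples, by symmetric Laurent polynomials, of
`e_λ e_μ` and `e_μ e_λ`, and the idempotents are bar-invariant (`barHecke_idem`). Applying bar to
the product formula yields the bar conjugate `[C] + (c - c̄) [D]` of `[C]` (`barSchur_exC`). All
this needs the standard basis and the multiplicative bar involution of the Hecke algebra, which is
given only through operators on its regular module (`heckeCoeff_injective`, `barHecke_mul`).

After the shift by `p`, `c` becomes a polynomial in `v' = v^{-p}`, so the formulas pass to the
stable limit, which is well defined by `HasStableExpansion.unique`. There `b` may be negative, and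
the sign comes from `[b+1]`, which at the finite level always has a positive argument. Below `A`,
`B`, `D` there is nothing else in the order, and below `C` only `D`, so `{A} = [A]`, `{B} = [B]`,
`{D} = [D]`. For `a < b ≤ -2` the element `-c̄` lies in `v⁻¹ ℤ[v⁻¹]`, hence `{C} = [C] - c̄ [D]`
(`cb_txC`) and `{B} * {A} = {C} + (c + c̄) {D}`, where `c + c̄` is nonzero with nonpositive
coefficients. -/

theorem v_ne_zero : v ≠ 0 := RatFunc.X_ne_zero

theorem v_zpow_ne_zero (k : ℤ) : v ^ k ≠ 0 := zpow_ne_zero k v_ne_zero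

/-- The value in `ℚ(v)` of a Laurent polynomial over `ℚ`. -/
def laurentVal (c : ℤ →₀ ℚ) : Qv := c.sum fun k m => RatFunc.C m * v ^ k

/-- Multiplication by a power of `v` moves the sum into `ℚ[X]`, which embeds in `ℚ(v)`. Thus
identities between Laurent polynomials can be compared coefficient by coefficient. -/
theorem laurentVal_eq_zero {c : ℤ →₀ ℚ} (h : laurentVal c = 0) : c = 0 := by
  obtain ⟨N, hN⟩ : ∃ N : ℕ, ∀ k ∈ c.support, 0 ≤ k + N := by
    refine ⟨c.support.sup Int.natAbs, fun k hk => ?_⟩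
    have := Finset.le_sup (f := Int.natAbs) hk
    omega
  set p : Polynomial ℚ := ∑ k ∈ c.support, Polynomial.monomial (k + N).toNat (c k) with hp
  have h1 : algebraMap (Polynomial ℚ) Qv p = laurentVal c * v ^ (N : ℤ) := by
    rw [hp, map_sum, laurentVal, Finsupp.sum, Finset.sum_mul]
    refine Finset.sum_congr rfl fun k hk => ?_
    rw [mul_assoc, ← zpow_add₀ v_ne_zero, ← Polynomial.C_mul_X_pow_eq_monomial, map_mul, map_pow,
      RatFunc.algebraMap_X, RatFunc.algebraMap_C]
    conv_rhs => rw [← Int.toNat_of_nonneg (hN k hk)]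
    rw [zpow_natCast]
    rfl
  rw [h, zero_mul, map_eq_zero_iff _ (RatFunc.algebraMap_injective ℚ)] at h1
  ext k
  by_contra hk
  have hks : k ∈ c.support := Finsupp.mem_support_iff.2 hk
  have h2 := congrArg (fun q => Polynomial.coeff q (k + N).toNat) h1
  simp only [hp, Polynomial.finsetSum_coeff, Polynomial.coeff_monomial,
    Polynomial.coeff_zero] at h2
  rw [Finset.sum_eq_single k] at h2
  · simp at h2
    exact hk h2
  · intro j hj hjk
    rw [if_neg]
    have := hN j hj
    have := hN k hks
    omega
  · intro h; exact absurd hks h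

theorem laurentVal_add (c c' : ℤ →₀ ℚ) : laurentVal (c + c') = laurentVal c + laurentVal c' := by
  unfold laurentVal
  rw [Finsupp.sum_add_index'] <;> simp [add_mul]

theorem laurentVal_neg (c : ℤ →₀ ℚ) : laurentVal (-c) = -laurentVal c := by
  unfold laurentVal
  rw [Finsupp.sum_neg_index] <;> simp

/-- Two families of nonnegative coefficients with sum zero both vanish. Non-positivity is detected
in this form: a nonzero element whose negative is positive cannot be positive. -/
theorem eq_zero_of_neg_mem_NLaurent {f : Qv} (h : f ∈ NLaurent) (h' : -f ∈ NLaurent) : f = 0 := by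
  obtain ⟨c, hc⟩ := h
  obtain ⟨c', hc'⟩ := h'
  have key : ∀ c : ℤ →₀ ℕ, (c.sum fun k m => (m : Qv) * v ^ k) =
      laurentVal (c.mapRange (fun m : ℕ => (m : ℚ)) (by simp)) := by
    intro c
    rw [laurentVal, Finsupp.sum_mapRange_index (by simp)]
    simp
  rw [key] at hc hc'
  have h0 := laurentVal_eq_zero (c := c.mapRange (fun m : ℕ => (m : ℚ)) (by simp) +
    c'.mapRange (fun m : ℕ => (m : ℚ)) (by simp)) (by rw [laurentVal_add, ← hc, ← hc']; ring)
  have h1 : c = 0 := by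
    ext k
    have := DFunLike.congr_fun h0 k
    simp only [Finsupp.coe_add, Pi.add_apply, Finsupp.mapRange_apply, Finsupp.coe_zero,
      Pi.zero_apply] at this
    have h2 : (c k : ℚ) = 0 := by
      have := Nat.cast_nonneg (α := ℚ) (c k)
      have := Nat.cast_nonneg (α := ℚ) (c' k)
      linarith
    simpa using h2
  rw [hc, h1]
  simp [laurentVal]

theorem barQ_zpow (k : ℤ) : barQ (v ^ k) = v ^ (-k) := by
  rw [map_zpow₀, barQ_v, inv_zpow, zpow_neg]

theorem barQ_pow (k : ℕ) : barQ (v ^ k) = v ^ (-(k : ℤ)) := by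
  rw [← zpow_natCast, barQ_zpow]

/-- No nonzero element of `v⁻¹ ℤ[v⁻¹]` is invariant under the bar involution. -/
theorem eq_zero_of_mem_negLattice {x : Qv} (hx : x ∈ negLattice) (h : barQ x = x) : x = 0 := by
  obtain ⟨c, hc⟩ := hx
  -- The exponents of `x` are the negative numbers `-k - 1` and those of its conjugate the positive
  -- numbers `k + 1`; the two supports are disjoint.
  let e₁ : ℕ ↪ ℤ := ⟨fun k => (k : ℤ) + 1, fun a b h => by simpa using h⟩
  let e₂ : ℕ ↪ ℤ := ⟨fun k => -(k : ℤ) - 1, fun a b h => by simpa using h⟩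
  have he₁ : ∀ k, e₁ k = (k : ℤ) + 1 := fun _ => rfl
  have he₂ : ∀ k, e₂ k = -(k : ℤ) - 1 := fun _ => rfl
  let d : ℕ →₀ ℚ := c.mapRange (fun m : ℤ => (m : ℚ)) (by simp)
  have h2 : x = laurentVal (d.embDomain e₂) := by
    rw [laurentVal, Finsupp.sum_embDomain, Finsupp.sum_mapRange_index (by simp), hc]
    simp [he₂]
  have h1 : barQ x = laurentVal (d.embDomain e₁) := by
    rw [hc, Finsupp.sum, map_sum, laurentVal, Finsupp.sum_embDomain,
      Finsupp.sum_mapRange_index (by simp), Finsupp.sum]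
    refine Finset.sum_congr rfl fun k _ => ?_
    rw [map_mul, barQ_zpow]
    simp [he₁, add_comm]
  have h0 := laurentVal_eq_zero (c := d.embDomain e₁ + -d.embDomain e₂) (by
    rw [laurentVal_add, laurentVal_neg, ← h1, ← h2, h]; ring)
  have hd : c = 0 := by
    ext k
    have := DFunLike.congr_fun h0 (e₁ k)
    rw [Finsupp.add_apply, Finsupp.neg_apply, Finsupp.embDomain_apply_self,
      Finsupp.embDomain_of_notMem_range] at this
    · simpa [d] using this
    · rintro ⟨j, hj⟩
      rw [he₁, he₂] at hj
      omega
  rw [hc, hd]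
  simp

/-- At `v = 1` the sum becomes the number of its terms. This makes Poincaré polynomials invertible
in `ℚ(v)`. -/
theorem sum_pow_v_ne_zero {ι : Type*} {s : Finset ι} (hs : s.Nonempty) (f : ι → ℕ) :
    ∑ i ∈ s, v ^ f i ≠ 0 := by
  have h1 : algebraMap (Polynomial ℚ) Qv (∑ i ∈ s, Polynomial.X ^ f i) = ∑ i ∈ s, v ^ f i := by
    simp [v]
  rw [← h1, Ne, map_eq_zero_iff _ (RatFunc.algebraMap_injective ℚ)]
  intro h
  have := congrArg (Polynomial.eval 1) h
  simp [Polynomial.eval_finsetSum, hs.ne_empty] at this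

theorem v_zpow_injective : Function.Injective fun k : ℤ => v ^ k := by
  intro a b hab
  by_contra hne
  have h0 := laurentVal_eq_zero (c := Finsupp.single a 1 + -Finsupp.single b 1) (by
    rw [laurentVal_add, laurentVal_neg]
    simpa [laurentVal, sub_eq_zero, ← sub_eq_add_neg] using hab)
  have := DFunLike.congr_fun h0 a
  simp [hne] at this

theorem v_sq_sub_one_ne_zero : v ^ 2 - 1 ≠ 0 := by
  intro h
  have := @v_zpow_injective 2 0 (by simpa [sub_eq_zero] using h)
  omega

/-- A Laurent polynomial in `v'` over `ℚ(v)` which vanishes at `v' = v^{-p}` for all large even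
`p` is zero. -/
theorem laurent_eq_zero_of_evalLaurent {g : ℤ →₀ Qv} {p₀ : ℕ}
    (h : ∀ p ≥ p₀, Even p → evalLaurent g (v ^ (-(p : ℤ))) = 0) : g = 0 := by
  obtain ⟨N, hN⟩ : ∃ N : ℕ, ∀ k ∈ g.support, 0 ≤ k + N := by
    refine ⟨g.support.sup Int.natAbs, fun k hk => ?_⟩
    have := Finset.le_sup (f := Int.natAbs) hk
    omega
  set P : Polynomial Qv := ∑ k ∈ g.support, Polynomial.monomial (k + N).toNat (g k) with hP
  have h1 : ∀ x : Qv, x ≠ 0 → P.eval x = evalLaurent g x * x ^ (N : ℤ) := by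
    intro x hx
    rw [hP, Polynomial.eval_finsetSum, evalLaurent, Finsupp.sum, Finset.sum_mul]
    refine Finset.sum_congr rfl fun k hk => ?_
    rw [mul_assoc, ← zpow_add₀ hx, Polynomial.eval_monomial]
    conv_rhs => rw [← Int.toNat_of_nonneg (hN k hk)]
    rw [zpow_natCast]
  -- `P` vanishes at the infinitely many distinct points `v^{-p}` with `p ≥ p₀` even.
  have h2 : P = 0 := by
    apply Polynomial.eq_of_infinite_eval_eq
    refine Set.Infinite.mono (s := Set.range fun j : ℕ => v ^ (-((2 * (p₀ + j) : ℕ) : ℤ))) ?_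
      (Set.infinite_range_of_injective ?_)
    · rintro _ ⟨j, rfl⟩
      simp only [Set.mem_ofPred_eq, Polynomial.eval_zero]
      rw [h1 _ (v_zpow_ne_zero _), h _ (by omega) (by simp), zero_mul]
    · intro a b hab
      have := v_zpow_injective hab
      omega
  ext1 k
  by_contra hk
  have hks : k ∈ g.support := Finsupp.mem_support_iff.2 hk
  have h3 := congrArg (fun q => Polynomial.coeff q (k + N).toNat) h2
  simp only [hP, Polynomial.finsetSum_coeff, Polynomial.coeff_monomial,
    Polynomial.coeff_zero] at h3
  rw [Finset.sum_eq_single k] at h3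
  · simp at h3
    exact hk h3
  · intro j hj hjk
    rw [if_neg]
    have := hN j hj
    have := hN k hks
    omega
  · intro h; exact absurd hks h

theorem evalLaurent_sub (g g' : ℤ →₀ Qv) (x : Qv) :
    evalLaurent (g - g') x = evalLaurent g x - evalLaurent g' x := by
  unfold evalLaurent
  rw [Finsupp.sum_sub_index]
  intros
  ring

theorem evalLaurent_add (g g' : ℤ →₀ Qv) (x : Qv) :
    evalLaurent (g + g') x = evalLaurent g x + evalLaurent g' x := by
  unfold evalLaurent
  rw [Finsupp.sum_add_index'] <;> simp [add_mul]

@[simp] theorem evalLaurent_single (k : ℤ) (c x : Qv) :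
    evalLaurent (Finsupp.single k c) x = c * x ^ k := by
  simp [evalLaurent]

@[simp] theorem evalLaurent_zero (x : Qv) : evalLaurent 0 x = 0 := by
  simp [evalLaurent]

/-- `∑_{j < m} q^j`, `q = v²`. -/
def qNat (m : ℕ) : Qv := ∑ j ∈ Finset.range m, (v ^ 2) ^ j

theorem qNat_eq (m : ℕ) : qNat m = (v ^ (2 * (m : ℤ)) - 1) / (v ^ 2 - 1) := by
  rw [qNat, geom_sum_eq (by rw [← sub_ne_zero]; exact v_sq_sub_one_ne_zero), ← pow_mul]
  norm_cast

theorem qNat_ne_zero {m : ℕ} (hm : 0 < m) : qNat m ≠ 0 := by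
  unfold qNat
  simp_rw [← pow_mul]
  exact sum_pow_v_ne_zero ⟨0, Finset.mem_range.2 hm⟩ _

/-- The substitution `j ↦ m - j` reverses the geometric sum. Consequently `v^{-m} qNat (m + 1)` is
bar-invariant. -/
theorem barQ_qNat_succ (m : ℕ) : barQ (qNat (m + 1)) = v ^ (-2 * (m : ℤ)) * qNat (m + 1) := by
  rw [qNat, map_sum, ← Finset.sum_range_reflect, Finset.mul_sum]
  refine Finset.sum_congr rfl fun j hj => ?_
  have hj' := Finset.mem_range.1 hj
  rw [← pow_mul, ← pow_mul, barQ_pow, ← zpow_natCast, ← zpow_add₀ v_ne_zero]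
  congr 1
  push_cast
  omega

end

section

/-! ### The length function of the Weyl group of type `B_d` -/

variable {d : ℕ}

theorem wb_rev (w : WB d) (x : Fin (2 * d + 1)) : w.1 x.rev = (w.1 x).rev := by
  have h := Subgroup.mem_centralizer_singleton_iff.1 w.2
  have := DFunLike.congr_fun h x
  simpa using this

theorem wb_inv_rev (w : WB d) (x : Fin (2 * d + 1)) : w.1⁻¹ x.rev = (w.1⁻¹ x).rev :=
  wb_rev w⁻¹ x

@[simp] theorem wb_coe_mul (x y : WB d) : (x * y).1 = x.1 * y.1 := rfl

@[simp] theorem wb_coe_inv (x : WB d) : (x⁻¹).1 = x.1⁻¹ := rfl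

@[simp] theorem wb_coe_one : (1 : WB d).1 = 1 := rfl

/-- The position `i`. -/
def lowPos (i : Fin d) : Fin (2 * d + 1) := ⟨i, by omega⟩

/-- The position `i + 1`. -/
def highPos (i : Fin d) : Fin (2 * d + 1) := ⟨i + 1, by omega⟩

theorem simpleRefl_val (i : Fin d) (x : Fin (2 * d + 1)) :
    ((simpleRefl d i).1 x : ℕ) =
      if (i : ℕ) + 1 < d then
        (if (x : ℕ) = i then (i : ℕ) + 1 else if (x : ℕ) = i + 1 then (i : ℕ)
          else if (x : ℕ) = 2 * d - i then 2 * d - i - 1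
          else if (x : ℕ) = 2 * d - i - 1 then 2 * d - i else x)
      else (if (x : ℕ) = i then 2 * d - i else if (x : ℕ) = 2 * d - i then (i : ℕ) else x) := by
  have hi := i.2
  have hx := x.2
  simp only [simpleRefl, simplePerm]
  split_ifs with h <;>
    simp only [Equiv.Perm.mul_apply, Equiv.swap_apply_def, Fin.ext_iff, Fin.val_rev] <;>
    split_ifs <;> (try simp only [Fin.val_rev] at *) <;> omega

theorem simpleRefl_mul_self (i : Fin d) : simpleRefl d i * simpleRefl d i = 1 := by
  apply Subtype.ext
  ext x
  have hi := i.2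
  have hx := x.2
  simp only [wb_coe_mul, Equiv.Perm.mul_apply, simpleRefl_val, wb_coe_one, Equiv.Perm.one_apply]
  split_ifs <;> omega

@[simp] theorem simpleRefl_inv (i : Fin d) : (simpleRefl d i)⁻¹ = simpleRefl d i :=
  inv_eq_of_mul_eq_one_right (simpleRefl_mul_self i)

@[simp] theorem simpleRefl_mul_cancel_left (i : Fin d) (w : WB d) :
    simpleRefl d i * (simpleRefl d i * w) = w := by
  rw [← mul_assoc, simpleRefl_mul_self, one_mul]

@[simp] theorem simpleRefl_mul_cancel_right (i : Fin d) (w : WB d) :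
    w * simpleRefl d i * simpleRefl d i = w := by
  rw [mul_assoc, simpleRefl_mul_self, mul_one]

theorem simpleRefl_apply_apply (i : Fin d) (x : Fin (2 * d + 1)) :
    (simpleRefl d i).1 ((simpleRefl d i).1 x) = x := by
  have := congrArg (fun w : WB d => w.1 x) (simpleRefl_mul_self i)
  simpa using this

/-- The inverted pairs of `w`, without the pairs of opposite positions. -/
def invSet (w : WB d) : Finset (Fin (2 * d + 1) × Fin (2 * d + 1)) :=
  Finset.univ.filter fun p => p.1 < p.2 ∧ p.2 ≠ p.1.rev ∧ w.1 p.2 < w.1 p.1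

theorem mem_invSet {w : WB d} {p q : Fin (2 * d + 1)} :
    (p, q) ∈ invSet w ↔ p < q ∧ q ≠ p.rev ∧ w.1 q < w.1 p := by
  simp [invSet]

/-- A pair is inverted by `x y` if `y` keeps its order and `x` inverts the image, or if `y` inverts
it and `x` does not restore the order. Disjointness says that `x` restores no pair inverted by `y`,
so both sources count in full. -/
theorem card_invSet_mul {x y : WB d} (h : Disjoint (invSet x) (invSet y⁻¹)) :
    (invSet (x * y)).card = (invSet x).card + (invSet y).card := by
  rw [Finset.disjoint_left] at h
  have key : invSet (x * y) =
      (invSet x).map (Equiv.prodCongr y.1⁻¹ y.1⁻¹).toEmbedding ∪ invSet y := by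
    ext ⟨p, q⟩
    rw [Finset.mem_union, Finset.mem_map_equiv]
    change _ ↔ (y.1 p, y.1 q) ∈ invSet x ∨ _
    rw [mem_invSet (w := x * y), mem_invSet (w := y)]
    simp only [wb_coe_mul, Equiv.Perm.mul_apply]
    have hne : q ≠ p.rev ↔ y.1 q ≠ (y.1 p).rev := by
      rw [← wb_rev, Ne, Ne, y.1.injective.eq_iff]
    constructor
    · rintro ⟨h1, h2, h3⟩
      rcases lt_trichotomy (y.1 p) (y.1 q) with h4 | h4 | h4
      · exact Or.inl (mem_invSet.2 ⟨h4, hne.1 h2, h3⟩)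
      · exact absurd (y.1.injective h4) h1.ne
      · exact Or.inr ⟨h1, h2, h4⟩
    · rintro (h1 | ⟨h1, h2, h3⟩)
      · have h0 := h h1
        rw [mem_invSet] at h0 h1
        have hinv : ∀ z, y.1⁻¹ (y.1 z) = z := y.1.symm_apply_apply
        simp only [wb_coe_inv, hinv, not_and, not_lt] at h0
        refine ⟨lt_of_le_of_ne (h0 h1.1 h1.2.1) ?_, hne.2 h1.2.1, h1.2.2⟩
        rintro rfl
        exact h1.1.ne rfl
      · refine ⟨h1, h2, lt_of_not_ge fun h4 => ?_⟩
        have h5 : y.1 p ≠ (y.1 q).rev := by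
          exact fun h5 => hne.1 h2 (by rw [h5, Fin.rev_rev])
        have h6 : x.1 (y.1 p) < x.1 (y.1 q) := by
          refine lt_of_le_of_ne h4 fun h => h1.ne ?_
          exact y.1.injective (x.1.injective h)
        refine h (mem_invSet.2 ⟨h3, h5, h6⟩) (mem_invSet.2 ⟨h3, h5, ?_⟩)
        simpa using h1
  rw [key, Finset.card_union_of_disjoint, Finset.card_map]
  rw [Finset.disjoint_left]
  rintro ⟨p, q⟩ h1 h2
  rw [Finset.mem_map_equiv] at h1
  change (y.1 p, y.1 q) ∈ invSet x at h1
  rw [mem_invSet] at h1 h2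
  exact absurd h1.1 h2.2.2.not_gt

theorem mem_invSet_simpleRefl {i : Fin d} {p q : Fin (2 * d + 1)} :
    (p, q) ∈ invSet (simpleRefl d i) ↔
      (p = lowPos i ∧ q = highPos i) ∨ (p = (highPos i).rev ∧ q = (lowPos i).rev) := by
  have hi := i.2
  have hp := p.2
  have hq := q.2
  simp only [mem_invSet, Fin.lt_def, Fin.ext_iff, lowPos, highPos, Fin.val_rev, ne_eq,
    simpleRefl_val]
  split_ifs <;> omega

/-- Omitting opposite pairs makes the number the same for all generators. The last one swaps `d - 1`
and `d + 1`; it inverts `(d - 1, d)`, `(d, d + 1)` and the opposite pair `(d - 1, d + 1)`, which is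
not counted. -/
theorem card_invSet_simpleRefl (i : Fin d) : (invSet (simpleRefl d i)).card = 2 := by
  have : invSet (simpleRefl d i) =
      {(lowPos i, highPos i), ((highPos i).rev, (lowPos i).rev)} := by
    ext ⟨p, q⟩
    simp [mem_invSet_simpleRefl]
  rw [this, Finset.card_pair]
  have hi := i.2
  simp only [ne_eq, Prod.mk.injEq, Fin.ext_iff, lowPos, highPos, Fin.val_rev]
  omega

theorem card_invSet_simpleRefl_mul {i : Fin d} {w : WB d}
    (h : w.1⁻¹ (lowPos i) < w.1⁻¹ (highPos i)) :
    (invSet (simpleRefl d i * w)).card = 2 + (invSet w).card := by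
  rw [card_invSet_mul, card_invSet_simpleRefl]
  rw [Finset.disjoint_left]
  rintro ⟨p, q⟩ h1 h2
  rw [mem_invSet_simpleRefl] at h1
  rw [mem_invSet] at h2
  rcases h1 with ⟨rfl, rfl⟩ | ⟨rfl, rfl⟩
  · exact absurd h2.2.2 h.not_gt
  · have h3 := h2.2.2
    rw [wb_rev, wb_rev, Fin.rev_lt_rev] at h3
    exact absurd h3 h.not_gt

theorem lowPos_lt_highPos (i : Fin d) : lowPos i < highPos i := by
  simp [lowPos, highPos, Fin.lt_def]

theorem highPos_ne_rev_lowPos (i : Fin d) : highPos i ≠ (lowPos i).rev := by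
  have := i.2
  simp only [lowPos, highPos, ne_eq, Fin.ext_iff, Fin.val_rev]
  omega

/-- For `i + 1 < d` the reflection exchanges the two positions. For the last one, `highPos i` is the
centre, which every element of the group fixes, and `lowPos i` goes to its mirror image; mirroring
reverses the comparison with the centre. -/
theorem simpleRefl_flip (i : Fin d) (w : WB d) :
    (simpleRefl d i * w).1⁻¹ (lowPos i) < (simpleRefl d i * w).1⁻¹ (highPos i) ↔
      ¬ w.1⁻¹ (lowPos i) < w.1⁻¹ (highPos i) := by
  have hi := i.2
  have e : ∀ x, (simpleRefl d i * w).1⁻¹ x = w.1⁻¹ ((simpleRefl d i).1 x) := by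
    intro x
    rw [← wb_coe_inv, mul_inv_rev, simpleRefl_inv]
    rfl
  rw [e, e]
  by_cases h : (i : ℕ) + 1 < d
  · have h1 : (simpleRefl d i).1 (lowPos i) = highPos i := by
      ext; rw [simpleRefl_val]; simp [lowPos, highPos, h]
    have h2 : (simpleRefl d i).1 (highPos i) = lowPos i := by
      ext; rw [simpleRefl_val]; simp [lowPos, highPos, h]
    rw [h1, h2, not_lt]
    refine ⟨le_of_lt, fun h3 => lt_of_le_of_ne h3 fun h4 => ?_⟩
    exact (lowPos_lt_highPos i).ne (w.1⁻¹.injective h4).symm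
  · have h1 : (simpleRefl d i).1 (lowPos i) = (lowPos i).rev := by
      ext; rw [simpleRefl_val]; simp [lowPos, h, Fin.val_rev]
    have h2 : (simpleRefl d i).1 (highPos i) = highPos i := by
      ext; rw [simpleRefl_val]; rw [if_neg h, if_neg (by simp [highPos]), if_neg (by simp [highPos]; omega)]
    have h3 : highPos i = (highPos i).rev := by
      ext; simp [highPos, Fin.val_rev]; omega
    rw [h1, h2, wb_inv_rev]
    have h4 := wb_inv_rev w (highPos i)
    rw [← h3] at h4
    have h5 : w.1⁻¹ (lowPos i) ≠ w.1⁻¹ (highPos i) := fun h6 =>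
      (lowPos_lt_highPos i).ne (w.1⁻¹.injective h6)
    simp only [Fin.lt_def, Fin.ext_iff, Fin.val_rev, ne_eq] at *
    omega

theorem card_invSet_simpleRefl_mul' {i : Fin d} {w : WB d}
    (h : ¬ w.1⁻¹ (lowPos i) < w.1⁻¹ (highPos i)) :
    (invSet w).card = 2 + (invSet (simpleRefl d i * w)).card := by
  have := card_invSet_simpleRefl_mul ((simpleRefl_flip i w).2 h)
  rwa [simpleRefl_mul_cancel_left] at this

/-- By symmetry, a permutation increasing on the left half up to the centre is increasing
everywhere, and the only increasing permutation is the identity. -/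
theorem eq_one_of_forall_lt {w : WB d} (h : ∀ i : Fin d, w.1 (lowPos i) < w.1 (highPos i)) :
    w = 1 := by
  have h1 : StrictMono w.1 := by
    rw [Fin.strictMono_iff_lt_succ]
    intro j
    by_cases hj : (j : ℕ) < d
    · exact h ⟨j, hj⟩
    · have hj2 := j.2
      have h2 := h ⟨2 * d - 1 - j, by omega⟩
      have e1 : j.castSucc = (highPos ⟨2 * d - 1 - j, by omega⟩ : Fin (2 * d + 1)).rev := by
        ext; simp [highPos, Fin.val_rev]; omega
      have e2 : j.succ = (lowPos ⟨2 * d - 1 - j, by omega⟩ : Fin (2 * d + 1)).rev := by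
        ext; simp [lowPos, Fin.val_rev]; omega
      rw [e1, e2, wb_rev, wb_rev, Fin.rev_lt_rev]
      exact h2
  have h2 : h1.orderIsoOfSurjective _ w.1.surjective = OrderIso.refl _ := Subsingleton.elim _ _
  apply Subtype.ext
  ext x
  exact congrArg Fin.val (DFunLike.congr_fun h2 x)

theorem invSet_one : invSet (1 : WB d) = ∅ := by
  ext ⟨p, q⟩
  simp only [mem_invSet, wb_coe_one, Equiv.Perm.one_apply, Finset.notMem_empty, iff_false]
  exact fun h => absurd h.1 h.2.2.not_gt

theorem exists_word (w : WB d) : ∃ l : List (Fin d),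
    2 * l.length = (invSet w).card ∧ (l.map (simpleRefl d)).prod = w := by
  induction hn : (invSet w).card using Nat.strong_induction_on generalizing w with
  | _ n ih =>
    by_cases hw : ∀ i : Fin d, w.1⁻¹ (lowPos i) < w.1⁻¹ (highPos i)
    · have : w⁻¹ = 1 := eq_one_of_forall_lt hw
      rw [inv_eq_one] at this
      subst this
      refine ⟨[], ?_, by simp⟩
      rw [← hn, invSet_one]
      rfl
    · push Not at hw
      obtain ⟨i, hi⟩ := hw
      have h1 := card_invSet_simpleRefl_mul' hi.not_gt
      obtain ⟨l, hl, hl'⟩ := ih _ (by omega) (simpleRefl d i * w) rfl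
      refine ⟨i :: l, ?_, ?_⟩
      · simp only [List.length_cons]
        omega
      · simp [hl']

theorem card_invSet_le (l : List (Fin d)) :
    (invSet (l.map (simpleRefl d)).prod).card ≤ 2 * l.length := by
  induction l with
  | nil => simp [invSet_one]
  | cons i l ih =>
    simp only [List.map_cons, List.prod_cons, List.length_cons]
    by_cases h : (l.map (simpleRefl d)).prod.1⁻¹ (lowPos i) <
        (l.map (simpleRefl d)).prod.1⁻¹ (highPos i)
    · rw [card_invSet_simpleRefl_mul h]
      omega
    · have := card_invSet_simpleRefl_mul' h
      omega

/-- Each letter changes the number of inverted pairs by exactly 2, which bounds the length from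
below. Removing left descents as long as there are any produces a word which attains the bound. -/
theorem two_mul_len (w : WB d) : 2 * len w = (invSet w).card := by
  obtain ⟨l, hl, hl'⟩ := exists_word w
  have hmem : l.length ∈ {k | ∃ l : List (Fin d), l.length = k ∧
      (l.map (simpleRefl d)).prod = w} := ⟨l, rfl, hl'⟩
  have h1 : len w ≤ l.length := Nat.sInf_le hmem
  obtain ⟨l', h2, h3⟩ := Nat.sInf_mem ⟨_, hmem⟩
  have h4 := card_invSet_le l'
  rw [h3] at h4
  change l'.length = len w at h2
  omega

theorem redWord_spec (w : WB d) :
    (redWord w).length = len w ∧ ((redWord w).map (simpleRefl d)).prod = w := by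
  obtain ⟨l, hl, hl'⟩ := exists_word w
  have h := two_mul_len w
  exact Classical.epsilon_spec
    (p := fun l : List (Fin d) => l.length = len w ∧ (l.map (simpleRefl d)).prod = w)
    ⟨l, by omega, hl'⟩

theorem len_one : len (1 : WB d) = 0 := by
  have := two_mul_len (1 : WB d)
  rw [invSet_one, Finset.card_empty] at this
  omega

theorem len_simpleRefl_mul {i : Fin d} {w : WB d}
    (h : w.1⁻¹ (lowPos i) < w.1⁻¹ (highPos i)) : len (simpleRefl d i * w) = len w + 1 := by
  have h1 := card_invSet_simpleRefl_mul h
  rw [← two_mul_len, ← two_mul_len] at h1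
  omega

theorem len_simpleRefl_mul' {i : Fin d} {w : WB d}
    (h : ¬ w.1⁻¹ (lowPos i) < w.1⁻¹ (highPos i)) : len w = len (simpleRefl d i * w) + 1 := by
  have h1 := card_invSet_simpleRefl_mul' h
  rw [← two_mul_len, ← two_mul_len] at h1
  omega

theorem len_lt_simpleRefl_mul_iff {i : Fin d} {w : WB d} :
    len w < len (simpleRefl d i * w) ↔ w.1⁻¹ (lowPos i) < w.1⁻¹ (highPos i) := by
  by_cases h : w.1⁻¹ (lowPos i) < w.1⁻¹ (highPos i)
  · exact iff_of_true (by rw [len_simpleRefl_mul h]; omega) h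
  · exact iff_of_false (by rw [len_simpleRefl_mul' h]; omega) h

theorem len_inv (w : WB d) : len w⁻¹ = len w := by
  have key : ∀ w : WB d, len w⁻¹ ≤ len w := by
    intro w
    obtain ⟨h1, h2⟩ := redWord_spec w
    rw [← h1]
    refine Nat.sInf_le ⟨(redWord w).reverse, by simp, ?_⟩
    conv_rhs => rw [← h2]
    rw [List.prod_inv_reverse, List.map_reverse, List.map_map]
    congr 3
    ext1 i
    simp
  exact le_antisymm (key w) (by simpa using key w⁻¹)

theorem len_mul_simpleRefl (w : WB d) (i : Fin d) :
    len (w * simpleRefl d i) = len (simpleRefl d i * w⁻¹) := by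
  rw [← len_inv (w * _)]
  simp

theorem len_lt_mul_simpleRefl_iff {i : Fin d} {w : WB d} :
    len w < len (w * simpleRefl d i) ↔ w.1 (lowPos i) < w.1 (highPos i) := by
  rw [len_mul_simpleRefl, ← len_inv w, len_lt_simpleRefl_mul_iff]
  simp

theorem len_simpleRefl_mul_cases (i : Fin d) (w : WB d) :
    len (simpleRefl d i * w) = len w + 1 ∨ len w = len (simpleRefl d i * w) + 1 := by
  by_cases h : w.1⁻¹ (lowPos i) < w.1⁻¹ (highPos i)
  · exact Or.inl (len_simpleRefl_mul h)
  · exact Or.inr (len_simpleRefl_mul' h)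

theorem wb_apply_center (w : WB d) {x : Fin (2 * d + 1)} (hx : x.rev = x) : w.1 x = x := by
  have h := wb_rev w x
  rw [hx] at h
  simp only [Fin.ext_iff, Fin.val_rev] at *
  omega

/-- If right multiplication by `t` affects the left descent `s` of `w` then `s w = w t`. -/
theorem mul_eq_mul_of_descent_change {i j : Fin d} {w : WB d}
    (h : ¬ ((simpleRefl d i * w).1 (lowPos j) < (simpleRefl d i * w).1 (highPos j) ↔
      w.1 (lowPos j) < w.1 (highPos j))) : simpleRefl d i * w = w * simpleRefl d j := by
  have hi := i.2
  have hj := j.2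
  have hne : w.1 (lowPos j) ≠ w.1 (highPos j) := fun h6 =>
    (lowPos_lt_highPos j).ne (w.1.injective h6)
  have hrev : w.1 (highPos j) ≠ (w.1 (lowPos j)).rev := by
    rw [← wb_rev]
    exact fun h6 => highPos_ne_rev_lowPos j (w.1.injective h6)
  -- Left multiplication by the reflection changes the relative order of two non-opposite values
  -- only if they are its own inverted pair or the mirror image of that pair. So `w` maps the pair
  -- of `j` onto one of these, in one of two orders.
  have hpair : (w.1 (lowPos j) = lowPos i ∧ w.1 (highPos j) = highPos i) ∨
      (w.1 (lowPos j) = (highPos i).rev ∧ w.1 (highPos j) = (lowPos i).rev) ∨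
      (w.1 (highPos j) = lowPos i ∧ w.1 (lowPos j) = highPos i) ∨
      (w.1 (highPos j) = (highPos i).rev ∧ w.1 (lowPos j) = (lowPos i).rev) := by
    have hs := (simpleRefl d i).1.injective.ne hne
    by_cases h1 : w.1 (lowPos j) < w.1 (highPos j)
    · have h2 : (w.1 (lowPos j), w.1 (highPos j)) ∈ invSet (simpleRefl d i) := by
        rw [mem_invSet]
        refine ⟨h1, hrev, ?_⟩
        simp only [h1, iff_true, not_lt, wb_coe_mul, Equiv.Perm.mul_apply] at h
        exact lt_of_le_of_ne h hs.symm
      rw [mem_invSet_simpleRefl] at h2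
      tauto
    · have h2 : (w.1 (highPos j), w.1 (lowPos j)) ∈ invSet (simpleRefl d i) := by
        rw [mem_invSet]
        refine ⟨lt_of_le_of_ne (not_lt.1 h1) hne.symm, ?_, ?_⟩
        · intro h3
          apply hrev
          rw [h3, Fin.rev_rev]
        · simpa [h1] using h
      rw [mem_invSet_simpleRefl] at h2
      tauto
  -- `highPos` is the centre exactly for the last reflection, and `w` fixes the centre; hence `i`
  -- and `j` are both last or both not last.
  have hcond : (i : ℕ) + 1 < d ↔ (j : ℕ) + 1 < d := by
    have h1 : (j : ℕ) + 1 = d ↔ (highPos j).rev = highPos j := by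
      simp only [highPos, Fin.ext_iff, Fin.val_rev]; omega
    have h2 : (i : ℕ) + 1 = d ↔ (highPos i).rev = highPos i := by
      simp only [highPos, Fin.ext_iff, Fin.val_rev]; omega
    have h3 : (lowPos i).rev ≠ lowPos i := by
      simp only [lowPos, ne_eq, Fin.ext_iff, Fin.val_rev]; omega
    have h4 : (lowPos j).rev ≠ lowPos j := by
      simp only [lowPos, ne_eq, Fin.ext_iff, Fin.val_rev]; omega
    have h5 : (highPos j).rev = highPos j ↔ (highPos i).rev = highPos i := by
      rw [← w.1.injective.eq_iff, wb_rev]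
      rw [Ne, ← w.1.injective.eq_iff, wb_rev] at h4
      rcases hpair with ⟨h6, h7⟩ | ⟨h6, h7⟩ | ⟨h6, h7⟩ | ⟨h6, h7⟩
      · rw [h7]
      · rw [h7, Fin.rev_rev]
        rw [h6, Fin.rev_rev] at h4
        exact ⟨fun h => absurd h.symm h3, fun h => absurd h.symm h4⟩
      · rw [h6]
        rw [h7] at h4
        exact ⟨fun h => absurd h h3, fun h => absurd h h4⟩
      · rw [h6, Fin.rev_rev]
        exact eq_comm
    omega
  apply Subtype.ext
  simp only [wb_coe_mul, simpleRefl, simplePerm]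
  by_cases hj' : (j : ℕ) + 1 < d
  · rw [if_pos hj', if_pos (hcond.2 hj')]
    change Equiv.swap (lowPos i) (highPos i) * Equiv.swap (lowPos i).rev (highPos i).rev * w.1 =
      w.1 * (Equiv.swap (lowPos j) (highPos j) * Equiv.swap (lowPos j).rev (highPos j).rev)
    rw [← mul_assoc w.1, Equiv.mul_swap_eq_swap_mul w.1, mul_assoc _ w.1,
      Equiv.mul_swap_eq_swap_mul w.1, ← mul_assoc _ _ w.1, wb_rev, wb_rev]
    have hcomm : Equiv.swap (lowPos i) (highPos i) * Equiv.swap (lowPos i).rev (highPos i).rev =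
        Equiv.swap (lowPos i).rev (highPos i).rev * Equiv.swap (lowPos i) (highPos i) := by
      apply Equiv.Perm.Disjoint.commute
      apply Equiv.Perm.disjoint_swap_swap
      simp [lowPos, highPos, Fin.ext_iff, Fin.val_rev]
      omega
    rcases hpair with ⟨h6, h7⟩ | ⟨h6, h7⟩ | ⟨h6, h7⟩ | ⟨h6, h7⟩ <;> rw [h6, h7]
    · rw [Fin.rev_rev, Fin.rev_rev, hcomm, Equiv.swap_comm (highPos i), Equiv.swap_comm (highPos i).rev]
    · rw [Equiv.swap_comm (highPos i), Equiv.swap_comm (highPos i).rev]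
    · rw [Fin.rev_rev, Fin.rev_rev, hcomm]
  · rw [if_neg hj', if_neg (by rwa [hcond])]
    change Equiv.swap (lowPos i) (lowPos i).rev * w.1 =
      w.1 * Equiv.swap (lowPos j) (lowPos j).rev
    rw [Equiv.mul_swap_eq_swap_mul, wb_rev]
    have h8 : (highPos i).rev = highPos i := by
      simp only [highPos, Fin.ext_iff, Fin.val_rev]; omega
    have h9 : w.1 (highPos j) = highPos j := wb_apply_center w (by
      simp only [highPos, Fin.ext_iff, Fin.val_rev]; omega)
    have h10 : highPos j = highPos i := by
      simp only [highPos, Fin.ext_iff]; omega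
    have h11 : (lowPos i).rev ≠ highPos i := (highPos_ne_rev_lowPos i).symm
    have h12 : lowPos i ≠ highPos i := (lowPos_lt_highPos i).ne
    rcases hpair with ⟨h6, h7⟩ | ⟨h6, h7⟩ | ⟨h6, h7⟩ | ⟨h6, h7⟩
    · rw [h6]
    · rw [h9, h10] at h7
      exact absurd h7.symm h11
    · rw [h9, h10] at h6
      exact absurd h6.symm h12
    · rw [h7, Fin.rev_rev, Equiv.swap_comm]

end

section

/-! ### The standard basis and the bar involution of the Hecke algebra -/

variable {d : ℕ}

attribute [local instance 2000] Semiring.toNatAlgebra Ring.toIntAlgebra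

instance instRingHecke (d : ℕ) : Ring (Hecke d) := Algebra.semiringToRing Qv

theorem left_induction {P : WB d → Prop} (one : P 1)
    (step : ∀ (i : Fin d) (w : WB d), len w < len (simpleRefl d i * w) → P w →
      P (simpleRefl d i * w)) (w : WB d) : P w := by
  induction hn : len w using Nat.strong_induction_on generalizing w with
  | _ n ih =>
    by_cases hw : ∀ i : Fin d, w.1⁻¹ (lowPos i) < w.1⁻¹ (highPos i)
    · have : w⁻¹ = 1 := eq_one_of_forall_lt hw
      rw [inv_eq_one] at this
      rwa [this]
    · push Not at hw
      obtain ⟨i, hi⟩ := hw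
      have h1 := len_simpleRefl_mul' hi.not_gt
      have h2 := step i (simpleRefl d i * w) (by rw [simpleRefl_mul_cancel_left]; omega)
        (ih _ (by omega) _ rfl)
      rwa [simpleRefl_mul_cancel_left] at h2

theorem right_induction {P : WB d → Prop} (one : P 1)
    (step : ∀ (i : Fin d) (w : WB d), len w < len (w * simpleRefl d i) → P w →
      P (w * simpleRefl d i)) (w : WB d) : P w := by
  have : P w⁻¹⁻¹ := by
    refine left_induction (P := fun w => P w⁻¹) (by simpa using one) (fun i w h hw => ?_) w⁻¹
    rw [mul_inv_rev, simpleRefl_inv]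
    refine step i _ ?_ hw
    rwa [len_inv, len_mul_simpleRefl, inv_inv]
  rwa [inv_inv] at this

/-- The basis vector of the regular module indexed by `w`. -/
abbrev basisVec (w : WB d) : WB d →₀ Qv := Finsupp.single w 1

theorem heckeGen_up {i : Fin d} {w : WB d} (h : len w < len (simpleRefl d i * w)) :
    heckeGen d i (basisVec w) = basisVec (simpleRefl d i * w) := by
  simp [heckeGen, h]

theorem heckeGen_down {i : Fin d} {w : WB d} (h : ¬ len w < len (simpleRefl d i * w)) :
    heckeGen d i (basisVec w) =
      (v ^ 2 - 1) • basisVec w + v ^ 2 • basisVec (simpleRefl d i * w) := by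
  simp [heckeGen, h]

/-- Right multiplication by `T_s` on the regular module. -/
def rightGen (d : ℕ) (i : Fin d) : Module.End Qv (WB d →₀ Qv) :=
  Finsupp.linearCombination Qv fun w : WB d =>
    if len w < len (w * simpleRefl d i) then Finsupp.single (w * simpleRefl d i) (1 : Qv)
    else Finsupp.single w (v ^ 2 - 1) + Finsupp.single (w * simpleRefl d i) (v ^ 2)

theorem rightGen_up {i : Fin d} {w : WB d} (h : len w < len (w * simpleRefl d i)) :
    rightGen d i (basisVec w) = basisVec (w * simpleRefl d i) := by
  simp [rightGen, h]

theorem rightGen_down {i : Fin d} {w : WB d} (h : ¬ len w < len (w * simpleRefl d i)) :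
    rightGen d i (basisVec w) =
      (v ^ 2 - 1) • basisVec w + v ^ 2 • basisVec (w * simpleRefl d i) := by
  simp [rightGen, h]

/-- If `s w ≠ w t`, left and right descents do not influence each other, and the four cases are
checked on the basis. If `s w = w t`, the two operators agree on the span of `w` and `s w`. This
commutation plays the role of associativity for the algebra defined by the left operators. -/
theorem heckeGen_rightGen_comm (i j : Fin d) (x : WB d →₀ Qv) :
    heckeGen d i (rightGen d j x) = rightGen d j (heckeGen d i x) := by
  suffices heckeGen d i ∘ₗ rightGen d j = rightGen d j ∘ₗ heckeGen d i from
    LinearMap.congr_fun this x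
  ext1 w
  ext1
  simp only [LinearMap.comp_apply, Finsupp.lsingle_apply]
  set s := simpleRefl d i
  set t := simpleRefl d j
  by_cases hst : s * w = w * t
  · have hup : ∀ w' : WB d, s * w' = w' * t → len w' < len (s * w') →
        ¬ len (s * w') < len w' := fun _ _ h => h.not_gt
    have hsw : s * (w * t) = w := by rw [← hst]; exact simpleRefl_mul_cancel_left i w
    have hwt : w * t * t = w := simpleRefl_mul_cancel_right j w
    have hne := len_simpleRefl_mul_cases i w
    by_cases hu : len w < len (s * w)
    · rw [rightGen_up (by rw [← hst]; exact hu), heckeGen_up hu,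
        heckeGen_down (by rw [hsw, ← hst]; exact hu.not_gt), hst,
        rightGen_down (by rw [hwt, ← hst]; exact hu.not_gt), hsw, hwt]
    · have hd : len (s * w) < len w := by
        change len (s * w) = _ ∨ _ = len (s * w) + 1 at hne
        omega
      rw [rightGen_down (by rw [← hst]; exact hu), heckeGen_down hu]
      simp only [map_add, map_smul]
      rw [heckeGen_down hu, rightGen_down (by rw [← hst]; exact hu),
        heckeGen_up (by rw [hsw, ← hst]; exact hd), hst,
        rightGen_up (by rw [hwt, ← hst]; exact hd), hsw, hwt]
  · have hR : len (s * w) < len (s * w * t) ↔ len w < len (w * t) := by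
      rw [len_lt_mul_simpleRefl_iff, len_lt_mul_simpleRefl_iff]
      by_contra h
      exact hst (mul_eq_mul_of_descent_change h)
    have hL : len (w * t) < len (s * (w * t)) ↔ len w < len (s * w) := by
      rw [len_lt_simpleRefl_mul_iff, len_lt_simpleRefl_mul_iff]
      by_contra h
      have h1 := mul_eq_mul_of_descent_change (i := j) (j := i) (w := w⁻¹) (by
        rw [← wb_coe_inv, ← wb_coe_inv, mul_inv_rev, simpleRefl_inv] at h
        exact h)
      have h2 := congrArg (fun x => x⁻¹) h1
      simp only [mul_inv_rev, inv_inv, simpleRefl_inv] at h2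
      exact hst h2.symm
    have ha : s * (w * t) = s * w * t := (mul_assoc _ _ _).symm
    by_cases hu : len w < len (s * w) <;> by_cases hr : len w < len (w * t)
    · rw [rightGen_up hr, heckeGen_up (hL.2 hu), heckeGen_up hu, rightGen_up (hR.2 hr), ha]
    · rw [rightGen_down hr, heckeGen_up hu]
      simp only [map_add, map_smul]
      rw [heckeGen_up hu, heckeGen_up (hL.2 hu), rightGen_down (by rwa [hR]), ha]
    · rw [rightGen_up hr, heckeGen_down (by rwa [hL]), heckeGen_down hu]
      simp only [map_add, map_smul]
      rw [rightGen_up hr, rightGen_up (hR.2 hr), ha]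
    · rw [rightGen_down hr, heckeGen_down hu]
      simp only [map_add, map_smul]
      rw [heckeGen_down hu, rightGen_down hr, heckeGen_down (by rwa [hL]),
        rightGen_down (by rwa [hR]), ha]
      module

theorem hecke_rightGen_comm (h : Hecke d) (j : Fin d) (x : WB d →₀ Qv) :
    h.1 (rightGen d j x) = rightGen d j (h.1 x) := by
  obtain ⟨h, hh⟩ := h
  induction hh using Algebra.adjoin_induction generalizing x with
  | mem y hy =>
    obtain ⟨i, rfl⟩ := hy
    exact heckeGen_rightGen_comm i j x
  | algebraMap r => simp [Module.algebraMap_end_apply]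
  | add a b _ _ ha hb =>
    simp only [LinearMap.add_apply, map_add]
    exact congrArg₂ _ (ha x) (hb x)
  | mul a b _ _ ha hb =>
    simp only [Module.End.mul_apply]
    exact (congrArg a (hb x)).trans (ha _)

theorem heckeCoeff_add (a b : Hecke d) : heckeCoeff (a + b) = heckeCoeff a + heckeCoeff b := rfl

theorem heckeCoeff_smul (c : Qv) (a : Hecke d) : heckeCoeff (c • a) = c • heckeCoeff a := rfl

/-- The coefficients with respect to the standard basis, as a linear map. -/
def heckeCoeffₗ (d : ℕ) : Hecke d →ₗ[Qv] (WB d →₀ Qv) where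
  toFun := heckeCoeff
  map_add' _ _ := rfl
  map_smul' _ _ := rfl

/-- Elements of the algebra commute with the right operators, and these produce every basis vector
from that of `1`. So an element is determined by its value there, and identities in the Hecke
algebra can be checked on coefficients. -/
theorem heckeCoeff_injective : Function.Injective (heckeCoeff (d := d)) := by
  change Function.Injective (heckeCoeffₗ d)
  rw [injective_iff_map_eq_zero]
  intro h h0
  replace h0 : h.1 (basisVec 1) = 0 := h0
  apply Subtype.ext
  refine Finsupp.lhom_ext' fun w => LinearMap.ext_ring ?_
  change h.1 (basisVec w) = (0 : WB d →₀ Qv)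
  induction w using right_induction with
  | one => exact h0
  | step i w hw ih => rw [← rightGen_up hw, hecke_rightGen_comm, ih, map_zero]

theorem heckeCoeff_Tgen_mul (i : Fin d) (h : Hecke d) :
    heckeCoeff (Tgen d i * h) = heckeGen d i (heckeCoeff h) := rfl

theorem heckeCoeff_mul_Tgen (h : Hecke d) (i : Fin d) :
    heckeCoeff (h * Tgen d i) = rightGen d i (heckeCoeff h) := by
  change h.1 (heckeGen d i (basisVec 1)) = rightGen d i (h.1 (basisVec 1))
  have h1 : len (1 : WB d) < len (simpleRefl d i) := by
    have := len_simpleRefl_mul_cases i (1 : WB d)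
    rw [mul_one, len_one] at this
    rw [len_one]
    omega
  rw [← hecke_rightGen_comm, heckeGen_up (by rwa [mul_one]), rightGen_up (by rwa [one_mul]),
    one_mul, mul_one]

theorem len_prod_le (l : List (Fin d)) : len (l.map (simpleRefl d)).prod ≤ l.length :=
  Nat.sInf_le ⟨l, rfl, rfl⟩

/-- A tail of a reduced word is reduced. -/
theorem reduced_tail {i : Fin d} {l : List (Fin d)}
    (h : (i :: l).length = len ((i :: l).map (simpleRefl d)).prod) :
    l.length = len (l.map (simpleRefl d)).prod ∧
      len (l.map (simpleRefl d)).prod < len (simpleRefl d i * (l.map (simpleRefl d)).prod) := by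
  rw [List.map_cons, List.prod_cons, List.length_cons] at h
  have h1 := len_prod_le l
  have h2 := len_simpleRefl_mul_cases i (l.map (simpleRefl d)).prod
  omega

@[simp] theorem heckeCoeff_T (w : WB d) : heckeCoeff (T w) = basisVec w := by
  obtain ⟨h1, h2⟩ := redWord_spec w
  have key : ∀ l : List (Fin d), l.length = len (l.map (simpleRefl d)).prod →
      heckeCoeff (l.map (Tgen d)).prod = basisVec (l.map (simpleRefl d)).prod := by
    intro l
    induction l with
    | nil => intro _; rfl
    | cons i l ih =>
      intro h
      obtain ⟨h3, h4⟩ := reduced_tail h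
      rw [List.map_cons, List.prod_cons, heckeCoeff_Tgen_mul, ih h3, heckeGen_up h4,
        List.map_cons, List.prod_cons]
  rw [T, key _ (by rw [h2, h1]), h2]

theorem T_one : T (1 : WB d) = 1 := heckeCoeff_injective (by rw [heckeCoeff_T]; rfl)

theorem Tgen_mul_T_up {i : Fin d} {w : WB d} (h : len w < len (simpleRefl d i * w)) :
    Tgen d i * T w = T (simpleRefl d i * w) := by
  apply heckeCoeff_injective
  rw [heckeCoeff_Tgen_mul, heckeCoeff_T, heckeGen_up h, heckeCoeff_T]

theorem Tgen_mul_T_down {i : Fin d} {w : WB d} (h : ¬ len w < len (simpleRefl d i * w)) :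
    Tgen d i * T w = (v ^ 2 - 1) • T w + v ^ 2 • T (simpleRefl d i * w) := by
  apply heckeCoeff_injective
  rw [heckeCoeff_Tgen_mul, heckeCoeff_T, heckeGen_down h, heckeCoeff_add, heckeCoeff_smul,
    heckeCoeff_smul, heckeCoeff_T, heckeCoeff_T]

theorem T_mul_Tgen_up {i : Fin d} {w : WB d} (h : len w < len (w * simpleRefl d i)) :
    T w * Tgen d i = T (w * simpleRefl d i) := by
  apply heckeCoeff_injective
  rw [heckeCoeff_mul_Tgen, heckeCoeff_T, rightGen_up h, heckeCoeff_T]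

theorem T_mul_Tgen_down {i : Fin d} {w : WB d} (h : ¬ len w < len (w * simpleRefl d i)) :
    T w * Tgen d i = (v ^ 2 - 1) • T w + v ^ 2 • T (w * simpleRefl d i) := by
  apply heckeCoeff_injective
  rw [heckeCoeff_mul_Tgen, heckeCoeff_T, rightGen_down h, heckeCoeff_add, heckeCoeff_smul,
    heckeCoeff_smul, heckeCoeff_T, heckeCoeff_T]

theorem T_simpleRefl (i : Fin d) : T (simpleRefl d i) = Tgen d i := by
  have h1 : len (1 : WB d) < len (simpleRefl d i * 1) := by
    have := len_simpleRefl_mul_cases i (1 : WB d)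
    rw [len_one] at *
    omega
  have := Tgen_mul_T_up h1
  rwa [T_one, mul_one, mul_one, eq_comm] at this

theorem Tgen_mul_Tgen (i : Fin d) :
    Tgen d i * Tgen d i = (v ^ 2 - 1) • Tgen d i + v ^ 2 • 1 := by
  have h1 : ¬ len (simpleRefl d i) < len (simpleRefl d i * simpleRefl d i) := by
    rw [simpleRefl_mul_self, len_one]
    omega
  have := Tgen_mul_T_down h1
  rwa [simpleRefl_mul_self, T_simpleRefl, T_one] at this

theorem v_sq_inv : v ^ (-2 : ℤ) * v ^ 2 = 1 := by
  rw [← zpow_natCast, ← zpow_add₀ v_ne_zero]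
  simp

theorem TgenInv_mul_Tgen (i : Fin d) : TgenInv d i * Tgen d i = 1 := by
  rw [TgenInv, add_mul, smul_mul_assoc, smul_mul_assoc, one_mul, Tgen_mul_Tgen, smul_add,
    smul_smul, smul_smul, v_sq_inv, mul_sub, v_sq_inv]
  module

theorem Tgen_mul_TgenInv (i : Fin d) : Tgen d i * TgenInv d i = 1 := by
  rw [TgenInv, mul_add, mul_smul_comm, mul_smul_comm, mul_one, Tgen_mul_Tgen, smul_add,
    smul_smul, smul_smul, v_sq_inv, mul_sub, v_sq_inv]
  module

/-- This identifies `Tbar w` as the inverse of `T w⁻¹`; in particular it does not depend on the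
chosen reduced word. -/
theorem Tbar_mul_T_inv (w : WB d) : Tbar w * T w⁻¹ = 1 ∧ T w⁻¹ * Tbar w = 1 := by
  obtain ⟨h1, h2⟩ := redWord_spec w
  have key : ∀ l : List (Fin d), l.length = len (l.map (simpleRefl d)).prod →
      (l.map (TgenInv d)).prod * T (l.map (simpleRefl d)).prod⁻¹ = 1 ∧
      T (l.map (simpleRefl d)).prod⁻¹ * (l.map (TgenInv d)).prod = 1 := by
    intro l
    induction l with
    | nil => intro _; simp [T_one]
    | cons i l ih =>
      intro h
      obtain ⟨h3, h4⟩ := reduced_tail h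
      have h5 : len (l.map (simpleRefl d)).prod⁻¹ <
          len ((l.map (simpleRefl d)).prod⁻¹ * simpleRefl d i) := by
        rwa [len_inv, len_mul_simpleRefl, inv_inv]
      rw [List.map_cons, List.prod_cons, List.map_cons, List.prod_cons, mul_inv_rev,
        simpleRefl_inv, ← T_mul_Tgen_up h5]
      obtain ⟨h6, h7⟩ := ih h3
      constructor
      · rw [mul_assoc, ← mul_assoc _ _ (Tgen d i), h6, one_mul, TgenInv_mul_Tgen]
      · rw [mul_assoc, ← mul_assoc (Tgen d i), Tgen_mul_TgenInv, one_mul, h7]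
  have h3 := key _ (by rw [h2, h1])
  rwa [h2] at h3

theorem Tbar_one : Tbar (1 : WB d) = 1 := by
  have := (Tbar_mul_T_inv (1 : WB d)).1
  rwa [inv_one, T_one, mul_one] at this

theorem Tbar_simpleRefl_mul {i : Fin d} {w : WB d} (h : len w < len (simpleRefl d i * w)) :
    Tbar (simpleRefl d i * w) = TgenInv d i * Tbar w := by
  have h1 := Tbar_mul_T_inv (simpleRefl d i * w)
  have h2 := Tbar_mul_T_inv w
  have h5 : len w⁻¹ < len (w⁻¹ * simpleRefl d i) := by
    rwa [len_inv, len_mul_simpleRefl, inv_inv]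
  have h3 : T (simpleRefl d i * w)⁻¹ * (TgenInv d i * Tbar w) = 1 := by
    rw [mul_inv_rev, simpleRefl_inv, ← T_mul_Tgen_up h5, mul_assoc, ← mul_assoc (Tgen d i),
      Tgen_mul_TgenInv, one_mul, h2.2]
  exact left_inv_eq_right_inv h1.1 h3

theorem eq_sum_T (h : Hecke d) : h = (heckeCoeff h).sum fun w c => c • T w := by
  apply heckeCoeff_injective
  change _ = heckeCoeffₗ d _
  rw [Finsupp.sum, map_sum]
  simp only [map_smul]
  change _ = ∑ w ∈ _, heckeCoeff h w • heckeCoeff (T w)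
  simp only [heckeCoeff_T]
  conv_lhs => rw [← Finsupp.sum_single (heckeCoeff h)]
  simp [Finsupp.sum]

theorem hecke_induction {P : Hecke d → Prop} (zero : P 0) (add : ∀ a b, P a → P b → P (a + b))
    (smul_T : ∀ (c : Qv) (w : WB d), P (c • T w)) (h : Hecke d) : P h := by
  rw [eq_sum_T h, Finsupp.sum]
  exact Finset.sum_induction _ P add zero fun w _ => smul_T _ w

theorem barHecke_add (a b : Hecke d) : barHecke (a + b) = barHecke a + barHecke b := by
  unfold barHecke
  rw [heckeCoeff_add, Finsupp.sum_add_index']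
  · simp
  · intro w c c'
    rw [map_add, add_smul]

theorem barHecke_smul (c : Qv) (a : Hecke d) : barHecke (c • a) = barQ c • barHecke a := by
  unfold barHecke
  rw [heckeCoeff_smul, Finsupp.sum_smul_index (by simp), Finsupp.smul_sum]
  simp [mul_smul]

theorem barHecke_zero : barHecke (0 : Hecke d) = 0 := by
  simpa using barHecke_smul 0 (0 : Hecke d)

@[simp] theorem barHecke_T (w : WB d) : barHecke (T w) = Tbar w := by
  simp [barHecke]

theorem barHecke_one : barHecke (1 : Hecke d) = 1 := by
  rw [← T_one, barHecke_T, Tbar_one, T_one]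

/-- On an ascent this is the recursion for `Tbar`. On a descent `T_s T_w` is expanded by the
quadratic relation, and `Tbar (s w) = T_s Tbar w` recombines the conjugates. Multiplicativity of the
bar map follows by induction on the length. -/
theorem barHecke_Tgen_mul (i : Fin d) (h : Hecke d) :
    barHecke (Tgen d i * h) = TgenInv d i * barHecke h := by
  induction h using hecke_induction with
  | zero => simp [barHecke_zero]
  | add a b ha hb => rw [mul_add, barHecke_add, ha, hb, barHecke_add, mul_add]
  | smul_T c w =>
    rw [mul_smul_comm, barHecke_smul, barHecke_smul, mul_smul_comm, barHecke_T]
    congr 1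
    by_cases h : len w < len (simpleRefl d i * w)
    · rw [Tgen_mul_T_up h, barHecke_T, Tbar_simpleRefl_mul h]
    · rw [Tgen_mul_T_down h]
      have h1 : len (simpleRefl d i * w) < len (simpleRefl d i * (simpleRefl d i * w)) := by
        have := len_simpleRefl_mul_cases i w
        rw [simpleRefl_mul_cancel_left]
        omega
      have h2 := Tbar_simpleRefl_mul h1
      rw [simpleRefl_mul_cancel_left] at h2
      have h3 : Tbar (simpleRefl d i * w) = Tgen d i * Tbar w := by
        rw [h2, ← mul_assoc, Tgen_mul_TgenInv, one_mul]
      rw [barHecke_add, barHecke_smul, barHecke_smul, barHecke_T, barHecke_T, h3, TgenInv, add_mul,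
        smul_mul_assoc, smul_mul_assoc, one_mul, map_sub, map_one, barQ_pow]
      push_cast
      module

theorem barHecke_mul (a b : Hecke d) : barHecke (a * b) = barHecke a * barHecke b := by
  induction a using hecke_induction with
  | zero => simp [barHecke_zero]
  | add a b ha hb => rw [add_mul, barHecke_add, ha, hb, barHecke_add, add_mul]
  | smul_T c w =>
    rw [smul_mul_assoc, barHecke_smul, barHecke_smul, smul_mul_assoc]
    congr 1
    induction w using left_induction with
    | one => rw [T_one, one_mul, barHecke_one, one_mul]
    | step i w hw ih =>
      rw [← Tgen_mul_T_up hw, mul_assoc, barHecke_Tgen_mul, barHecke_Tgen_mul, ih, mul_assoc]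

theorem barHecke_Tgen (i : Fin d) : barHecke (Tgen d i) = TgenInv d i := by
  simpa [barHecke_one] using barHecke_Tgen_mul i 1

/-! ### Sums over subsets closed under multiplication by a simple reflection -/

/-- The set splits into pairs `{w, s w}`, and `T_s` multiplies each `T_w + T_{s w}` by `v²`. -/
theorem Tgen_mul_sum {i : Fin d} {S : Finset (WB d)} (hS : ∀ w ∈ S, simpleRefl d i * w ∈ S) :
    Tgen d i * ∑ w ∈ S, T w = v ^ 2 • ∑ w ∈ S, T w := by
  rw [← sub_eq_zero, Finset.mul_sum, Finset.smul_sum, ← Finset.sum_sub_distrib]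
  refine Finset.sum_involution (fun w _ => simpleRefl d i * w) ?_ ?_ hS
    fun w _ => simpleRefl_mul_cancel_left i w
  · intro w _
    have key : ∀ w : WB d, len w < len (simpleRefl d i * w) →
        Tgen d i * T w - v ^ 2 • T w + (Tgen d i * T (simpleRefl d i * w) -
          v ^ 2 • T (simpleRefl d i * w)) = 0 := by
      intro w hw
      rw [Tgen_mul_T_up hw, Tgen_mul_T_down (by rw [simpleRefl_mul_cancel_left]; omega),
        simpleRefl_mul_cancel_left]
      module
    by_cases h : len w < len (simpleRefl d i * w)
    · exact key w h
    · have := len_simpleRefl_mul_cases i w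
      have h2 := key (simpleRefl d i * w) (by rw [simpleRefl_mul_cancel_left]; omega)
      rwa [simpleRefl_mul_cancel_left, add_comm] at h2
  · intro w _ _ h
    have := len_simpleRefl_mul_cases i w
    rw [h] at this
    omega

theorem sum_mul_Tgen {i : Fin d} {S : Finset (WB d)} (hS : ∀ w ∈ S, w * simpleRefl d i ∈ S) :
    (∑ w ∈ S, T w) * Tgen d i = v ^ 2 • ∑ w ∈ S, T w := by
  rw [← sub_eq_zero, Finset.sum_mul, Finset.smul_sum, ← Finset.sum_sub_distrib]
  have hc : ∀ w : WB d, len (w * simpleRefl d i) = len w + 1 ∨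
      len w = len (w * simpleRefl d i) + 1 := by
    intro w
    rw [len_mul_simpleRefl, ← len_inv w]
    exact len_simpleRefl_mul_cases i w⁻¹
  refine Finset.sum_involution (fun w _ => w * simpleRefl d i) ?_ ?_ hS
    fun w _ => simpleRefl_mul_cancel_right i w
  · intro w _
    have key : ∀ w : WB d, len w < len (w * simpleRefl d i) →
        T w * Tgen d i - v ^ 2 • T w + (T (w * simpleRefl d i) * Tgen d i -
          v ^ 2 • T (w * simpleRefl d i)) = 0 := by
      intro w hw
      rw [T_mul_Tgen_up hw, T_mul_Tgen_down (by rw [simpleRefl_mul_cancel_right]; omega),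
        simpleRefl_mul_cancel_right]
      module
    by_cases h : len w < len (w * simpleRefl d i)
    · exact key w h
    · have := hc w
      have h2 := key (w * simpleRefl d i) (by rw [simpleRefl_mul_cancel_right]; omega)
      rwa [simpleRefl_mul_cancel_right, add_comm] at h2
  · intro w _ _ h
    have := hc w
    rw [h] at this
    omega

end

section

/-! ### Block maps of compositions -/

variable {n d : ℕ}

/-- `κ` is monotone with fibres of sizes `μ i`, so that `κ x` is the index of the block of `x`. -/
structure IsBlockMap (d : ℕ) (μ : Fin n → ℕ) (κ : Fin (2 * d + 1) → Fin n) : Prop where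
  mono : Monotone κ
  card : ∀ i, (Finset.univ.filter fun x => κ x = i).card = μ i

theorem mem_iff_val_lt_card {m : ℕ} {S : Finset (Fin m)} (hS : ∀ x ∈ S, ∀ y ≤ x, y ∈ S)
    (x : Fin m) : x ∈ S ↔ (x : ℕ) < S.card := by
  constructor
  · intro hx
    have : Finset.Iic x ⊆ S := fun y hy => hS x hx y (Finset.mem_Iic.1 hy)
    have := Finset.card_le_card this
    rw [Fin.card_Iic] at this
    omega
  · intro h
    by_contra hx
    have : S ⊆ Finset.Iio x := fun y hy => Finset.mem_Iio.2 (lt_of_not_ge fun h1 => hx (hS y hy x h1))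
    have := Finset.card_le_card this
    rw [Fin.card_Iio] at this
    omega

namespace IsBlockMap

variable {μ : Fin n → ℕ} {κ : Fin (2 * d + 1) → Fin n}

theorem sum_eq (h : IsBlockMap d μ κ) (I : Finset (Fin n)) :
    ∑ i ∈ I, μ i = (Finset.univ.filter fun x => κ x ∈ I).card := by
  rw [Finset.card_eq_sum_card_fiberwise (f := κ) (t := I) (by intro x hx; simpa using hx)]
  refine Finset.sum_congr rfl fun i hi => ?_
  rw [← h.card i, Finset.filter_filter]
  congr 1
  ext x
  simp only [Finset.mem_filter, Finset.mem_univ, true_and]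
  exact ⟨fun hx => ⟨hx ▸ hi, hx⟩, fun hx => hx.2⟩

theorem mem_block (h : IsBlockMap d μ κ) (x : Fin (2 * d + 1)) (i : Fin n) :
    x ∈ block d μ i ↔ κ x = i := by
  have h1 := mem_iff_val_lt_card (S := Finset.univ.filter fun x => κ x ∈ Finset.Iio i) (by
    intro x hx y hy
    simp only [Finset.mem_filter, Finset.mem_univ, true_and, Finset.mem_Iio] at *
    exact (h.mono hy).trans_lt hx) x
  have h2 := mem_iff_val_lt_card (S := Finset.univ.filter fun x => κ x ∈ Finset.Iic i) (by
    intro x hx y hy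
    simp only [Finset.mem_filter, Finset.mem_univ, true_and, Finset.mem_Iic] at *
    exact (h.mono hy).trans hx) x
  rw [← h.sum_eq] at h1 h2
  simp only [Finset.mem_filter, Finset.mem_univ, true_and, Finset.mem_Iio, Finset.mem_Iic]
    at h1 h2
  rw [block, Finset.mem_filter, ← h2, ← not_lt, ← h1, not_lt]
  exact ⟨fun hx => le_antisymm hx.2.2 hx.2.1, fun hx => ⟨Finset.mem_univ _, hx.ge, hx.le⟩⟩

theorem unique {κ' : Fin (2 * d + 1) → Fin n} (h : IsBlockMap d μ κ) (h' : IsBlockMap d μ κ') :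
    κ = κ' := by
  ext1 x
  exact ((h.mem_block x _).1 ((h'.mem_block x _).2 rfl))

/-- Conjugation by the reversal gives another block map of the same symmetric composition, and block
maps are unique. -/
theorem rev (h : IsBlockMap d μ κ) (hμ : ∀ i, μ i.rev = μ i) (x : Fin (2 * d + 1)) :
    κ x.rev = (κ x).rev := by
  have h2 : IsBlockMap d μ fun x => (κ x.rev).rev := by
    refine ⟨fun x y hxy => Fin.rev_le_rev.2 (h.mono (Fin.rev_le_rev.2 hxy)), fun i => ?_⟩
    rw [← hμ i, ← h.card i.rev]
    refine Finset.card_bij (fun x _ => x.rev) ?_ ?_ ?_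
    · intro x hx
      simp only [Finset.mem_filter, Finset.mem_univ, true_and] at *
      rw [← hx, Fin.rev_rev]
    · intro x _ y _ hxy
      exact Fin.rev_injective hxy
    · intro x hx
      simp only [Finset.mem_filter, Finset.mem_univ, true_and] at *
      exact ⟨x.rev, by rw [Fin.rev_rev, hx, Fin.rev_rev], Fin.rev_rev x⟩
  have := congrFun (h.unique h2) x.rev
  rw [this, Fin.rev_rev]

end IsBlockMap

theorem exists_isBlockMap {μ : Fin n → ℕ} (hμ : ∑ i, μ i = 2 * d + 1) :
    ∃ κ, IsBlockMap d μ κ := by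
  have hsub : ∀ {i j : Fin n}, i < j → ∑ l ∈ Finset.Iic i, μ l ≤ ∑ l ∈ Finset.Iio j, μ l := by
    intro i j hij
    refine Finset.sum_le_sum_of_subset fun l hl => ?_
    rw [Finset.mem_Iic] at hl
    rw [Finset.mem_Iio]
    exact hl.trans_lt hij
  have hex : ∀ x : Fin (2 * d + 1), ∃ i, x ∈ block d μ i := by
    intro x
    have hn : n ≠ 0 := by
      rintro rfl
      simp at hμ
    have hne : (Finset.univ.filter fun i : Fin n => (x : ℕ) < ∑ j ∈ Finset.Iic i, μ j).Nonempty := by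
      refine ⟨⟨n - 1, by omega⟩, ?_⟩
      rw [Finset.mem_filter]
      refine ⟨Finset.mem_univ _, ?_⟩
      have : Finset.Iic (⟨n - 1, by omega⟩ : Fin n) = Finset.univ := by
        ext i
        simp only [Finset.mem_Iic, Fin.le_def, Finset.mem_univ, iff_true]
        omega
      rw [this, hμ]
      exact x.2
    refine ⟨Finset.min' _ hne, ?_⟩
    have h1 := Finset.min'_mem _ hne
    rw [Finset.mem_filter] at h1
    rw [block, Finset.mem_filter]
    refine ⟨Finset.mem_univ _, ?_, h1.2⟩
    by_contra hlt
    push Not at hlt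
    set i := Finset.min' _ hne with hi
    have hi0 : (i : ℕ) ≠ 0 := by
      intro h0
      have : Finset.Iio i = ∅ := by
        ext j
        simp only [Finset.mem_Iio, Fin.lt_def, Finset.notMem_empty, iff_false]
        omega
      rw [this] at hlt
      simp at hlt
    have h2 : Finset.Iio i = Finset.Iic ⟨i - 1, by omega⟩ := by
      ext j
      simp only [Finset.mem_Iio, Finset.mem_Iic, Fin.lt_def, Fin.le_def]
      omega
    rw [h2] at hlt
    have h3 := Finset.min'_le (Finset.univ.filter fun i : Fin n => (x : ℕ) < ∑ j ∈ Finset.Iic i, μ j)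
      ⟨i - 1, by omega⟩ (by rw [Finset.mem_filter]; exact ⟨Finset.mem_univ _, hlt⟩)
    rw [← hi, Fin.le_def] at h3
    simp only at h3
    omega
  choose κ hκ using hex
  have hκ' : ∀ x, (∑ j ∈ Finset.Iio (κ x), μ j) ≤ (x : ℕ) ∧
      (x : ℕ) < ∑ j ∈ Finset.Iic (κ x), μ j := fun x => (Finset.mem_filter.1 (hκ x)).2
  have hmono : Monotone κ := by
    intro x y hxy
    by_contra hlt
    rw [not_le] at hlt
    have h1 := hsub hlt
    have h2 := hκ' x
    have h3 := hκ' y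
    rw [Fin.le_def] at hxy
    omega
  refine ⟨κ, hmono, fun i => ?_⟩
  have h1 : (Finset.univ.filter fun x => κ x = i).image Fin.val =
      Finset.Ico (∑ j ∈ Finset.Iio i, μ j) (∑ j ∈ Finset.Iic i, μ j) := by
    ext m
    simp only [Finset.mem_image, Finset.mem_filter, Finset.mem_univ, true_and, Finset.mem_Ico]
    constructor
    · rintro ⟨x, rfl, rfl⟩
      exact hκ' x
    · intro hm
      have hle : ∑ j ∈ Finset.Iic i, μ j ≤ 2 * d + 1 := by
        rw [← hμ]
        exact Finset.sum_le_sum_of_subset (Finset.subset_univ _)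
      refine ⟨⟨m, by omega⟩, ?_, rfl⟩
      have h2 := hκ' ⟨m, by omega⟩
      rcases lt_trichotomy (κ ⟨m, by omega⟩) i with h | h | h
      · have := hsub h
        simp only at h2
        omega
      · exact h
      · have := hsub h
        simp only at h2
        omega
  rw [← Finset.card_image_of_injective _ Fin.val_injective, h1, Nat.card_Ico]
  have h2 : Finset.Iic i = insert i (Finset.Iio i) := by
    rw [Finset.Iio_insert]
  rw [h2, Finset.sum_insert (by simp)]
  omega

/-! ### Cosets of parabolic subgroups -/

/-- The left coset (or the empty set) of the elements `w` with `κ ∘ w⁻¹ = φ`. -/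
def fibre (κ φ : Fin (2 * d + 1) → Fin n) : Finset (WB d) :=
  (Set.toFinite {w : WB d | ∀ x, κ (w.1⁻¹ x) = φ x}).toFinset

@[simp] theorem mem_fibre {κ φ : Fin (2 * d + 1) → Fin n} {w : WB d} :
    w ∈ fibre κ φ ↔ ∀ x, κ (w.1⁻¹ x) = φ x := by
  simp [fibre]

/-- The sum of the `T_w` with `κ ∘ w⁻¹ = φ`. -/
def fibreSum (κ φ : Fin (2 * d + 1) → Fin n) : Hecke d := ∑ w ∈ fibre κ φ, T w

theorem parab_eq_fibre {μ : Fin n → ℕ} {κ : Fin (2 * d + 1) → Fin n} (h : IsBlockMap d μ κ) :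
    parab d μ = fibre κ κ := by
  ext w
  simp only [parab, Set.Finite.mem_toFinset, Set.mem_ofPred_eq, h.mem_block, mem_fibre]
  constructor
  · intro hw x
    have := hw _ (w.1⁻¹ x) rfl
    rw [← this]
    exact congrArg κ (w.1.apply_symm_apply x)
  · rintro hw _ x rfl
    rw [← hw]
    exact congrArg κ (w.1.symm_apply_apply x)

theorem relPos_eq {lam μ : Fin n → ℕ} {κ' κ : Fin (2 * d + 1) → Fin n}
    (h' : IsBlockMap d lam κ') (h : IsBlockMap d μ κ) (w : WB d) (i j : Fin n) :
    relPos lam μ w i j =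
      ((Finset.univ.filter fun x => κ' x = i ∧ κ (w.1⁻¹ x) = j).card : ℤ) := by
  rw [relPos, Nat.cast_inj]
  refine Finset.card_bij (fun x _ => w.1 x) ?_ (fun _ _ _ _ h => w.1.injective h) ?_
  · intro x hx
    rw [Finset.mem_filter, h.mem_block, h'.mem_block] at hx
    rw [Finset.mem_filter]
    exact ⟨Finset.mem_univ _, hx.2, (congrArg κ (w.1.symm_apply_apply x)).trans hx.1⟩
  · intro x hx
    rw [Finset.mem_filter] at hx
    refine ⟨w.1⁻¹ x, ?_, w.1.apply_symm_apply x⟩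
    rw [Finset.mem_filter, h.mem_block, h'.mem_block]
    exact ⟨hx.2.2, (congrArg κ' (w.1.apply_symm_apply x)).trans hx.2.1⟩

theorem mem_coset {lam μ : Fin n → ℕ} {M : Matrix (Fin n) (Fin n) ℤ} {w : WB d} :
    w ∈ coset lam μ M ↔ relPos lam μ w = M := by
  simp [coset]

theorem fibre_disjoint {κ φ ψ : Fin (2 * d + 1) → Fin n} (h : φ ≠ ψ) :
    Disjoint (fibre κ φ) (fibre κ ψ) := by
  rw [Finset.disjoint_left]
  intro w h1 h2
  rw [mem_fibre] at h1 h2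
  exact h (funext fun x => (h1 x).symm.trans (h2 x))

theorem simpleRefl_mul_inv_apply (i : Fin d) (w : WB d) (x : Fin (2 * d + 1)) :
    (simpleRefl d i * w).1⁻¹ x = w.1⁻¹ ((simpleRefl d i).1 x) := by
  rw [← wb_coe_inv, mul_inv_rev, simpleRefl_inv]
  rfl

theorem fibre_comp_simpleRefl (κ φ : Fin (2 * d + 1) → Fin n) (i : Fin d) :
    fibre κ (fun x => φ ((simpleRefl d i).1 x)) =
      (fibre κ φ).map (Equiv.mulLeft (simpleRefl d i)).toEmbedding := by
  ext w
  rw [Finset.mem_map_equiv, mem_fibre, mem_fibre]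
  have e : (Equiv.mulLeft (simpleRefl d i)).symm w = simpleRefl d i * w := by
    rw [Equiv.mulLeft_symm_apply, simpleRefl_inv]
  rw [e]
  simp only [simpleRefl_mul_inv_apply]
  constructor
  · intro h x
    rw [h, simpleRefl_apply_apply]
  · intro h x
    rw [← h, simpleRefl_apply_apply]

theorem len_lt_of_mem_fibre {κ φ : Fin (2 * d + 1) → Fin n} (hκ : Monotone κ) {i : Fin d}
    (h : φ (lowPos i) < φ (highPos i)) {w : WB d} (hw : w ∈ fibre κ φ) :
    w.1⁻¹ (lowPos i) < w.1⁻¹ (highPos i) := by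
  rw [mem_fibre] at hw
  rw [← hw, ← hw] at h
  exact hκ.reflect_lt h

/-- All elements of the fibre have this reflection as a left ascent, because `κ` is monotone. Hence
`T_s` acts by translation of the coset, without correction terms. -/
theorem Tgen_mul_fibreSum {κ φ : Fin (2 * d + 1) → Fin n} (hκ : Monotone κ) {i : Fin d}
    (h : φ (lowPos i) < φ (highPos i)) :
    Tgen d i * fibreSum κ φ = fibreSum κ fun x => φ ((simpleRefl d i).1 x) := by
  rw [fibreSum, fibreSum, fibre_comp_simpleRefl, Finset.sum_map, Finset.mul_sum]
  refine Finset.sum_congr rfl fun w hw => ?_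
  rw [Tgen_mul_T_up (len_lt_simpleRefl_mul_iff.2 (len_lt_of_mem_fibre hκ h hw))]
  rfl

theorem sup_len_fibre {κ φ : Fin (2 * d + 1) → Fin n} (hκ : Monotone κ) {i : Fin d}
    (h : φ (lowPos i) < φ (highPos i)) (hne : (fibre κ φ).Nonempty) :
    (fibre κ fun x => φ ((simpleRefl d i).1 x)).sup len = (fibre κ φ).sup len + 1 := by
  rw [fibre_comp_simpleRefl, Finset.sup_map]
  have h1 : (fibre κ φ).sup (len ∘ (Equiv.mulLeft (simpleRefl d i)).toEmbedding) =
      (fibre κ φ).sup fun w => len w + 1 :=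
    Finset.sup_congr rfl fun w hw => len_simpleRefl_mul (len_lt_of_mem_fibre hκ h hw)
  rw [h1]
  have h2 : Monotone fun m : ℕ => m + 1 := fun a b h => Nat.succ_le_succ h
  exact (Finset.apply_sup_eq_sup_comp_of_nonempty h2 hne).symm

theorem apply_simpleRefl_of_eq {φ : Fin (2 * d + 1) → Fin n} (hrev : ∀ x, φ x.rev = (φ x).rev)
    {i : Fin d} (h : φ (lowPos i) = φ (highPos i)) (x : Fin (2 * d + 1)) :
    φ ((simpleRefl d i).1 x) = φ x := by
  have hi := i.2
  have hx := x.2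
  have hr : φ (lowPos i).rev = φ (highPos i).rev := by rw [hrev, hrev, h]
  have key : ∀ {a b : Fin (2 * d + 1)}, x = a → (simpleRefl d i).1 x = b → φ a = φ b →
      φ ((simpleRefl d i).1 x) = φ x := by
    rintro a b rfl rfl h
    exact h.symm
  have e := simpleRefl_val i x
  split_ifs at e with h1 h2 h3 h4 h5 h6 h7
  · exact key (a := lowPos i) (b := highPos i) (Fin.ext h2) (Fin.ext e) h
  · exact key (a := highPos i) (b := lowPos i) (Fin.ext h3) (Fin.ext e) h.symm
  · exact key (a := (lowPos i).rev) (b := (highPos i).rev)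
      (by rw [Fin.ext_iff, Fin.val_rev]; simp only [lowPos]; omega)
      (by rw [Fin.ext_iff, Fin.val_rev]; simp only [highPos]; omega) hr
  · exact key (a := (highPos i).rev) (b := (lowPos i).rev)
      (by rw [Fin.ext_iff, Fin.val_rev]; simp only [highPos]; omega)
      (by rw [Fin.ext_iff, Fin.val_rev]; simp only [lowPos]; omega) hr.symm
  · rw [Fin.ext e]
  all_goals
    have hc : (highPos i).rev = highPos i := by
      rw [Fin.ext_iff, Fin.val_rev]; simp only [highPos]; omega
    rw [hc, ← h] at hr
  · exact key (a := lowPos i) (b := (lowPos i).rev) (Fin.ext h6)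
      (by rw [Fin.ext_iff, Fin.val_rev]; simp only [lowPos]; omega) hr.symm
  · exact key (a := (lowPos i).rev) (b := lowPos i)
      (by rw [Fin.ext_iff, Fin.val_rev]; simp only [lowPos]; omega) (Fin.ext e) hr
  · rw [Fin.ext e]

theorem Tgen_mul_cosetSum {lam μ : Fin n → ℕ} {κ' κ : Fin (2 * d + 1) → Fin n}
    (h' : IsBlockMap d lam κ') (h : IsBlockMap d μ κ) (hrev : ∀ x, κ' x.rev = (κ' x).rev)
    {i : Fin d} (hi : κ' (lowPos i) = κ' (highPos i)) (M : Matrix (Fin n) (Fin n) ℤ) :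
    Tgen d i * ∑ w ∈ coset (d := d) lam μ M, T w = v ^ 2 • ∑ w ∈ coset (d := d) lam μ M, T w := by
  refine Tgen_mul_sum fun w hw => ?_
  rw [mem_coset] at *
  rw [← hw]
  ext k l
  rw [relPos_eq h' h, relPos_eq h' h, Nat.cast_inj]
  refine Finset.card_bij (fun x _ => (simpleRefl d i).1 x) ?_
    (fun _ _ _ _ h => (simpleRefl d i).1.injective h) ?_
  · intro x hx
    simp only [Finset.mem_filter, Finset.mem_univ, true_and, simpleRefl_mul_inv_apply] at *
    rwa [apply_simpleRefl_of_eq hrev hi]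
  · intro x hx
    simp only [Finset.mem_filter, Finset.mem_univ, true_and, simpleRefl_mul_inv_apply] at *
    refine ⟨(simpleRefl d i).1 x, ?_, simpleRefl_apply_apply i x⟩
    rwa [apply_simpleRefl_of_eq hrev hi, simpleRefl_apply_apply]

/-! ### Symmetrizers -/

section Symmetrizer

variable {κ : Fin (2 * d + 1) → Fin n}

theorem Tgen_mul_symm (hrev : ∀ x, κ x.rev = (κ x).rev) {i : Fin d}
    (hi : κ (lowPos i) = κ (highPos i)) :
    Tgen d i * fibreSum κ κ = v ^ 2 • fibreSum κ κ := by
  refine Tgen_mul_sum fun w hw => ?_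
  rw [mem_fibre] at *
  intro x
  rw [simpleRefl_mul_inv_apply, hw, apply_simpleRefl_of_eq hrev hi]

theorem symm_mul_Tgen (hrev : ∀ x, κ x.rev = (κ x).rev) {i : Fin d}
    (hi : κ (lowPos i) = κ (highPos i)) :
    fibreSum κ κ * Tgen d i = v ^ 2 • fibreSum κ κ := by
  refine sum_mul_Tgen fun w hw => ?_
  rw [mem_fibre] at *
  intro x
  rw [← wb_coe_inv, mul_inv_rev, simpleRefl_inv]
  change κ ((simpleRefl d i).1 (w.1⁻¹ x)) = _
  rw [apply_simpleRefl_of_eq hrev hi, hw]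

theorem fibre_induction (hκ : Monotone κ) (hrev : ∀ x, κ x.rev = (κ x).rev) {P : WB d → Prop}
    (one : P 1) (step : ∀ (i : Fin d) (w : WB d), κ (lowPos i) = κ (highPos i) →
      len w < len (simpleRefl d i * w) → P w → P (simpleRefl d i * w)) {w : WB d}
    (hw : w ∈ fibre κ κ) : P w := by
  induction w using left_induction with
  | one => exact one
  | step i w h ih =>
    have h1 := len_lt_simpleRefl_mul_iff.1 h
    rw [mem_fibre] at hw
    have h2 : κ (lowPos i) = κ (highPos i) := by
      refine le_antisymm (hκ (lowPos_lt_highPos i).le) ?_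
      have h3 := mt (simpleRefl_flip i w).1 (not_not.2 h1)
      have h4 := hκ (not_lt.1 h3)
      rwa [hw, hw] at h4
    refine step i w h2 h (ih ?_)
    rw [mem_fibre]
    intro x
    have h3 := hw ((simpleRefl d i).1 x)
    rwa [simpleRefl_mul_inv_apply, simpleRefl_apply_apply, apply_simpleRefl_of_eq hrev h2] at h3

theorem T_mul_of_invariant (hκ : Monotone κ) (hrev : ∀ x, κ x.rev = (κ x).rev) {h : Hecke d}
    (hh : ∀ i, κ (lowPos i) = κ (highPos i) → Tgen d i * h = v ^ 2 • h) {w : WB d}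
    (hw : w ∈ fibre κ κ) : T w * h = v ^ (2 * len w) • h := by
  refine fibre_induction hκ hrev (P := fun w => T w * h = v ^ (2 * len w) • h) ?_ ?_ hw
  · rw [T_one, one_mul, len_one, mul_zero, pow_zero, one_smul]
  · intro i w hi hl ih
    rw [← Tgen_mul_T_up hl, mul_assoc, ih, mul_smul_comm, hh i hi, smul_smul,
      len_simpleRefl_mul (len_lt_simpleRefl_mul_iff.1 hl), mul_add, pow_add, mul_one]

theorem mul_T_of_invariant (hκ : Monotone κ) (hrev : ∀ x, κ x.rev = (κ x).rev) {h : Hecke d}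
    (hh : ∀ i, κ (lowPos i) = κ (highPos i) → h * Tgen d i = v ^ 2 • h) {w : WB d}
    (hw : w ∈ fibre κ κ) : h * T w = v ^ (2 * len w) • h := by
  refine fibre_induction hκ hrev (P := fun w => h * T w = v ^ (2 * len w) • h) ?_ ?_ hw
  · rw [T_one, mul_one, len_one, mul_zero, pow_zero, one_smul]
  · intro i w hi hl ih
    rw [← Tgen_mul_T_up hl, ← mul_assoc, hh i hi, smul_mul_assoc, ih, smul_smul,
      len_simpleRefl_mul (len_lt_simpleRefl_mul_iff.1 hl), mul_add, pow_add, mul_one, mul_comm]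

/-- The Poincaré polynomial of the parabolic subgroup. -/
def poincare (κ : Fin (2 * d + 1) → Fin n) : Qv := ∑ w ∈ fibre κ κ, v ^ (2 * len w)

theorem one_mem_fibre : (1 : WB d) ∈ fibre κ κ := by
  rw [mem_fibre]
  intro x
  rfl

theorem poincare_ne_zero (κ : Fin (2 * d + 1) → Fin n) : poincare κ ≠ 0 :=
  sum_pow_v_ne_zero ⟨1, one_mem_fibre⟩ _

theorem symm_mul_of_invariant (hκ : Monotone κ) (hrev : ∀ x, κ x.rev = (κ x).rev) {h : Hecke d}
    (hh : ∀ i, κ (lowPos i) = κ (highPos i) → Tgen d i * h = v ^ 2 • h) :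
    fibreSum κ κ * h = poincare κ • h := by
  rw [fibreSum, Finset.sum_mul, poincare, Finset.sum_smul]
  exact Finset.sum_congr rfl fun w hw => T_mul_of_invariant hκ hrev hh hw

theorem inv_mem_fibre {w : WB d} (hw : w ∈ fibre κ κ) : w⁻¹ ∈ fibre κ κ := by
  rw [mem_fibre] at *
  intro x
  rw [← hw]
  exact congrArg κ (w.1.symm_apply_apply x)

/-- The idempotent of the parabolic subgroup. -/
def idem (κ : Fin (2 * d + 1) → Fin n) : Hecke d := (poincare κ)⁻¹ • fibreSum κ κ

theorem Tgen_mul_idem (hrev : ∀ x, κ x.rev = (κ x).rev) {i : Fin d}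
    (hi : κ (lowPos i) = κ (highPos i)) : Tgen d i * idem κ = v ^ 2 • idem κ := by
  rw [idem, mul_smul_comm, Tgen_mul_symm hrev hi, smul_comm]

theorem idem_mul_Tgen (hrev : ∀ x, κ x.rev = (κ x).rev) {i : Fin d}
    (hi : κ (lowPos i) = κ (highPos i)) : idem κ * Tgen d i = v ^ 2 • idem κ := by
  rw [idem, smul_mul_assoc, symm_mul_Tgen hrev hi, smul_comm]

theorem idem_mul_of_invariant (hκ : Monotone κ) (hrev : ∀ x, κ x.rev = (κ x).rev) {h : Hecke d}
    (hh : ∀ i, κ (lowPos i) = κ (highPos i) → Tgen d i * h = v ^ 2 • h) : idem κ * h = h := by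
  rw [idem, smul_mul_assoc, symm_mul_of_invariant hκ hrev hh, smul_smul,
    inv_mul_cancel₀ (poincare_ne_zero κ), one_smul]

theorem barHecke_sum {ι : Type*} (s : Finset ι) (f : ι → Hecke d) :
    barHecke (∑ i ∈ s, f i) = ∑ i ∈ s, barHecke (f i) :=
  map_sum (⟨⟨barHecke, barHecke_zero⟩, barHecke_add⟩ : Hecke d →+ Hecke d) f s

/-- With `x` the symmetrizer and `P` the Poincaré polynomial, `x x̄` is computed twice. Since `x̄`
is again left invariant, it is `P x̄`; since `x` absorbs each `(T_{w⁻¹})⁻¹` as `v^{-2 ℓ(w)}`, it is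
`P̄ x`. Hence `x̄ / P̄ = x / P`. -/
theorem barHecke_idem (hκ : Monotone κ) (hrev : ∀ x, κ x.rev = (κ x).rev) :
    barHecke (idem κ) = idem κ := by
  set x := fibreSum κ κ with hx
  have h1 : x * barHecke x = poincare κ • barHecke x := by
    refine symm_mul_of_invariant hκ hrev fun i hi => ?_
    have h2 := congrArg barHecke (Tgen_mul_symm hrev hi)
    rw [barHecke_mul, barHecke_smul, barHecke_Tgen, barQ_pow, ← hx] at h2
    have h3 := congrArg (fun y => v ^ 2 • (Tgen d i * y)) h2
    simp only [← mul_assoc, Tgen_mul_TgenInv, one_mul, mul_smul_comm, smul_smul] at h3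
    rw [h3]
    push_cast
    rw [mul_comm, v_sq_inv, one_smul]
  have h2 : x * barHecke x = barQ (poincare κ) • x := by
    conv_lhs => rw [hx, fibreSum, barHecke_sum]
    rw [Finset.mul_sum, poincare, map_sum, Finset.sum_smul]
    refine Finset.sum_congr rfl fun w hw => ?_
    have h3 : x * T w⁻¹ = v ^ (2 * len w) • x := by
      rw [← len_inv w]
      exact mul_T_of_invariant hκ hrev (fun i hi => symm_mul_Tgen hrev hi) (inv_mem_fibre hw)
    have h4 := congrArg (fun y => y * Tbar w) h3
    simp only [mul_assoc, (Tbar_mul_T_inv w).2, mul_one, smul_mul_assoc] at h4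
    change x * _ = _
    rw [barHecke_T, barQ_pow, zpow_neg, zpow_natCast, eq_inv_smul_iff₀
      (pow_ne_zero _ v_ne_zero), ← h4]
  have h5 : barQ (poincare κ) ≠ 0 := (map_ne_zero barQ).2 (poincare_ne_zero κ)
  rw [idem, barHecke_smul, map_inv₀, inv_smul_eq_iff₀ h5, ← hx, smul_comm, ← h2, h1, smul_smul,
    inv_mul_cancel₀ (poincare_ne_zero κ), one_smul]

end Symmetrizer

end

section

/-! ### Every centrally symmetric matrix labels a double coset -/

/-- Conjugating `ι` to `Fin N` and composing with the reversal gives an increasing self-map, which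
must be the identity. -/
theorem exists_rank {X L : Type*} [Fintype X] [LinearOrder L] (f : X → L)
    (hf : Function.Injective f) (ι : X → X) (hι : ∀ x y, f x < f y → f (ι y) < f (ι x)) {N : ℕ}
    (hN : Fintype.card X = N) :
    ∃ R : X ≃ Fin N, (∀ x y, f x < f y → R x < R y) ∧ ∀ x, R (ι x) = (R x).rev := by
  let _ : LinearOrder X := LinearOrder.lift' f hf
  let e := Fintype.orderIsoFinOfCardEq X hN
  have h1 : StrictMono fun k : Fin N => (e.symm (ι (e k))).rev := by
    intro a b hab
    rw [Fin.rev_lt_rev]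
    apply e.symm.strictMono
    exact hι _ _ (e.strictMono hab)
  have h2 : h1.orderIsoOfSurjective _ (Finite.surjective_of_injective h1.injective) =
    OrderIso.refl _ := Subsingleton.elim _ _
  refine ⟨e.symm.toEquiv, fun x y hxy => e.symm.strictMono hxy, fun x => ?_⟩
  have h3 : (e.symm (ι (e (e.symm x)))).rev = e.symm x := DFunLike.congr_fun h2 (e.symm x)
  rw [e.apply_symm_apply] at h3
  rw [← Fin.rev_rev (e.symm.toEquiv (ι x))]
  exact congrArg Fin.rev h3

variable {n d : ℕ}

/-- The cells of a matrix of natural numbers. -/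
abbrev Cell (m : Fin n → Fin n → ℕ) : Type := Σ p : Fin n × Fin n, Fin (m p.1 p.2)

theorem cell_ext {m : Fin n → Fin n → ℕ} {x y : Cell m} (h1 : x.1.1 = y.1.1)
    (h2 : x.1.2 = y.1.2) (h3 : (x.2 : ℕ) = y.2) : x = y := by
  obtain ⟨⟨i, j⟩, k⟩ := x
  obtain ⟨⟨i', j'⟩, k'⟩ := y
  obtain rfl : i = i' := h1
  obtain rfl : j = j' := h2
  obtain rfl : k = k' := Fin.ext h3
  rfl

theorem card_cells {m : Fin n → Fin n → ℕ} (P : Fin n × Fin n → Prop) [DecidablePred P] :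
    (Finset.univ.filter fun x : Cell m => P x.1).card =
      ∑ p ∈ Finset.univ.filter P, m p.1 p.2 := by
  have h : (Finset.univ.filter fun x : Cell m => P x.1) =
      (Finset.univ.filter P).sigma fun p => (Finset.univ : Finset (Fin (m p.1 p.2))) := by
    ext x
    simp
  rw [h, Finset.card_sigma]
  simp

/-- The cells of the matrix are listed once by rows and once by columns, and `w` sends the column
rank of a cell to its row rank. The rotation of the matrix reverses both lists, so `w` commutes with
the reversal. -/
theorem exists_relPos {lam μ : Fin n → ℕ} {M : Matrix (Fin n) (Fin n) ℤ} (h0 : ∀ i j, 0 ≤ M i j)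
    (hrev : ∀ i j, M i.rev j.rev = M i j) (hr : ∀ i, ∑ j, M i j = lam i)
    (hc : ∀ j, ∑ i, M i j = μ j) (hd : ∑ i, lam i = 2 * d + 1) :
    ∃ w : WB d, relPos lam μ w = M := by
  set m : Fin n → Fin n → ℕ := fun i j => (M i j).toNat with hm
  have hmM : ∀ i j, (m i j : ℤ) = M i j := fun i j => Int.toNat_of_nonneg (h0 i j)
  have hmrev : ∀ i j, m i.rev j.rev = m i j := fun i j => by rw [hm]; simp only [hrev]
  have hmr : ∀ i, ∑ j, m i j = lam i := by
    intro i
    rw [← Nat.cast_inj (R := ℤ)]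
    push_cast
    simp only [hmM, hr]
  have hmc : ∀ j, ∑ i, m i j = μ j := by
    intro j
    rw [← Nat.cast_inj (R := ℤ)]
    push_cast
    simp only [hmM, hc]
  have hrow : ∀ i, (Finset.univ.filter fun x : Cell m => x.1.1 = i).card = lam i := by
    intro i
    rw [card_cells fun p => p.1 = i, ← hmr i]
    refine Finset.sum_bij' (fun p _ => p.2) (fun j _ => (i, j)) ?_ ?_ ?_ ?_ ?_ <;> simp
    rintro a b rfl
    rfl
  have hcol : ∀ j, (Finset.univ.filter fun x : Cell m => x.1.2 = j).card = μ j := by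
    intro j
    rw [card_cells fun p => p.2 = j, ← hmc j]
    refine Finset.sum_bij' (fun p _ => p.1) (fun i _ => (i, j)) ?_ ?_ ?_ ?_ ?_ <;> simp
  have hcard : Fintype.card (Cell m) = 2 * d + 1 := by
    rw [← hd, ← Finset.card_univ,
      Finset.card_eq_sum_card_fiberwise (f := fun x : Cell m => x.1.1) (t := Finset.univ)
        (by simp [Set.MapsTo])]
    exact Finset.sum_congr rfl fun i _ => hrow i
  let ι : Cell m → Cell m := fun x => ⟨(x.1.1.rev, x.1.2.rev), ⟨m x.1.1 x.1.2 - 1 - x.2, by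
    simp only [hmrev]
    have := x.2.2
    omega⟩⟩
  -- The index inside an entry is centred at zero, so that the rotation, which reverses each entry,
  -- negates it; this is what makes `ι` order-reversing.
  let f : Cell m → Fin n ×ₗ Fin n ×ₗ ℤ := fun x =>
    toLex (x.1.1, toLex (x.1.2, (2 * (x.2 : ℕ) + 1 - m x.1.1 x.1.2 : ℤ)))
  let g : Cell m → Fin n ×ₗ Fin n ×ₗ ℤ := fun x =>
    toLex (x.1.2, toLex (x.1.1, (2 * (x.2 : ℕ) + 1 - m x.1.1 x.1.2 : ℤ)))
  have hz : ∀ x : Cell m, (2 * ((ι x).2 : ℕ) + 1 - m (ι x).1.1 (ι x).1.2 : ℤ) =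
      -(2 * (x.2 : ℕ) + 1 - m x.1.1 x.1.2 : ℤ) := by
    intro x
    have h1 := x.2.2
    have h2 : ((ι x).2 : ℕ) = m x.1.1 x.1.2 - 1 - x.2 := rfl
    have h3 : m (ι x).1.1 (ι x).1.2 = m x.1.1 x.1.2 := hmrev _ _
    omega
  have hinj : ∀ x y : Cell m, x.1.1 = y.1.1 → x.1.2 = y.1.2 →
      (2 * (x.2 : ℕ) + 1 - m x.1.1 x.1.2 : ℤ) = (2 * (y.2 : ℕ) + 1 - m y.1.1 y.1.2 : ℤ) →
      x = y := by
    intro x y h1 h2 h3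
    refine cell_ext h1 h2 ?_
    have h4 : m x.1.1 x.1.2 = m y.1.1 y.1.2 := by simp only [h1, h2]
    omega
  obtain ⟨R, hR1, hR2⟩ := exists_rank f (by
    intro x y hxy
    have h1 := congrArg (fun z => (ofLex z).1) hxy
    have h2 := congrArg (fun z => (ofLex (ofLex z).2).1) hxy
    have h3 := congrArg (fun z => (ofLex (ofLex z).2).2) hxy
    exact hinj x y h1 h2 h3) ι (by
    intro x y hxy
    simp only [f, Prod.Lex.toLex_lt_toLex] at *
    rw [hz, hz]
    simp only [ι, Fin.rev_lt_rev, Fin.rev_inj, neg_lt_neg_iff]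
    tauto) hcard
  obtain ⟨C, hC1, hC2⟩ := exists_rank g (by
    intro x y hxy
    have h1 := congrArg (fun z => (ofLex z).1) hxy
    have h2 := congrArg (fun z => (ofLex (ofLex z).2).1) hxy
    have h3 := congrArg (fun z => (ofLex (ofLex z).2).2) hxy
    exact hinj x y h2 h1 h3) ι (by
    intro x y hxy
    simp only [g, Prod.Lex.toLex_lt_toLex] at *
    rw [hz, hz]
    simp only [ι, Fin.rev_lt_rev, Fin.rev_inj, neg_lt_neg_iff]
    tauto) hcard
  have hκ' : IsBlockMap d lam fun x => (R.symm x).1.1 := by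
    refine ⟨fun x y hxy => ?_, fun i => ?_⟩
    · by_contra hlt
      have h1 := hR1 (R.symm y) (R.symm x) (Prod.Lex.toLex_lt_toLex.2 (Or.inl (not_le.1 hlt)))
      rw [R.apply_symm_apply, R.apply_symm_apply] at h1
      exact absurd h1 hxy.not_gt
    · rw [← hrow i]
      refine Finset.card_bij' (fun x _ => R.symm x) (fun x _ => R x) ?_ ?_ ?_ ?_ <;> simp
  have hκ : IsBlockMap d μ fun x => (C.symm x).1.2 := by
    refine ⟨fun x y hxy => ?_, fun i => ?_⟩
    · by_contra hlt
      have h1 := hC1 (C.symm y) (C.symm x) (Prod.Lex.toLex_lt_toLex.2 (Or.inl (not_le.1 hlt)))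
      rw [C.apply_symm_apply, C.apply_symm_apply] at h1
      exact absurd h1 hxy.not_gt
    · rw [← hcol i]
      refine Finset.card_bij' (fun x _ => C.symm x) (fun x _ => C x) ?_ ?_ ?_ ?_ <;> simp
  let w : WB d := ⟨C.symm.trans R, by
    rw [Subgroup.mem_centralizer_singleton_iff]
    ext1 x
    obtain ⟨s, rfl⟩ := C.surjective x
    change R (C.symm (C s).rev) = (R (C.symm (C s))).rev
    rw [← hC2, C.symm_apply_apply, C.symm_apply_apply, hR2]⟩
  refine ⟨w, ?_⟩
  ext i j
  rw [relPos_eq hκ' hκ, ← hmM, Nat.cast_inj]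
  have h1 := card_cells (m := m) fun p => p = (i, j)
  rw [Finset.filter_eq' Finset.univ (i, j), if_pos (Finset.mem_univ _), Finset.sum_singleton] at h1
  rw [← h1]
  have hw : ∀ x, w.1⁻¹ x = C (R.symm x) := fun x => rfl
  refine Finset.card_bij' (fun x _ => R.symm x) (fun x _ => R x) ?_ ?_ ?_ ?_ <;>
    simp [hw, Prod.ext_iff]

/-! ### Uniqueness of stable expansions -/

/-- The coefficient of `T_w` in the entry `(lam, μ)`. -/
def schurCoeff (lam μ : Wt n d) (w : WB d) : SchurMat n d →ₗ[Qv] Qv where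
  toFun X := heckeCoeff (X lam μ) w
  map_add' _ _ := rfl
  map_smul' _ _ := rfl

theorem heckeCoeff_sum_T (S : Finset (WB d)) (w : WB d) :
    heckeCoeff (∑ x ∈ S, T x) w = if w ∈ S then 1 else 0 := by
  change (heckeCoeffₗ d (∑ x ∈ S, T x)) w = _
  rw [map_sum, Finsupp.finsetSum_apply]
  have : ∀ x : WB d, (heckeCoeffₗ d (T x)) w = if x = w then 1 else 0 := by
    intro x
    change (heckeCoeff (T x)) w = _
    rw [heckeCoeff_T, Finsupp.single_apply]
  simp only [this, Finset.sum_ite_eq']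

theorem one_mem_parab (μ : Fin n → ℕ) : (1 : WB d) ∈ parab d μ := by
  simp [parab]

theorem schurCoeff_std (lam μ : Wt n d) (w : WB d) (M : Matrix (Fin n) (Fin n) ℤ) :
    ∃ c ≠ 0, schurCoeff lam μ w (std n d M) = if w ∈ coset lam.1 μ.1 M then c else 0 := by
  refine ⟨v ^ (((Finset.sup (parab d μ.1) len : ℕ) : ℤ) -
      ((Finset.sup (coset (d := d) lam.1 μ.1 M) len : ℕ) : ℤ)) /
      ∑ w ∈ parab d μ.1, v ^ (2 * len w), ?_, ?_⟩
  · exact div_ne_zero (v_zpow_ne_zero _) (sum_pow_v_ne_zero ⟨1, one_mem_parab _⟩ _)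
  · change ((_ : Qv) • heckeCoeff (∑ x ∈ coset (d := d) lam.1 μ.1 M, T x)) w = _
    rw [Finsupp.smul_apply, heckeCoeff_sum_T, smul_eq_mul, mul_ite, mul_one, mul_zero]

theorem shift_apply (p : ℕ) (A : TXi n) (i j : Fin n) :
    shift p A i j = A.1 i j + if i = j then (p : ℤ) else 0 := by
  simp only [shift, Matrix.add_apply, Matrix.smul_apply, Matrix.one_apply, smul_eq_mul]
  split_ifs <;> simp

theorem shift_injective (p : ℕ) : Function.Injective (shift (n := n) p) := by
  intro A B h
  exact Subtype.ext (add_right_cancel h)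

theorem rev_eq_iff {mid : Fin n} (hmid : mid.rev = mid) (i : Fin n) :
    i.rev = i ↔ i = mid := by
  simp only [Fin.ext_iff, Fin.val_rev] at *
  have := i.2
  have := mid.2
  omega

theorem exists_rev_eq (hn : Odd n) : ∃ mid : Fin n, mid.rev = mid := by
  obtain ⟨r, rfl⟩ := hn
  refine ⟨⟨r, by omega⟩, ?_⟩
  rw [Fin.ext_iff, Fin.val_rev]
  simp only
  omega

/-- The rotation pairs off all entries except the central one, which is odd. The total is therefore
of the form `2d + 1`, as needed for a double coset in type B. -/
theorem odd_sum_of_symm (hn : Odd n) {M : Matrix (Fin n) (Fin n) ℤ}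
    (hrev : ∀ i j, M i.rev j.rev = M i j) (hodd : ∀ i, i.rev = i → Odd (M i i)) :
    Odd (∑ i, ∑ j, M i j) := by
  obtain ⟨mid, hmid⟩ := exists_rev_eq hn
  have h0 : ∑ p ∈ (Finset.univ : Finset (Fin n × Fin n)).erase (mid, mid),
      ((M p.1 p.2 : ℤ) : ZMod 2) = 0 := by
    refine Finset.sum_involution (fun p _ => (p.1.rev, p.2.rev)) ?_ ?_ ?_ ?_
    · intro p _
      simp only [hrev]
      exact CharTwo.add_self_eq_zero _
    · intro p hp _ h
      rw [Prod.ext_iff] at h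
      refine (Finset.mem_erase.1 hp).1 (Prod.ext ?_ ?_)
      · exact (rev_eq_iff hmid _).1 h.1
      · exact (rev_eq_iff hmid _).1 h.2
    · intro p hp
      rw [Finset.mem_erase] at *
      refine ⟨fun h => hp.1 ?_, Finset.mem_univ _⟩
      rw [Prod.ext_iff] at *
      simp only at h
      exact ⟨by rw [← Fin.rev_rev p.1, h.1, hmid], by rw [← Fin.rev_rev p.2, h.2, hmid]⟩
    · intro p _
      simp
  have h1 : ∑ i, ∑ j, M i j = M mid mid +
      ∑ p ∈ (Finset.univ : Finset (Fin n × Fin n)).erase (mid, mid), M p.1 p.2 := by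
    rw [← Fintype.sum_prod_type (fun p : Fin n × Fin n => M p.1 p.2)]
    exact (Finset.add_sum_erase _ (fun p : Fin n × Fin n => M p.1 p.2)
      (Finset.mem_univ (mid, mid))).symm
  rw [h1]
  refine (hodd mid hmid).add_even ?_
  rw [even_iff_two_dvd]
  have := (ZMod.intCast_zmod_eq_zero_iff_dvd (∑ p ∈ (Finset.univ :
    Finset (Fin n × Fin n)).erase (mid, mid), M p.1 p.2) 2).1 (by push_cast; exact h0)
  exact_mod_cast this

/-- A large shift of an element of `Ξ̃` labels a nonempty double coset. -/
theorem exists_mem_coset_shift (hn : Odd n) (Z : TXi n) :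
    ∃ p₀ : ℕ, ∀ p ≥ p₀, Even p → ∃ (d : ℕ) (lam μ : Wt n d) (w : WB d),
      w ∈ coset lam.1 μ.1 (shift p Z) := by
  refine ⟨∑ i, (Z.1 i i).natAbs, fun p hp hpe => ?_⟩
  set M := shift p Z with hM
  have hrev : ∀ i j, M i.rev j.rev = M i j := by
    intro i j
    rw [hM, shift_apply, shift_apply, Z.2.2.2]
    simp
  have h0 : ∀ i j, 0 ≤ M i j := by
    intro i j
    rw [hM, shift_apply]
    split_ifs with h
    · subst h
      have := Finset.single_le_sum (f := fun i => (Z.1 i i).natAbs) (fun _ _ => Nat.zero_le _)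
        (Finset.mem_univ i)
      omega
    · simpa using Z.2.1 i j h
  have hodd : Odd (∑ i, ∑ j, M i j) := by
    refine odd_sum_of_symm hn hrev fun i hi => ?_
    rw [hM, shift_apply, if_pos rfl]
    exact (Z.2.2.1 i hi).add_even (by exact_mod_cast hpe)
  have hrow : ∀ i, ((∑ j, M i j).toNat : ℤ) = ∑ j, M i j := fun i =>
    Int.toNat_of_nonneg (Finset.sum_nonneg fun j _ => h0 i j)
  have hcol : ∀ j, ((∑ i, M i j).toNat : ℤ) = ∑ i, M i j := fun i =>
    Int.toNat_of_nonneg (Finset.sum_nonneg fun j _ => h0 j i)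
  obtain ⟨k, hk⟩ := hodd
  have hk0 : 0 ≤ k := by
    have : 0 ≤ ∑ i, ∑ j, M i j := Finset.sum_nonneg fun i _ => Finset.sum_nonneg fun j _ => h0 i j
    omega
  have hs1 : ∑ i, (∑ j, M i j).toNat = 2 * k.toNat + 1 := by
    rw [← Nat.cast_inj (R := ℤ)]
    push_cast
    simp only [hrow]
    omega
  have hs2 : ∑ j, (∑ i, M i j).toNat = 2 * k.toNat + 1 := by
    rw [← Nat.cast_inj (R := ℤ)]
    push_cast
    simp only [hcol]
    rw [Finset.sum_comm]
    omega
  have hr1 : ∀ i : Fin n, (∑ j, M i.rev j).toNat = (∑ j, M i j).toNat := by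
    intro i
    rw [← Equiv.sum_comp Fin.revPerm]
    simp [hrev]
  have hr2 : ∀ j : Fin n, (∑ i, M i j.rev).toNat = (∑ i, M i j).toNat := by
    intro i
    rw [← Equiv.sum_comp Fin.revPerm]
    simp [hrev]
  obtain ⟨w, hw⟩ := exists_relPos (d := k.toNat) (lam := fun i => (∑ j, M i j).toNat)
    (μ := fun j => (∑ i, M i j).toNat) h0 hrev (fun i => (hrow i).symm) (fun j => (hcol j).symm) hs1
  refine ⟨k.toNat, ⟨fun i => (∑ j, M i j).toNat, ?_⟩, ⟨fun j => (∑ i, M i j).toNat, ?_⟩, w,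
    mem_coset.2 hw⟩
  · simp only [Finset.mem_filter, Finset.mem_piAntidiag, Finset.mem_univ, implies_true, and_true]
    exact ⟨hs1, hr1⟩
  · simp only [Finset.mem_filter, Finset.mem_piAntidiag, Finset.mem_univ, implies_true, and_true]
    exact ⟨hs2, hr2⟩

/-- Distinct matrices label disjoint sets, so the coefficient of one `T_w` in the double coset of
`Z` isolates the summand of `Z`. The factor `c` comes from the normalization and does not depend on
`G` or `x`. -/
theorem schurCoeff_sum_shift {p : ℕ} {Z : TXi n} {lam μ : Wt n d} {w : WB d}
    (hw : w ∈ coset lam.1 μ.1 (shift p Z)) :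
    ∃ c ≠ 0, ∀ (G : TXi n →₀ (ℤ →₀ Qv)) (x : Qv),
      schurCoeff lam μ w (G.sum fun Z g => evalLaurent g x • std n d (shift p Z)) =
        evalLaurent (G Z) x * c := by
  obtain ⟨c, hc0, hc⟩ := schurCoeff_std lam μ w (shift p Z)
  rw [if_pos hw] at hc
  refine ⟨c, hc0, fun G x => ?_⟩
  rw [Finsupp.sum, map_sum, Finset.sum_eq_single Z]
  · rw [map_smul, hc, smul_eq_mul]
  · intro Z' _ hZ
    obtain ⟨c', -, hc'⟩ := schurCoeff_std lam μ w (shift p Z')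
    rw [map_smul, hc', if_neg, smul_zero]
    intro h
    rw [mem_coset] at h hw
    exact hZ (shift_injective p (h.symm.trans hw))
  · intro h
    rw [Finsupp.notMem_support_iff.1 h]
    simp

/-- The difference of two coefficients vanishes at `v' = v^{-p}` for all large even `p`, because `Z
+ p I` then labels a nonempty double coset for some `d`. Uniqueness makes the choice in
`stableLimit` harmless. -/
theorem HasStableExpansion.unique (hn : Odd n) {F : (p d : ℕ) → SchurMat n d}
    {G G' : TXi n →₀ (ℤ →₀ Qv)} (h : HasStableExpansion F G) (h' : HasStableExpansion F G') :
    G = G' := by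
  obtain ⟨p₁, h1⟩ := h
  obtain ⟨p₂, h2⟩ := h'
  ext1 Z
  obtain ⟨p₃, h3⟩ := exists_mem_coset_shift hn Z
  rw [← sub_eq_zero]
  refine laurent_eq_zero_of_evalLaurent (p₀ := max p₁ (max p₂ p₃)) fun p hp hpe => ?_
  obtain ⟨d, lam, μ, w, hw⟩ := h3 p (by omega) hpe
  obtain ⟨c, hc0, hc⟩ := schurCoeff_sum_shift hw
  have h4 := (h1 p (by omega) hpe d).symm.trans (h2 p (by omega) hpe d)
  have h5 := congrArg (schurCoeff lam μ w) h4
  rw [hc, hc] at h5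
  rw [evalLaurent_sub, sub_eq_zero]
  exact mul_right_cancel₀ hc0 h5

theorem stableLimit_eq (hn : Odd n) {F : (p d : ℕ) → SchurMat n d}
    {G : TXi n →₀ (ℤ →₀ Qv)} (h : HasStableExpansion F G) (A : TXi n) :
    stableLimit F A = evalLaurent (G A) 1 := by
  have hex : ∃ G, HasStableExpansion F G := ⟨G, h⟩
  rw [stableLimit, dif_pos hex, Finsupp.mapRange_apply, hex.choose_spec.unique hn h]

end

section

variable {n d : ℕ}

/-! ### Moving one position (and its mirror image) to another block -/

/-- The labelling `χ` with the label of `p` changed to `β`, and that of its mirror image to the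
mirror image of `β`. -/
def move (χ : Fin (2 * d + 1) → Fin n) (p : Fin (2 * d + 1)) (β : Fin n) :
    Fin (2 * d + 1) → Fin n :=
  fun z => if z = p then β else if z = p.rev then β.rev else χ z

variable {χ φ : Fin (2 * d + 1) → Fin n} {p : Fin (2 * d + 1)} {α β : Fin n}

@[simp] theorem move_self : move χ p β p = β := by simp [move]

theorem move_of_ne {z : Fin (2 * d + 1)} (h1 : z ≠ p) (h2 : z ≠ p.rev) : move χ p β z = χ z := by
  simp [move, h1, h2]

theorem move_rev_self (hp : p ≠ p.rev) : move χ p β p.rev = β.rev := by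
  simp [move, hp.symm]

theorem move_rev (hχ : ∀ x, χ x.rev = (χ x).rev) (hp : p ≠ p.rev) (x : Fin (2 * d + 1)) :
    move χ p β x.rev = (move χ p β x).rev := by
  by_cases h1 : x = p
  · rw [h1, move_rev_self hp, move_self]
  by_cases h2 : x = p.rev
  · rw [h2, Fin.rev_rev, move_rev_self hp, move_self, Fin.rev_rev]
  rw [move_of_ne h1 h2, move_of_ne, hχ]
  · rwa [Ne, Fin.rev_eq_iff]
  · rwa [Ne, Fin.rev_inj]

theorem move_comp_simpleRefl (hχ : ∀ x, χ x.rev = (χ x).rev) {i : Fin d}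
    (hi : χ (lowPos i) = χ (highPos i)) (p : Fin (2 * d + 1)) (β : Fin n) :
    (fun x => move χ p β ((simpleRefl d i).1 x)) = move χ ((simpleRefl d i).1 p) β := by
  ext1 z
  have h : ∀ q, (simpleRefl d i).1 z = q ↔ z = (simpleRefl d i).1 q := by
    intro q
    constructor
    · rintro rfl
      rw [simpleRefl_apply_apply]
    · rintro rfl
      rw [simpleRefl_apply_apply]
  simp only [move, h, wb_rev, apply_simpleRefl_of_eq hχ hi]

/-- The row sums recover the diagonal, so only the few nonzero off-diagonal entries have to be
examined. -/
theorem mem_coset_iff_offDiag {lam μ : Fin n → ℕ} {κ' κ : Fin (2 * d + 1) → Fin n}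
    (h' : IsBlockMap d lam κ') (h : IsBlockMap d μ κ) {M : Matrix (Fin n) (Fin n) ℤ}
    (hM : ∀ i, ∑ j, M i j = lam i) {w : WB d} :
    w ∈ coset lam μ M ↔ ∀ i j, i ≠ j →
      ((Finset.univ.filter fun x => κ' x = i ∧ κ (w.1⁻¹ x) = j).card : ℤ) = M i j := by
  rw [mem_coset]
  constructor
  · rintro rfl i j _
    rw [relPos_eq h' h]
  · intro hoff
    have hrow : ∀ i, ∑ j, relPos lam μ w i j = lam i := by
      intro i
      rw [← h'.card i, Finset.card_eq_sum_card_fiberwise (f := fun x => κ (w.1⁻¹ x))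
        (t := Finset.univ) (by simp [Set.MapsTo])]
      push_cast
      refine Finset.sum_congr rfl fun j _ => ?_
      rw [relPos_eq h' h, Finset.filter_filter]
    ext i j
    by_cases hij : i = j
    · subst hij
      have h1 := hrow i
      rw [← hM i, ← Finset.add_sum_erase _ _ (Finset.mem_univ i),
        ← Finset.add_sum_erase _ (fun j => M i j) (Finset.mem_univ i)] at h1
      rw [Finset.sum_congr rfl (g := fun j => M i j)] at h1
      · exact add_right_cancel h1
      · intro j hj
        rw [relPos_eq h' h]
        exact hoff i j (Finset.ne_of_mem_erase hj).symm
    · rw [relPos_eq h' h]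
      exact hoff i j hij

/-- The off-diagonal counts record where `φ` differs from `χ`: here at one position and its mirror
image. The hypothesis `hrev` rules out that the cell `(α, β)` is its own mirror image, in which case
the count 1 would not describe a mirror pair. -/
theorem move_char (hχ : ∀ x, χ x.rev = (χ x).rev) (hφ : ∀ x, φ x.rev = (φ x).rev) (hαβ : α ≠ β)
    (hrev : ¬ (α.rev = α ∧ β.rev = β)) :
    (∀ i j, i ≠ j → (Finset.univ.filter fun x => χ x = i ∧ φ x = j).card =
      if (i = α ∧ j = β) ∨ (i = α.rev ∧ j = β.rev) then 1 else 0) ↔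
    ∃ x, χ x = α ∧ x ≠ x.rev ∧ φ = move χ x β := by
  constructor
  · intro h
    have h1 := h α β hαβ
    rw [if_pos (Or.inl ⟨rfl, rfl⟩), Finset.card_eq_one] at h1
    obtain ⟨x, hx⟩ := h1
    have hmem : ∀ z, χ z = α ∧ φ z = β ↔ z = x := by
      intro z
      rw [← Finset.mem_singleton (a := x), ← hx]
      simp
    obtain ⟨h2, h3⟩ := (hmem x).2 rfl
    have hxr : x ≠ x.rev := by
      intro h4
      have h5 := hχ x
      have h6 := hφ x
      rw [← h4, h2] at h5
      rw [← h4, h3] at h6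
      exact hrev ⟨h5.symm, h6.symm⟩
    refine ⟨x, h2, hxr, funext fun z => ?_⟩
    by_cases hz1 : z = x
    · rw [hz1, move_self, h3]
    by_cases hz2 : z = x.rev
    · rw [hz2, move_rev_self hxr, hφ, h3]
    rw [move_of_ne hz1 hz2]
    by_contra hne
    have h4 := h (χ z) (φ z) (Ne.symm hne)
    have h5 : (Finset.univ.filter fun y => χ y = χ z ∧ φ y = φ z).card ≠ 0 := by
      rw [Finset.card_ne_zero]
      exact ⟨z, by simp⟩
    rw [h4] at h5
    split_ifs at h5 with h6
    · rcases h6 with h6 | h6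
      · exact hz1 ((hmem z).1 h6)
      · apply hz2
        rw [← Fin.rev_rev z, (hmem z.rev).1 ⟨by rw [hχ, h6.1, Fin.rev_rev],
          by rw [hφ, h6.2, Fin.rev_rev]⟩]
    · exact h5 rfl
  · rintro ⟨x, hx, hxr, rfl⟩ i j hij
    split_ifs with h
    · rw [Finset.card_eq_one]
      rcases h with ⟨rfl, rfl⟩ | ⟨rfl, rfl⟩
      · refine ⟨x, ?_⟩
        ext z
        simp only [Finset.mem_filter, Finset.mem_univ, true_and, Finset.mem_singleton]
        constructor
        · rintro ⟨h1, h2⟩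
          by_contra hz1
          by_cases hz2 : z = x.rev
          · rw [hz2, hχ, hx] at h1
            rw [hz2, move_rev_self hxr] at h2
            exact hrev ⟨h1, h2⟩
          · rw [move_of_ne hz1 hz2, h1] at h2
            exact hij h2
        · rintro rfl
          exact ⟨hx, move_self⟩
      · refine ⟨x.rev, ?_⟩
        ext z
        simp only [Finset.mem_filter, Finset.mem_univ, true_and, Finset.mem_singleton]
        constructor
        · rintro ⟨h1, h2⟩
          by_contra hz2
          by_cases hz1 : z = x
          · rw [hz1, hx] at h1
            rw [hz1, move_self] at h2
            exact hrev ⟨h1.symm, h2.symm⟩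
          · rw [move_of_ne hz1 hz2, h1] at h2
            exact hij h2
        · rintro rfl
          exact ⟨by rw [hχ, hx], move_rev_self hxr⟩
    · rw [Finset.card_eq_zero, Finset.filter_eq_empty_iff]
      rintro z - ⟨h1, h2⟩
      apply h
      by_cases hz1 : z = x
      · rw [hz1, hx] at h1
        rw [hz1, move_self] at h2
        exact Or.inl ⟨h1.symm, h2.symm⟩
      by_cases hz2 : z = x.rev
      · rw [hz2, hχ, hx] at h1
        rw [hz2, move_rev_self hxr] at h2
        exact Or.inr ⟨h1.symm, h2.symm⟩
      · rw [move_of_ne hz1 hz2, h1] at h2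
        exact absurd h2 hij

theorem ne_rev_of_label (hχ : ∀ x, χ x.rev = (χ x).rev) (hα : α.rev ≠ α) {x : Fin (2 * d + 1)}
    (hx : χ x = α) : x ≠ x.rev := by
  intro h
  have h1 := hχ x
  rw [← h, hx] at h1
  exact hα h1.symm

/-- This is the pattern of `C`: one position changes from `α` to the self-mirror label `β`, another
from `β` to `α`, and their mirror images follow. -/
theorem move_move_char (hχ : ∀ x, χ x.rev = (χ x).rev) (hφ : ∀ x, φ x.rev = (φ x).rev)
    (hαβ : α ≠ β) (hα : α.rev ≠ α) (hβ : β.rev = β) :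
    (∀ i j, i ≠ j → (Finset.univ.filter fun x => χ x = i ∧ φ x = j).card =
      if ((i = α ∨ i = α.rev) ∧ j = β) ∨ (i = β ∧ (j = α ∨ j = α.rev)) then 1 else 0) ↔
    ∃ x y, χ x = α ∧ χ y = β ∧ y ≠ y.rev ∧ φ = move (move χ x β) y α := by
  have hαβ' : α.rev ≠ β := fun h => hαβ (by rw [← hβ, ← h, Fin.rev_rev])
  constructor
  · intro h
    have h1 := h α β hαβ
    rw [if_pos (Or.inl ⟨Or.inl rfl, rfl⟩), Finset.card_eq_one] at h1
    obtain ⟨x, hx⟩ := h1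
    have h1' := h β α hαβ.symm
    rw [if_pos (Or.inr ⟨rfl, Or.inl rfl⟩), Finset.card_eq_one] at h1'
    obtain ⟨y, hy⟩ := h1'
    have hmem : ∀ z, χ z = α ∧ φ z = β ↔ z = x := by
      intro z
      rw [← Finset.mem_singleton (a := x), ← hx]
      simp
    have hmem' : ∀ z, χ z = β ∧ φ z = α ↔ z = y := by
      intro z
      rw [← Finset.mem_singleton (a := y), ← hy]
      simp
    obtain ⟨h2, h3⟩ := (hmem x).2 rfl
    obtain ⟨h2', h3'⟩ := (hmem' y).2 rfl
    have hxr : x ≠ x.rev := ne_rev_of_label hχ hα h2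
    have hyr : y ≠ y.rev := ne_rev_of_label hφ hα h3'
    refine ⟨x, y, h2, h2', hyr, funext fun z => ?_⟩
    by_cases hz1' : z = y
    · rw [hz1', move_self, h3']
    by_cases hz2' : z = y.rev
    · rw [hz2', move_rev_self hyr, hφ, h3']
    rw [move_of_ne hz1' hz2']
    by_cases hz1 : z = x
    · rw [hz1, move_self, h3]
    by_cases hz2 : z = x.rev
    · rw [hz2, move_rev_self hxr, hφ, h3]
    rw [move_of_ne hz1 hz2]
    by_contra hne
    have h4 := h (χ z) (φ z) (Ne.symm hne)
    have h5 : (Finset.univ.filter fun y => χ y = χ z ∧ φ y = φ z).card ≠ 0 := by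
      rw [Finset.card_ne_zero]
      exact ⟨z, by simp⟩
    rw [h4] at h5
    split_ifs at h5 with h6
    · rcases h6 with ⟨h6 | h6, h7⟩ | ⟨h7, h6 | h6⟩
      · exact hz1 ((hmem z).1 ⟨h6, h7⟩)
      · apply hz2
        rw [← Fin.rev_rev z, (hmem z.rev).1 ⟨by rw [hχ, h6, Fin.rev_rev], by rw [hφ, h7, hβ]⟩]
      · exact hz1' ((hmem' z).1 ⟨h7, h6⟩)
      · apply hz2'
        rw [← Fin.rev_rev z, (hmem' z.rev).1 ⟨by rw [hχ, h7, hβ], by rw [hφ, h6, Fin.rev_rev]⟩]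
    · exact h5 rfl
  · rintro ⟨x, y, hx, hy, hyr, rfl⟩ i j hij
    have hxr : x ≠ x.rev := ne_rev_of_label hχ hα hx
    have hχx : χ x.rev = α.rev := by rw [hχ, hx]
    have hχy : χ y.rev = β := by rw [hχ, hy, hβ]
    have hxy : x ≠ y := fun h => hαβ (by rw [← hx, h, hy])
    have hxy' : x ≠ y.rev := fun h => hαβ (by rw [← hx, h, hχy])
    have hxy1 : x.rev ≠ y := fun h => hαβ' (by rw [← hχx, h, hy])
    have hxy2 : x.rev ≠ y.rev := fun h => hαβ' (by rw [← hχx, h, hχy])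
    have e1 : move (move χ x β) y α x = β := by rw [move_of_ne hxy hxy', move_self]
    have e2 : move (move χ x β) y α x.rev = β := by
      rw [move_of_ne hxy1 hxy2, move_rev_self hxr, hβ]
    have e3 : move (move χ x β) y α y = α := move_self
    have e4 : move (move χ x β) y α y.rev = α.rev := move_rev_self hyr
    have e5 : ∀ z, χ z ≠ move (move χ x β) y α z → z = x ∨ z = x.rev ∨ z = y ∨ z = y.rev := by
      intro z hz
      by_contra hcon
      push Not at hcon
      rw [move_of_ne hcon.2.2.1 hcon.2.2.2, move_of_ne hcon.1 hcon.2.1] at hz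
      exact hz rfl
    have key : ∀ {z₀ : Fin (2 * d + 1)}, χ z₀ = i → move (move χ x β) y α z₀ = j →
        (∀ z, (z = x ∨ z = x.rev ∨ z = y ∨ z = y.rev) → χ z = i →
          move (move χ x β) y α z = j → z = z₀) →
        (Finset.univ.filter fun z => χ z = i ∧ move (move χ x β) y α z = j).card = 1 := by
      intro z₀ h1 h2 h3
      rw [Finset.card_eq_one]
      refine ⟨z₀, ?_⟩
      ext z
      simp only [Finset.mem_filter, Finset.mem_univ, true_and, Finset.mem_singleton]
      constructor
      · rintro ⟨h4, h5⟩
        exact h3 z (e5 z (by rw [h4, h5]; exact hij)) h4 h5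
      · rintro rfl
        exact ⟨h1, h2⟩
    split_ifs with h
    · rcases h with ⟨rfl | rfl, rfl⟩ | ⟨rfl, rfl | rfl⟩
      · refine key hx e1 ?_
        rintro z (rfl | rfl | rfl | rfl) h1 h2
        · rfl
        · exact absurd (hχx.symm.trans h1) hα
        · exact absurd (e3.symm.trans h2) hαβ
        · exact absurd (e4.symm.trans h2) hαβ'
      · refine key hχx e2 ?_
        rintro z (rfl | rfl | rfl | rfl) h1 h2
        · exact absurd (hx.symm.trans h1) hα.symm
        · rfl
        · exact absurd (e3.symm.trans h2) hαβ
        · exact absurd (e4.symm.trans h2) hαβ'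
      · refine key hy e3 ?_
        rintro z (rfl | rfl | rfl | rfl) h1 h2
        · exact absurd (hx.symm.trans h1) hαβ
        · exact absurd (hχx.symm.trans h1) hαβ'
        · rfl
        · exact absurd (e4.symm.trans h2) hα
      · refine key hχy e4 ?_
        rintro z (rfl | rfl | rfl | rfl) h1 h2
        · exact absurd (hx.symm.trans h1) hαβ
        · exact absurd (hχx.symm.trans h1) hαβ'
        · exact absurd (e3.symm.trans h2) hα.symm
        · rfl
    · rw [Finset.card_eq_zero, Finset.filter_eq_empty_iff]
      rintro z - ⟨h1, h2⟩
      apply h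
      rcases e5 z (by rw [h1, h2]; exact hij) with rfl | rfl | rfl | rfl
      · exact Or.inl ⟨Or.inl (h1.symm.trans hx), h2.symm.trans e1⟩
      · exact Or.inl ⟨Or.inr (h1.symm.trans hχx), h2.symm.trans e2⟩
      · exact Or.inr ⟨h1.symm.trans hy, Or.inl (h2.symm.trans e3)⟩
      · exact Or.inr ⟨h1.symm.trans hχy, Or.inr (h2.symm.trans e4)⟩

theorem eq_char : (∀ i j, i ≠ j → (Finset.univ.filter fun x => χ x = i ∧ φ x = j).card = 0) ↔
    φ = χ := by
  constructor
  · intro h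
    ext1 z
    by_contra hne
    have h1 := h (χ z) (φ z) (Ne.symm hne)
    rw [Finset.card_eq_zero, Finset.filter_eq_empty_iff] at h1
    exact h1 (Finset.mem_univ z) ⟨rfl, rfl⟩
  · rintro rfl i j hij
    rw [Finset.card_eq_zero, Finset.filter_eq_empty_iff]
    rintro z - ⟨h1, h2⟩
    exact hij (h1.symm.trans h2)

/-! ### Chains of moves -/

/-- The product `T_{σ (l - 1)} ⋯ T_{σ 0}`. -/
def chainOp (σ : ℕ → Fin d) : ℕ → Hecke d
  | 0 => 1
  | l + 1 => Tgen d (σ l) * chainOp σ l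

/-- Each reflection of the chain exchanges positions with equal `χ`-labels, so it only displaces the
one exceptional position. At each step the labels ascend, so the coset is translated and its maximal
length grows by one. -/
theorem fibreSum_chain {κ : Fin (2 * d + 1) → Fin n} (hκ : Monotone κ)
    (hχ : ∀ x, χ x.rev = (χ x).rev) {σ : ℕ → Fin d} {q : ℕ → Fin (2 * d + 1)} {N : ℕ}
    (hσ : ∀ l < N, χ (lowPos (σ l)) = χ (highPos (σ l)))
    (hq : ∀ l < N, q (l + 1) = (simpleRefl d (σ l)).1 (q l))
    (hlt : ∀ l < N, move χ (q l) β (lowPos (σ l)) < move χ (q l) β (highPos (σ l)))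
    (hne : (fibre κ (move χ (q 0) β)).Nonempty) {l : ℕ} (hl : l ≤ N) :
    fibreSum κ (move χ (q l) β) = chainOp σ l * fibreSum κ (move χ (q 0) β) ∧
      (fibre κ (move χ (q l) β)).sup len = (fibre κ (move χ (q 0) β)).sup len + l ∧
      (fibre κ (move χ (q l) β)).Nonempty := by
  induction l with
  | zero => exact ⟨by rw [chainOp, one_mul], by rw [add_zero], hne⟩
  | succ l ih =>
    obtain ⟨h1, h2, h3⟩ := ih (by omega)
    have h4 := move_comp_simpleRefl hχ (hσ l (by omega)) (q l) β
    rw [← hq l (by omega)] at h4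
    rw [← h4]
    refine ⟨?_, ?_, ?_⟩
    · rw [← Tgen_mul_fibreSum hκ (hlt l (by omega)), h1, chainOp, mul_assoc]
    · rw [sup_len_fibre hκ (hlt l (by omega)) h3, h2, add_assoc]
    · rw [fibre_comp_simpleRefl]
      exact h3.map

theorem mul_chainOp {σ : ℕ → Fin d} {N : ℕ} {h : Hecke d}
    (hh : ∀ l < N, h * Tgen d (σ l) = v ^ 2 • h) {l : ℕ} (hl : l ≤ N) :
    h * chainOp σ l = (v ^ 2) ^ l • h := by
  induction l with
  | zero => rw [chainOp, mul_one, pow_zero, one_smul]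
  | succ l ih =>
    rw [chainOp, ← mul_assoc, hh l (by omega), smul_mul_assoc, ih (by omega), smul_smul,
      pow_succ' (v ^ 2)]

theorem chainOp_mul {σ : ℕ → Fin d} {N : ℕ} {h : Hecke d}
    (hh : ∀ l < N, Tgen d (σ l) * h = v ^ 2 • h) {l : ℕ} (hl : l ≤ N) :
    chainOp σ l * h = (v ^ 2) ^ l • h := by
  induction l with
  | zero => rw [chainOp, one_mul, pow_zero, one_smul]
  | succ l ih =>
    rw [chainOp, mul_assoc, ih (by omega), mul_smul_comm, hh l (by omega), smul_smul,
      pow_succ (v ^ 2)]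

/-- The sum of the products along a chain. -/
def chainSum (σ : ℕ → Fin d) (N : ℕ) : Hecke d := ∑ l ∈ Finset.range (N + 1), chainOp σ l

/-- The element `h` absorbs each letter as `v²`, so a product of `l` letters contributes `v^{2l}`.
-/
theorem mul_chainSum {σ : ℕ → Fin d} {N : ℕ} {h : Hecke d}
    (hh : ∀ l < N, h * Tgen d (σ l) = v ^ 2 • h) : h * chainSum σ N = qNat (N + 1) • h := by
  rw [chainSum, Finset.mul_sum, qNat, Finset.sum_smul]
  exact Finset.sum_congr rfl fun l hl => mul_chainOp hh (by rw [Finset.mem_range] at hl; omega)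

theorem chainSum_mul {σ : ℕ → Fin d} {N : ℕ} {h : Hecke d}
    (hh : ∀ l < N, Tgen d (σ l) * h = v ^ 2 • h) : chainSum σ N * h = qNat (N + 1) • h := by
  rw [chainSum, Finset.sum_mul, qNat, Finset.sum_smul]
  exact Finset.sum_congr rfl fun l hl => chainOp_mul hh (by rw [Finset.mem_range] at hl; omega)

end

section

variable {n d : ℕ}

/-! ### Multiplication of two adjacent parabolic double cosets -/

/-- The block maps `κ` and `κ'` of two compositions, where the middle block of `κ` consists of the
`2 k + 1` positions around `d`, the preceding block `i₀` has size `a`, and `κ'` is obtained by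
moving the first position of the middle block to `i₀`. -/
structure MoveDatum (κ' κ : Fin (2 * d + 1) → Fin n) (i₀ mid : Fin n) (k a : ℕ) : Prop where
  mono : Monotone κ
  mono' : Monotone κ'
  rev : ∀ x, κ x.rev = (κ x).rev
  lt : i₀ < mid
  mid_rev : mid.rev = mid
  k_pos : 0 < k
  a_pos : 0 < a
  le_d : a + k ≤ d
  mid_iff : ∀ x, κ x = mid ↔ d ≤ (x : ℕ) + k ∧ (x : ℕ) ≤ d + k
  i₀_iff : ∀ x, κ x = i₀ ↔ d ≤ (x : ℕ) + k + a ∧ (x : ℕ) + k < d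
  eq_move : ∀ x : Fin (2 * d + 1), (x : ℕ) + k = d → κ' = move κ x i₀

/-- The position `m`. -/
def pt (d m : ℕ) : Fin (2 * d + 1) := ⟨min m (2 * d), by omega⟩

theorem pt_val (d m : ℕ) : (pt d m : ℕ) = min m (2 * d) := rfl

/-- The `j`-th position of the block `i₀`, counted from its right end. -/
def leftPt (d k j : ℕ) : Fin (2 * d + 1) := pt d (d - k - j)

/-- The `l`-th position of the middle block, without its centre. -/
def midPt (d k l : ℕ) : Fin (2 * d + 1) := pt d (if l < k then d - k + l else d - k + l + 1)

/-- The simple reflections which move a position to the left. -/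
def leftRefl (hd : 0 < d) (k j : ℕ) : Fin d := ⟨d - k - 1 - j, by omega⟩

/-- The simple reflections which move a position through the middle block. -/
def midRefl (hd : 0 < d) (k l : ℕ) : Fin d :=
  ⟨min (if l < k then d - k + l else d + k - l - 2) (d - 1), by omega⟩

theorem simpleRefl_highPos {i : Fin d} (hi : (i : ℕ) + 1 < d) :
    (simpleRefl d i).1 (highPos i) = lowPos i := by
  rw [Fin.ext_iff, simpleRefl_val, if_pos hi, if_neg (by simp [highPos]),
    if_pos (show (highPos i : ℕ) = i + 1 from rfl)]
  rfl

namespace MoveDatum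

variable {κ' κ : Fin (2 * d + 1) → Fin n} {i₀ mid : Fin n} {k a : ℕ}

theorem d_pos (h : MoveDatum κ' κ i₀ mid k a) : 0 < d := by
  have := h.k_pos
  have := h.le_d
  omega

theorem i₀_rev_ne (h : MoveDatum κ' κ i₀ mid k a) : i₀.rev ≠ i₀ := by
  have h1 := h.lt
  have h2 := h.mid_rev
  simp only [ne_eq, Fin.ext_iff, Fin.lt_def, Fin.val_rev] at *
  omega

theorem mid_lt_rev (h : MoveDatum κ' κ i₀ mid k a) : mid < i₀.rev := by
  rw [← h.mid_rev, Fin.rev_lt_rev]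
  exact h.lt

theorem eq_move_leftPt (h : MoveDatum κ' κ i₀ mid k a) : κ' = move κ (leftPt d k 0) i₀ := by
  refine h.eq_move _ ?_
  have := h.le_d
  rw [leftPt, pt_val]
  omega

theorem leftPt_zero_ne_rev (h : MoveDatum κ' κ i₀ mid k a) : leftPt d k 0 ≠ (leftPt d k 0).rev := by
  have := h.le_d
  have := h.k_pos
  rw [Ne, Fin.ext_iff, Fin.val_rev, leftPt, pt_val]
  omega

theorem rev' (h : MoveDatum κ' κ i₀ mid k a) (x : Fin (2 * d + 1)) : κ' x.rev = (κ' x).rev := by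
  rw [h.eq_move_leftPt]
  exact move_rev h.rev h.leftPt_zero_ne_rev x

theorem i₀_iff' (h : MoveDatum κ' κ i₀ mid k a) (x : Fin (2 * d + 1)) :
    κ' x = i₀ ↔ d ≤ (x : ℕ) + k + a ∧ (x : ℕ) + k ≤ d := by
  have := h.le_d
  have := h.k_pos
  rw [h.eq_move_leftPt]
  by_cases h1 : x = leftPt d k 0
  · rw [h1, move_self, leftPt, pt_val]
    simp only [true_iff]
    omega
  by_cases h2 : x = (leftPt d k 0).rev
  · rw [h2, move_rev_self h.leftPt_zero_ne_rev, leftPt, Fin.val_rev, pt_val]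
    simp only [h.i₀_rev_ne, false_iff]
    omega
  rw [move_of_ne h1 h2, h.i₀_iff]
  rw [Fin.ext_iff, leftPt, pt_val] at h1
  omega

theorem move_leftPt_zero (h : MoveDatum κ' κ i₀ mid k a) : move κ' (leftPt d k 0) mid = κ := by
  have := h.le_d
  have := h.k_pos
  ext1 x
  by_cases h1 : x = leftPt d k 0
  · rw [h1, move_self, eq_comm, h.mid_iff, leftPt, pt_val]
    omega
  by_cases h2 : x = (leftPt d k 0).rev
  · rw [h2, move_rev_self h.leftPt_zero_ne_rev, h.mid_rev, eq_comm, h.mid_iff, leftPt, Fin.val_rev,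
      pt_val]
    omega
  rw [move_of_ne h1 h2, h.eq_move_leftPt, move_of_ne h1 h2]

theorem leftRefl_label (h : MoveDatum κ' κ i₀ mid k a) : ∀ j < a,
    κ' (lowPos (leftRefl h.d_pos k j)) = i₀ ∧ κ' (highPos (leftRefl h.d_pos k j)) = i₀ := by
  intro j hj
  have := h.le_d
  have := h.k_pos
  rw [h.i₀_iff', h.i₀_iff']
  simp only [lowPos, highPos, leftRefl]
  omega

/-- The chain of moves within the block `i₀` of `κ'`. -/
theorem fibreSum_left (h : MoveDatum κ' κ i₀ mid k a) {j : ℕ} (hj : j ≤ a) :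
    fibreSum κ (move κ' (leftPt d k j) mid) =
        chainOp (leftRefl h.d_pos k) j * fibreSum κ κ ∧
      (fibre κ (move κ' (leftPt d k j) mid)).sup len = (fibre κ κ).sup len + j ∧
      (fibre κ (move κ' (leftPt d k j) mid)).Nonempty := by
  have hle := h.le_d
  have hk := h.k_pos
  have h1 := fibreSum_chain (χ := κ') (β := mid) (σ := leftRefl h.d_pos k) (q := leftPt d k)
    (N := a) h.mono h.rev' ?_ ?_ ?_ ?_ hj
  · rwa [h.move_leftPt_zero] at h1
  · intro l hl
    rw [(h.leftRefl_label l hl).1, (h.leftRefl_label l hl).2]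
  · intro l hl
    have e1 : leftPt d k l = highPos (leftRefl h.d_pos k l) := by
      rw [Fin.ext_iff]
      simp only [leftPt, leftRefl, pt_val, highPos]
      omega
    have e2 : leftPt d k (l + 1) = lowPos (leftRefl h.d_pos k l) := by
      rw [Fin.ext_iff]
      simp only [leftPt, leftRefl, pt_val, lowPos]
      omega
    rw [e1, e2, simpleRefl_highPos]
    simp only [leftRefl]
    omega
  · intro l hl
    have e1 : highPos (leftRefl h.d_pos k l) = leftPt d k l := by
      rw [Fin.ext_iff]
      simp only [leftPt, leftRefl, pt_val, highPos]
      omega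
    rw [e1, move_self, move_of_ne, (h.leftRefl_label l hl).1]
    · exact h.lt
    · rw [Ne, Fin.ext_iff]
      simp only [leftPt, leftRefl, pt_val, lowPos]
      omega
    · rw [Ne, Fin.ext_iff]
      simp only [leftPt, leftRefl, pt_val, lowPos, Fin.val_rev]
      omega
  · rw [h.move_leftPt_zero]
    exact ⟨1, one_mem_fibre⟩

/-- The chain of moves within the middle block of `κ`. -/
theorem fibreSum_mid (h : MoveDatum κ' κ i₀ mid k a) {ψ κ₁ : Fin (2 * d + 1) → Fin n}
    (hκ₁ : Monotone κ₁) (hψ : ∀ x, ψ x.rev = (ψ x).rev)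
    (hmid : ∀ x : Fin (2 * d + 1), d ≤ (x : ℕ) + k → (x : ℕ) ≤ d + k → ψ x = mid)
    (hne : (fibre κ₁ (move ψ (leftPt d k 0) i₀)).Nonempty) {l : ℕ} (hl : l < 2 * k) :
    fibreSum κ₁ (move ψ (midPt d k l) i₀) =
        chainOp (midRefl h.d_pos k) l * fibreSum κ₁ (move ψ (leftPt d k 0) i₀) ∧
      (fibre κ₁ (move ψ (midPt d k l) i₀)).sup len =
        (fibre κ₁ (move ψ (leftPt d k 0) i₀)).sup len + l := by
  have hle := h.le_d
  have hk := h.k_pos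
  have h0 : midPt d k 0 = leftPt d k 0 := by
    rw [midPt, leftPt, if_pos hk]
    rfl
  have hlow : ∀ l < 2 * k - 1, ψ (lowPos (midRefl h.d_pos k l)) = mid := by
    intro l hl
    apply hmid <;> simp only [lowPos, midRefl] <;> split_ifs <;> omega
  have hhigh : ∀ l < 2 * k - 1, ψ (highPos (midRefl h.d_pos k l)) = mid := by
    intro l hl
    apply hmid <;> simp only [highPos, midRefl] <;> split_ifs <;> omega
  have h1 := fibreSum_chain (χ := ψ) (β := i₀) (σ := midRefl h.d_pos k) (q := midPt d k)
    (N := 2 * k - 1) (κ := κ₁) hκ₁ hψ ?_ ?_ ?_ ?_ (l := l) (by omega)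
  · rw [h0] at h1
    exact ⟨h1.1, h1.2.1⟩
  · intro l hl
    rw [hlow l hl, hhigh l hl]
  · intro l hl
    rw [Fin.ext_iff, simpleRefl_val]
    -- Left of the centre the position itself is pushed to the right; for `l = k - 1` the last
    -- simple reflection takes it from `d - 1` directly to `d + 1`. Beyond the centre the mirror
    -- half of a simple reflection pushes it on.
    by_cases h2 : l < k
    · by_cases h3 : l + 1 < k
      · simp only [midPt, midRefl, pt_val, if_pos h2, if_pos h3]
        split_ifs <;> omega
      · simp only [midPt, midRefl, pt_val, if_pos h2, if_neg h3]
        split_ifs <;> omega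
    · have h3 : ¬ l + 1 < k := by omega
      simp only [midPt, midRefl, pt_val, if_neg h2, if_neg h3]
      split_ifs <;> omega
  · intro l hl
    by_cases h2 : l < k
    · have e1 : lowPos (midRefl h.d_pos k l) = midPt d k l := by
        rw [Fin.ext_iff]
        simp only [midPt, midRefl, pt_val, lowPos, if_pos h2]
        omega
      rw [e1, move_self, move_of_ne, hhigh l hl]
      · exact h.lt
      · rw [Ne, Fin.ext_iff]
        simp only [midPt, midRefl, pt_val, highPos, if_pos h2]
        omega
      · rw [Ne, Fin.ext_iff]
        simp only [midPt, midRefl, pt_val, highPos, Fin.val_rev, if_pos h2]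
        omega
    · have e1 : highPos (midRefl h.d_pos k l) = (midPt d k l).rev := by
        rw [Fin.ext_iff]
        simp only [midPt, midRefl, pt_val, highPos, if_neg h2, Fin.val_rev]
        omega
      rw [e1, move_rev_self, move_of_ne, hlow l hl]
      · exact h.mid_lt_rev
      · rw [Ne, Fin.ext_iff]
        simp only [midPt, midRefl, pt_val, lowPos, if_neg h2]
        omega
      · rw [Ne, Fin.ext_iff]
        simp only [midPt, midRefl, pt_val, lowPos, Fin.val_rev, if_neg h2]
        omega
      · rw [Ne, Fin.ext_iff]
        simp only [midPt, pt_val, Fin.val_rev, if_neg h2]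
        omega
  · rwa [h0]

/-- The elements of the double coset `W_lam W_μ`. -/
theorem exists_leftPt_iff (h : MoveDatum κ' κ i₀ mid k a) (P : Fin (2 * d + 1) → Prop) :
    (∃ x, κ' x = i₀ ∧ x ≠ x.rev ∧ P x) ↔ ∃ j ∈ Finset.range (a + 1), P (leftPt d k j) := by
  have hle := h.le_d
  have hk := h.k_pos
  constructor
  · rintro ⟨x, h1, -, h3⟩
    rw [h.i₀_iff'] at h1
    refine ⟨d - k - x, by rw [Finset.mem_range]; omega, ?_⟩
    have : leftPt d k (d - k - x) = x := by
      rw [Fin.ext_iff, leftPt, pt_val]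
      omega
    rwa [this]
  · rintro ⟨j, h1, h2⟩
    rw [Finset.mem_range] at h1
    refine ⟨leftPt d k j, ?_, ?_, h2⟩
    · rw [h.i₀_iff', leftPt, pt_val]
      omega
    · rw [Ne, Fin.ext_iff, Fin.val_rev, leftPt, pt_val]
      omega

theorem exists_leftPt_succ_iff (h : MoveDatum κ' κ i₀ mid k a) (P : Fin (2 * d + 1) → Prop) :
    (∃ x, κ x = i₀ ∧ P x) ↔ ∃ j ∈ Finset.range a, P (leftPt d k (j + 1)) := by
  have hle := h.le_d
  have hk := h.k_pos
  constructor
  · rintro ⟨x, h1, h3⟩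
    rw [h.i₀_iff] at h1
    refine ⟨d - k - x - 1, by rw [Finset.mem_range]; omega, ?_⟩
    have : leftPt d k (d - k - x - 1 + 1) = x := by
      rw [Fin.ext_iff, leftPt, pt_val]
      omega
    rwa [this]
  · rintro ⟨j, h1, h2⟩
    rw [Finset.mem_range] at h1
    refine ⟨leftPt d k (j + 1), ?_, h2⟩
    rw [h.i₀_iff, leftPt, pt_val]
    omega

theorem exists_midPt_iff (h : MoveDatum κ' κ i₀ mid k a) (P : Fin (2 * d + 1) → Prop) :
    (∃ x, κ x = mid ∧ x ≠ x.rev ∧ P x) ↔ ∃ l ∈ Finset.range (2 * k), P (midPt d k l) := by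
  have hle := h.le_d
  have hk := h.k_pos
  constructor
  · rintro ⟨x, h1, h2, h3⟩
    rw [h.mid_iff] at h1
    rw [Ne, Fin.ext_iff, Fin.val_rev] at h2
    by_cases h4 : (x : ℕ) < d
    · refine ⟨x - (d - k), by rw [Finset.mem_range]; omega, ?_⟩
      have : midPt d k (x - (d - k)) = x := by
        rw [Fin.ext_iff, midPt, pt_val]
        split_ifs <;> omega
      rwa [this]
    · refine ⟨x - (d - k) - 1, by rw [Finset.mem_range]; omega, ?_⟩
      have : midPt d k (x - (d - k) - 1) = x := by
        rw [Fin.ext_iff, midPt, pt_val]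
        split_ifs <;> omega
      rwa [this]
  · rintro ⟨j, h1, h2⟩
    rw [Finset.mem_range] at h1
    refine ⟨midPt d k j, ?_, ?_, h2⟩
    · rw [h.mid_iff, midPt, pt_val]
      split_ifs <;> omega
    · rw [Ne, Fin.ext_iff, Fin.val_rev, midPt, pt_val]
      split_ifs <;> omega

end MoveDatum

end

/-! ### Standard basis elements as chain sums times idempotents -/

section

variable {n d : ℕ}

/-- The Hecke algebra element of `[M]_d` in terms of the idempotent of its column composition. -/
theorem std_entry {lam μ : Wt n d} {κ : Fin (2 * d + 1) → Fin n} (hκ : IsBlockMap d μ.1 κ)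
    {M : Matrix (Fin n) (Fin n) ℤ} {h : Hecke d} {m : ℕ}
    (h1 : ∑ w ∈ coset (d := d) lam.1 μ.1 M, T w = h * fibreSum κ κ)
    (h2 : (coset (d := d) lam.1 μ.1 M).sup len = (fibre κ κ).sup len + m) :
    std n d M lam μ = v ^ (-(m : ℤ)) • (h * idem κ) := by
  rw [std, h1, h2, parab_eq_fibre hκ, idem, mul_smul_comm, smul_smul]
  congr 1
  rw [div_eq_mul_inv]
  congr 2
  push_cast
  ring

theorem wt_rev (μ : Wt n d) (i : Fin n) : μ.1 i.rev = μ.1 i := (Finset.mem_filter.1 μ.2).2 i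

theorem wt_sum (μ : Wt n d) : ∑ i, μ.1 i = 2 * d + 1 :=
  (Finset.mem_piAntidiag.1 (Finset.mem_filter.1 μ.2).1).1

theorem sup_biUnion_range {N L : ℕ} {S : ℕ → Finset (WB d)}
    (h : ∀ j ∈ Finset.range (N + 1), (S j).sup len = L + j) :
    ((Finset.range (N + 1)).biUnion S).sup len = L + N := by
  rw [Finset.sup_biUnion, Finset.sup_congr rfl h]
  apply le_antisymm
  · refine Finset.sup_le fun j hj => ?_
    rw [Finset.mem_range] at hj
    omega
  · exact Finset.le_sup (f := fun j => L + j) (Finset.self_mem_range_succ N)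

theorem mem_fibre_iff {κ φ : Fin (2 * d + 1) → Fin n} {w : WB d} :
    w ∈ fibre κ φ ↔ (fun x => κ (w.1⁻¹ x)) = φ := by
  rw [mem_fibre, funext_iff]

/-- A diagonal matrix labels the parabolic subgroup itself, whose normalized sum is the idempotent.
-/
theorem std_diag {κ : Fin (2 * d + 1) → Fin n} {μ : Wt n d} {M : Matrix (Fin n) (Fin n) ℤ}
    (hm : IsBlockMap d μ.1 κ)
    (hrow : ∀ i, ∑ j, M i j = μ.1 i) (hoff : ∀ i j, i ≠ j → M i j = 0) :
    std n d M μ μ = idem κ := by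
  have hcos : coset μ.1 μ.1 M = fibre κ κ := by
    ext w
    rw [mem_coset_iff_offDiag hm hm hrow, mem_fibre_iff, ← eq_char]
    refine forall₃_congr fun i j hij => ?_
    rw [hoff i j hij, ← Nat.cast_inj (R := ℤ)]
    rfl
  have h1 := std_entry (M := M) (lam := μ) hm (h := 1) (m := 0) (by rw [hcos, one_mul]; rfl)
    (by rw [hcos, add_zero])
  rwa [one_mul, Nat.cast_zero, neg_zero, zpow_zero, one_smul] at h1

namespace MoveDatum

variable {κ' κ : Fin (2 * d + 1) → Fin n} {i₀ mid : Fin n} {k a : ℕ} {lam μ : Wt n d}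
  {M : Matrix (Fin n) (Fin n) ℤ}

theorem phi_rev (h : MoveDatum κ' κ i₀ mid k a) (w : WB d) (x : Fin (2 * d + 1)) :
    κ (w.1⁻¹ x.rev) = (κ (w.1⁻¹ x)).rev := by
  rw [wb_inv_rev, h.rev]

theorem phi_rev' (h : MoveDatum κ' κ i₀ mid k a) (w : WB d) (x : Fin (2 * d + 1)) :
    κ' (w.1⁻¹ x.rev) = (κ' (w.1⁻¹ x)).rev := by
  rw [wb_inv_rev, h.rev']

theorem leftPt_ne (h : MoveDatum κ' κ i₀ mid k a) {j j' : ℕ} (hj : j ≤ a) (hj' : j' ≤ a)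
    (hne : j ≠ j') : leftPt d k j ≠ leftPt d k j' ∧ leftPt d k j ≠ (leftPt d k j').rev := by
  have := h.le_d
  have := h.k_pos
  rw [Ne, Ne, Fin.ext_iff, Fin.ext_iff, Fin.val_rev, leftPt, leftPt, pt_val, pt_val]
  omega

theorem leftPt_ne_midPt (h : MoveDatum κ' κ i₀ mid k a) {j l : ℕ} (hj : j < a)
    (hl : l < 2 * k) :
    leftPt d k (j + 1) ≠ midPt d k l ∧ leftPt d k (j + 1) ≠ (midPt d k l).rev := by
  have := h.le_d
  have := h.k_pos
  rw [Ne, Ne, Fin.ext_iff, Fin.ext_iff, Fin.val_rev, leftPt, midPt, pt_val, pt_val]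
  split_ifs <;> omega

theorem midPt_ne (h : MoveDatum κ' κ i₀ mid k a) {j j' : ℕ} (hj : j < 2 * k) (hj' : j' < 2 * k)
    (hne : j ≠ j') : midPt d k j ≠ midPt d k j' := by
  have := h.le_d
  have := h.k_pos
  rw [Ne, Fin.ext_iff, midPt, midPt, pt_val, pt_val]
  split_ifs <;> omega

/-! #### The matrix of `W_lam W_μ` -/

/-- `W_λ W_μ` is the union of the left cosets of `W_μ` in which the displaced position runs through
the `a + 1` places of the block `i₀` of `κ'`. They are linked by a chain of reflections in `W_λ`. -/
theorem std_left (h : MoveDatum κ' κ i₀ mid k a) (hl : IsBlockMap d lam.1 κ')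
    (hm : IsBlockMap d μ.1 κ) (hrow : ∀ i, ∑ j, M i j = lam.1 i)
    (hoff : ∀ i j, i ≠ j → M i j =
      if (i = i₀ ∧ j = mid) ∨ (i = i₀.rev ∧ j = mid.rev) then 1 else 0) :
    std n d M lam μ = v ^ (-(a : ℤ)) • (chainSum (leftRefl h.d_pos k) a * idem κ) := by
  have hcos : coset lam.1 μ.1 M = (Finset.range (a + 1)).biUnion
      fun j => fibre κ (move κ' (leftPt d k j) mid) := by
    ext w
    rw [mem_coset_iff_offDiag hl hm hrow, Finset.mem_biUnion]
    simp only [mem_fibre_iff]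
    rw [← h.exists_leftPt_iff fun x => (fun y => κ (w.1⁻¹ y)) = move κ' x mid,
      ← move_char h.rev' (h.phi_rev w) h.lt.ne fun hc => h.i₀_rev_ne hc.1]
    refine forall₃_congr fun i j hij => ?_
    rw [hoff i j hij, ← Nat.cast_inj (R := ℤ)]
    push_cast
    rfl
  refine std_entry hm ?_ ?_
  · rw [hcos, Finset.sum_biUnion, chainSum, Finset.sum_mul]
    · refine Finset.sum_congr rfl fun j hj => ?_
      rw [Finset.mem_range] at hj
      exact (h.fibreSum_left (by omega)).1
    · intro j hj j' hj' hne
      simp only [Finset.coe_range, Set.mem_Iio] at hj hj'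
      refine fibre_disjoint fun heq => h.lt.ne ?_
      have h1 := congrFun heq (leftPt d k j)
      obtain ⟨h2, h3⟩ := h.leftPt_ne (by omega) (by omega) hne
      rw [move_self, move_of_ne h2 h3] at h1
      rw [h1, eq_comm, h.i₀_iff', leftPt, pt_val]
      have := h.le_d
      omega
  · rw [hcos]
    refine sup_biUnion_range fun j hj => ?_
    rw [Finset.mem_range] at hj
    exact (h.fibreSum_left (by omega)).2.1

/-! #### The matrix of `W_μ W_lam` -/

/-- Here the displaced position runs through the `2 k` non-central places of the middle block of
`κ`, and the chain lies in `W_μ`; the longest element of the chain has length `2 k - 1`. -/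
theorem std_mid (h : MoveDatum κ' κ i₀ mid k a) (hl : IsBlockMap d lam.1 κ')
    (hm : IsBlockMap d μ.1 κ) (hrow : ∀ i, ∑ j, M i j = μ.1 i)
    (hoff : ∀ i j, i ≠ j → M i j =
      if (i = mid ∧ j = i₀) ∨ (i = mid.rev ∧ j = i₀.rev) then 1 else 0) :
    std n d M μ lam =
      v ^ (-((2 * k - 1 : ℕ) : ℤ)) • (chainSum (midRefl h.d_pos k) (2 * k - 1) * idem κ') := by
  have hk : 2 * k - 1 + 1 = 2 * k := by
    have := h.k_pos
    omega
  have hmid : ∀ x : Fin (2 * d + 1), d ≤ (x : ℕ) + k → (x : ℕ) ≤ d + k → κ x = mid :=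
    fun x h1 h2 => (h.mid_iff x).2 ⟨h1, h2⟩
  have hne : (fibre κ' (move κ (leftPt d k 0) i₀)).Nonempty := by
    rw [← h.eq_move_leftPt]
    exact ⟨1, one_mem_fibre⟩
  have hcos : coset μ.1 lam.1 M = (Finset.range (2 * k - 1 + 1)).biUnion
      fun l => fibre κ' (move κ (midPt d k l) i₀) := by
    ext w
    rw [mem_coset_iff_offDiag hm hl hrow, Finset.mem_biUnion, hk]
    simp only [mem_fibre_iff]
    rw [← h.exists_midPt_iff fun x => (fun y => κ' (w.1⁻¹ y)) = move κ x i₀,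
      ← move_char h.rev (h.phi_rev' w) h.lt.ne' fun hc => h.i₀_rev_ne hc.2]
    refine forall₃_congr fun i j hij => ?_
    rw [hoff i j hij, ← Nat.cast_inj (R := ℤ)]
    push_cast
    rfl
  have hstep := fun l (hl : l < 2 * k) => h.fibreSum_mid h.mono' h.rev hmid hne hl
  rw [← h.eq_move_leftPt] at hstep
  refine std_entry hl ?_ ?_
  · rw [hcos, Finset.sum_biUnion, chainSum, Finset.sum_mul]
    · refine Finset.sum_congr rfl fun j hj => ?_
      rw [Finset.mem_range] at hj
      exact (hstep j (by omega)).1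
    · intro j hj j' hj' hne
      simp only [Finset.coe_range, Set.mem_Iio] at hj hj'
      refine fibre_disjoint fun heq => ?_
      have h1 := congrFun heq (midPt d k j)
      have h2 := h.midPt_ne (by omega) (by omega) hne
      have h4 : κ (midPt d k j) = mid := by
        rw [h.mid_iff, midPt, pt_val]
        have := h.le_d
        split_ifs <;> omega
      rw [move_self] at h1
      by_cases h3 : midPt d k j = (midPt d k j').rev
      · rw [h3, move_rev_self] at h1
        · exact h.i₀_rev_ne h1.symm
        · rw [← h3]
          exact h2.symm
      · rw [move_of_ne h2 h3, h4] at h1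
        exact h.lt.ne h1
  · rw [hcos]
    refine sup_biUnion_range fun j hj => ?_
    rw [Finset.mem_range] at hj
    exact (hstep j (by omega)).2

/-! #### The two double cosets in the product -/

/-- This glues the two chains: the end of a nontrivial move inside `i₀` is at the same time the
start of a chain through the middle block. -/
theorem move_move_zero (h : MoveDatum κ' κ i₀ mid k a) {j : ℕ} (hj : j < a) :
    move (move κ (leftPt d k (j + 1)) mid) (leftPt d k 0) i₀ = move κ' (leftPt d k (j + 1)) mid := by
  obtain ⟨h1, h2⟩ := h.leftPt_ne (j := j + 1) (j' := 0) (by omega) (by omega) (by omega)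
  have h0 := h.leftPt_zero_ne_rev
  ext1 x
  by_cases h3 : x = leftPt d k 0
  · rw [h3, move_self, move_of_ne h1.symm, h.eq_move_leftPt, move_self]
    intro h4
    exact h2 (by rw [h4, Fin.rev_rev])
  by_cases h4 : x = (leftPt d k 0).rev
  · rw [h4, move_rev_self h0, move_of_ne h2.symm, h.rev', h.eq_move_leftPt, move_self]
    rw [Ne, Fin.rev_inj]
    exact h1.symm
  rw [move_of_ne h3 h4]
  simp only [move]
  rw [h.eq_move_leftPt, move_of_ne h3 h4]

/-- The left cosets are indexed by the place of the position moved into `i₀` (`2 k` choices) and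
that of the position moved out of it (`a` choices). Each is reached by a nonempty left chain
followed by a middle chain, and both lengths add. -/
theorem std_mixed (h : MoveDatum κ' κ i₀ mid k a) (hm : IsBlockMap d μ.1 κ)
    (hrow : ∀ i, ∑ j, M i j = μ.1 i)
    (hoff : ∀ i j, i ≠ j → M i j =
      if ((i = i₀ ∨ i = i₀.rev) ∧ j = mid) ∨ (i = mid ∧ (j = i₀ ∨ j = i₀.rev)) then 1 else 0) :
    std n d M μ μ = v ^ (-((a + (2 * k - 1) : ℕ) : ℤ)) •
      ((∑ l ∈ Finset.range (2 * k), ∑ j ∈ Finset.range a,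
        chainOp (midRefl h.d_pos k) l * chainOp (leftRefl h.d_pos k) (j + 1)) * idem κ) := by
  have hk := h.k_pos
  have ha := h.a_pos
  have hd := h.le_d
  set φ : ℕ → ℕ → Fin (2 * d + 1) → Fin n := fun l j =>
    move (move κ (leftPt d k (j + 1)) mid) (midPt d k l) i₀ with hφ
  have hcos : coset μ.1 μ.1 M = (Finset.range (2 * k - 1 + 1)).biUnion fun l =>
      (Finset.range (a - 1 + 1)).biUnion fun j => fibre κ (φ l j) := by
    ext w
    rw [mem_coset_iff_offDiag hm hm hrow]
    simp only [Finset.mem_biUnion, mem_fibre_iff]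
    have hk' : 2 * k - 1 + 1 = 2 * k := by omega
    have ha' : a - 1 + 1 = a := by omega
    rw [hk', ha', ← h.exists_midPt_iff fun y => ∃ j ∈ Finset.range a,
      (fun x => κ (w.1⁻¹ x)) = move (move κ (leftPt d k (j + 1)) mid) y i₀]
    have hcomm : (∃ y, κ y = mid ∧ y ≠ y.rev ∧ ∃ j ∈ Finset.range a,
        (fun x => κ (w.1⁻¹ x)) = move (move κ (leftPt d k (j + 1)) mid) y i₀) ↔
        ∃ x y, κ x = i₀ ∧ κ y = mid ∧ y ≠ y.rev ∧
          (fun x => κ (w.1⁻¹ x)) = move (move κ x mid) y i₀ := by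
      have hP := fun y => h.exists_leftPt_succ_iff
        fun x => (fun x => κ (w.1⁻¹ x)) = move (move κ x mid) y i₀
      constructor
      · rintro ⟨y, h1, h2, h5⟩
        obtain ⟨x, h3, h4⟩ := (hP y).2 h5
        exact ⟨x, y, h3, h1, h2, h4⟩
      · rintro ⟨x, y, h3, h1, h2, h4⟩
        exact ⟨y, h1, h2, (hP y).1 ⟨x, h3, h4⟩⟩
    rw [hcomm, ← move_move_char h.rev (h.phi_rev w) h.lt.ne h.i₀_rev_ne h.mid_rev]
    refine forall₃_congr fun i j hij => ?_
    rw [hoff i j hij, ← Nat.cast_inj (R := ℤ)]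
    push_cast
    rfl
  have hstep : ∀ l < 2 * k, ∀ j < a,
      fibreSum κ (φ l j) = chainOp (midRefl h.d_pos k) l *
        (chainOp (leftRefl h.d_pos k) (j + 1) * fibreSum κ κ) ∧
      (fibre κ (φ l j)).sup len = (fibre κ κ).sup len + (j + 1) + l := by
    intro l hl j hj
    obtain ⟨h1, h2, h3⟩ := h.fibreSum_left (j := j + 1) (by omega)
    rw [← h.move_move_zero hj] at h1 h2 h3
    have hψ : ∀ x, move κ (leftPt d k (j + 1)) mid x.rev =
        (move κ (leftPt d k (j + 1)) mid x).rev := by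
      refine move_rev h.rev ?_
      rw [Ne, Fin.ext_iff, Fin.val_rev, leftPt, pt_val]
      omega
    have h4 := h.fibreSum_mid h.mono hψ (fun x hx1 hx2 => by
      rw [move_of_ne]
      · exact (h.mid_iff x).2 ⟨hx1, hx2⟩
      · rw [Ne, Fin.ext_iff, leftPt, pt_val]
        omega
      · rw [Ne, Fin.ext_iff, Fin.val_rev, leftPt, pt_val]
        omega) h3 hl
    rw [h1, h2] at h4
    exact h4
  have hval : ∀ l < 2 * k, ∀ j < a, φ l j (leftPt d k (j + 1)) = mid := by
    intro l hl j hj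
    obtain ⟨h1, h2⟩ := h.leftPt_ne_midPt hj hl
    rw [hφ]
    simp only
    rw [move_of_ne h1 h2, move_self]
  have hval' : ∀ l < 2 * k, ∀ j < a, ∀ j' < a, j ≠ j' → φ l j' (leftPt d k (j + 1)) = i₀ := by
    intro l hl j hj j' hj' hne
    obtain ⟨h1, h2⟩ := h.leftPt_ne_midPt hj hl
    obtain ⟨h3, h4⟩ := h.leftPt_ne (j := j + 1) (j' := j' + 1) (by omega) (by omega) (by omega)
    rw [hφ]
    simp only
    rw [move_of_ne h1 h2, move_of_ne h3 h4, h.i₀_iff, leftPt, pt_val]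
    omega
  have hval2 : ∀ l < 2 * k, ∀ j < a, ∀ l' < 2 * k, ∀ j' < a, l ≠ l' → φ l j ≠ φ l' j' := by
    intro l hl j hj l' hl' j' hj' hne heq
    have h1 := congrFun heq (midPt d k l)
    rw [hφ] at h1
    simp only at h1
    have h2 := h.midPt_ne hl hl' hne
    rw [move_self] at h1
    by_cases h3 : midPt d k l = (midPt d k l').rev
    · rw [h3, move_rev_self] at h1
      · exact h.i₀_rev_ne h1.symm
      · rw [← h3]
        exact h2.symm
    · rw [move_of_ne h2 h3, move_of_ne, (h.mid_iff _).2] at h1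
      · exact h.lt.ne h1
      · rw [midPt, pt_val]
        split_ifs <;> omega
      · exact (h.leftPt_ne_midPt hj' hl).1.symm
      · intro h5
        apply (h.leftPt_ne_midPt hj' hl).2
        rw [h5, Fin.rev_rev]
  refine std_entry hm ?_ ?_
  · rw [hcos, Finset.sum_biUnion]
    · rw [show 2 * k - 1 + 1 = 2 * k by omega, show a - 1 + 1 = a by omega, Finset.sum_mul]
      refine Finset.sum_congr rfl fun l hl => ?_
      rw [Finset.mem_range] at hl
      rw [Finset.sum_biUnion, Finset.sum_mul]
      · refine Finset.sum_congr rfl fun j hj => ?_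
        rw [Finset.mem_range] at hj
        rw [mul_assoc]
        exact (hstep l hl j hj).1
      · intro j hj j' hj' hne
        simp only [Finset.coe_range, Set.mem_Iio] at hj hj'
        refine fibre_disjoint fun heq => h.lt.ne ?_
        rw [← hval l hl j hj, heq, hval' l hl j hj j' hj' hne]
    · intro l hl l' hl' hne
      simp only [Finset.coe_range, Set.mem_Iio] at hl hl'
      rw [Function.onFun, Finset.disjoint_biUnion_left]
      intro j hj
      rw [Finset.disjoint_biUnion_right]
      intro j' hj'
      rw [Finset.mem_range] at hj hj'
      exact fibre_disjoint (hval2 l (by omega) j (by omega) l' (by omega) j' (by omega) hne)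
  · rw [hcos]
    have h1 := sup_biUnion_range (d := d) (N := 2 * k - 1) (L := (fibre κ κ).sup len + a)
      (S := fun l => (Finset.range (a - 1 + 1)).biUnion fun j => fibre κ (φ l j)) ?_
    · rw [h1, add_assoc]
    · intro l hl
      rw [Finset.mem_range] at hl
      rw [sup_biUnion_range (L := (fibre κ κ).sup len + 1 + l)]
      · omega
      · intro j hj
        rw [Finset.mem_range] at hj
        rw [(hstep l (by omega) j (by omega)).2]
        omega

end MoveDatum

end

/-! ### Bar-invariance and the product of the two adjacent double cosets -/

section

variable {n d : ℕ}

theorem idem_mul_std {lam μ : Wt n d} {κ' κ : Fin (2 * d + 1) → Fin n}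
    (hl : IsBlockMap d lam.1 κ') (hm : IsBlockMap d μ.1 κ) (M : Matrix (Fin n) (Fin n) ℤ) :
    idem κ' * std n d M lam μ = std n d M lam μ := by
  have hrev := hl.rev (wt_rev lam)
  refine idem_mul_of_invariant hl.mono hrev fun i hi => ?_
  rw [std, mul_smul_comm, Tgen_mul_cosetSum hl hm hrev hi, smul_comm]

namespace MoveDatum

variable {κ' κ : Fin (2 * d + 1) → Fin n} {i₀ mid : Fin n} {k a : ℕ} {lam μ : Wt n d}
  {MA MB MC : Matrix (Fin n) (Fin n) ℤ}

theorem midRefl_label (h : MoveDatum κ' κ i₀ mid k a) : ∀ l < 2 * k - 1,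
    κ (lowPos (midRefl h.d_pos k l)) = mid ∧ κ (highPos (midRefl h.d_pos k l)) = mid := by
  intro l hl
  have := h.le_d
  have := h.k_pos
  rw [h.mid_iff, h.mid_iff]
  simp only [lowPos, highPos, midRefl]
  split_ifs <;> omega

/-- Multiplying by the idempotent on the left does not change the element and turns the chain sum
into a scalar. The element becomes the bar-invariant scalar `v^{-N} qNat (N + 1)` times a product of
two bar-invariant idempotents. -/
theorem bar_std_of_chain {χ : Fin (2 * d + 1) → Fin n} {ψ : Fin (2 * d + 1) → Fin n}
    {lam μ : Wt n d} (hl : IsBlockMap d lam.1 χ) (hm : IsBlockMap d μ.1 ψ)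
    {M : Matrix (Fin n) (Fin n) ℤ} {σ : ℕ → Fin d} {N : ℕ}
    (hσ : ∀ l < N, χ (lowPos (σ l)) = χ (highPos (σ l)))
    (hM : std n d M lam μ = v ^ (-(N : ℤ)) • (chainSum σ N * idem ψ)) :
    barHecke (std n d M lam μ) = std n d M lam μ := by
  have h1 : std n d M lam μ = (v ^ (-(N : ℤ)) * qNat (N + 1)) • (idem χ * idem ψ) := by
    rw [← idem_mul_std hl hm, hM, mul_smul_comm, ← mul_assoc,
      mul_chainSum fun l hl' => idem_mul_Tgen (hl.rev (wt_rev lam)) (hσ l hl'), smul_mul_assoc,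
      smul_smul]
  rw [h1, barHecke_smul, barHecke_mul, barHecke_idem hl.mono (hl.rev (wt_rev lam)),
    barHecke_idem hm.mono (hm.rev (wt_rev μ)), map_mul, barQ_zpow, barQ_qNat_succ, ← mul_assoc,
    ← zpow_add₀ v_ne_zero]
  congr 3
  ring

theorem bar_std_left (h : MoveDatum κ' κ i₀ mid k a) (hl : IsBlockMap d lam.1 κ')
    (hm : IsBlockMap d μ.1 κ) (hrow : ∀ i, ∑ j, MA i j = lam.1 i)
    (hoff : ∀ i j, i ≠ j → MA i j =
      if (i = i₀ ∧ j = mid) ∨ (i = i₀.rev ∧ j = mid.rev) then 1 else 0) :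
    barHecke (std n d MA lam μ) = std n d MA lam μ := by
  refine bar_std_of_chain hl hm (fun l hl' => ?_) (h.std_left hl hm hrow hoff)
  rw [(h.leftRefl_label l hl').1, (h.leftRefl_label l hl').2]

theorem bar_std_mid (h : MoveDatum κ' κ i₀ mid k a) (hl : IsBlockMap d lam.1 κ')
    (hm : IsBlockMap d μ.1 κ) (hrow : ∀ i, ∑ j, MB i j = μ.1 i)
    (hoff : ∀ i j, i ≠ j → MB i j =
      if (i = mid ∧ j = i₀) ∨ (i = mid.rev ∧ j = i₀.rev) then 1 else 0) :
    barHecke (std n d MB μ lam) = std n d MB μ lam := by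
  refine bar_std_of_chain hm hl (fun l hl' => ?_) (h.std_mid hl hm hrow hoff)
  rw [(h.midRefl_label l hl').1, (h.midRefl_label l hl').2]

/-- The product of the elements of `W_μ W_lam` and `W_lam W_μ`. -/
theorem std_mid_mul_std_left (h : MoveDatum κ' κ i₀ mid k a) (hl : IsBlockMap d lam.1 κ')
    (hm : IsBlockMap d μ.1 κ) (hrowA : ∀ i, ∑ j, MA i j = lam.1 i)
    (hoffA : ∀ i j, i ≠ j → MA i j =
      if (i = i₀ ∧ j = mid) ∨ (i = i₀.rev ∧ j = mid.rev) then 1 else 0)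
    (hrowB : ∀ i, ∑ j, MB i j = μ.1 i)
    (hoffB : ∀ i j, i ≠ j → MB i j =
      if (i = mid ∧ j = i₀) ∨ (i = mid.rev ∧ j = i₀.rev) then 1 else 0)
    (hrowC : ∀ i, ∑ j, MC i j = μ.1 i)
    (hoffC : ∀ i j, i ≠ j → MC i j =
      if ((i = i₀ ∨ i = i₀.rev) ∧ j = mid) ∨ (i = mid ∧ (j = i₀ ∨ j = i₀.rev)) then 1 else 0) :
    std n d MB μ lam * std n d MA lam μ = std n d MC μ μ +
      (v ^ (-((a + (2 * k - 1) : ℕ) : ℤ)) * qNat (2 * k)) • idem κ := by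
  have hk : 2 * k - 1 + 1 = 2 * k := by
    have := h.k_pos
    omega
  have h1 : chainSum (midRefl h.d_pos k) (2 * k - 1) * idem κ = qNat (2 * k) • idem κ := by
    rw [chainSum_mul fun l hl' => Tgen_mul_idem h.rev ?_, hk]
    rw [(h.midRefl_label l hl').1, (h.midRefl_label l hl').2]
  rw [h.std_mid hl hm hrowB hoffB, smul_mul_assoc, mul_assoc, idem_mul_std hl hm,
    h.std_left hl hm hrowA hoffA, h.std_mixed hm hrowC hoffC, mul_smul_comm, smul_smul,
    ← zpow_add₀ v_ne_zero, mul_smul, ← smul_add, ← h1]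
  congr 1
  · congr 1
    push_cast
    ring
  · rw [← mul_assoc, ← add_mul]
    congr 1
    nth_rw 2 [chainSum]
    -- The term `j = 0` of the left chain is `1`. It leaves the middle chain sum alone, which acts
    -- on `idem κ` by a scalar because its reflections lie in `W_μ`; the terms `j + 1` make up the
    -- matrix of `C`.
    rw [Finset.sum_range_succ', mul_add, chainOp, mul_one]
    congr 1
    rw [chainSum, hk, Finset.sum_mul]
    exact Finset.sum_congr rfl fun l _ => Finset.mul_sum _ _ _

end MoveDatum

end

section

variable {n d : ℕ}

/-! ### Entries outside the row and column sums -/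

theorem sum_relPos (lam μ : Wt n d) (w : WB d) :
    (∀ i, ∑ j, relPos lam.1 μ.1 w i j = lam.1 i) ∧
      ∀ j, ∑ i, relPos lam.1 μ.1 w i j = μ.1 j := by
  obtain ⟨κ', h'⟩ := exists_isBlockMap (wt_sum lam)
  obtain ⟨κ, h⟩ := exists_isBlockMap (wt_sum μ)
  constructor
  · intro i
    rw [← h'.card i, Finset.card_eq_sum_card_fiberwise (f := fun x => κ (w.1⁻¹ x))
      (t := Finset.univ) (by simp [Set.MapsTo])]
    push_cast
    refine Finset.sum_congr rfl fun j _ => ?_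
    rw [relPos_eq h' h, Finset.filter_filter]
  · intro j
    have h1 : (Finset.univ.filter fun x => κ x = j).card =
        (Finset.univ.filter fun x => κ (w.1⁻¹ x) = j).card :=
      Finset.card_equiv w.1 fun x => by simp
    rw [← h.card j, h1, Finset.card_eq_sum_card_fiberwise (f := κ')
      (t := Finset.univ) (by simp [Set.MapsTo])]
    push_cast
    refine Finset.sum_congr rfl fun i _ => ?_
    rw [relPos_eq h' h, Finset.filter_filter]
    simp only [and_comm]

theorem sum_of_std_ne_zero {lam μ : Wt n d} {M : Matrix (Fin n) (Fin n) ℤ}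
    (h : std n d M lam μ ≠ 0) :
    (∀ i, ∑ j, M i j = lam.1 i) ∧ ∀ j, ∑ i, M i j = μ.1 j := by
  have hne : (coset (d := d) lam.1 μ.1 M).Nonempty := by
    rw [Finset.nonempty_iff_ne_empty]
    intro h0
    rw [std, h0, Finset.sum_empty, smul_zero] at h
    exact h rfl
  obtain ⟨w, hw⟩ := hne
  rw [mem_coset] at hw
  rw [← hw]
  exact sum_relPos lam μ w

/-! ### The matrices of the example -/

/-- `i₀` precedes the central index `mid`. -/
structure IsMiddle (i₀ mid : Fin n) : Prop where
  mid_rev : mid.rev = mid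
  succ : (i₀ : ℕ) + 1 = mid

/-- The diagonal entries: `b` in the centre, and `a` elsewhere. -/
def diagVec (mid : Fin n) (a b : ℤ) (i : Fin n) : ℤ := if i = mid then b else a

/-- The indicator of the two neighbours of the centre. -/
def sideInd (i₀ i : Fin n) : ℤ := (if i = i₀ then 1 else 0) + if i = i₀.rev then 1 else 0

/-- For `n = 3`, `i₀ = 0` and `mid = 1`, the four matrices defined from here on are those of the
example; for larger `n` the diagonal is continued by `a`. -/
def exA (i₀ mid : Fin n) (a b : ℤ) : Matrix (Fin n) (Fin n) ℤ := fun i j =>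
  (if i = j then diagVec mid a b i else 0) + if j = mid then sideInd i₀ i else 0

def exB (i₀ mid : Fin n) (a b : ℤ) : Matrix (Fin n) (Fin n) ℤ := fun i j =>
  (if i = j then diagVec mid a b i else 0) + if i = mid then sideInd i₀ j else 0

def exC (i₀ mid : Fin n) (a b : ℤ) : Matrix (Fin n) (Fin n) ℤ := fun i j =>
  (if i = j then diagVec mid a b i - sideInd i₀ i else 0) +
    (if j = mid then sideInd i₀ i else 0) + if i = mid then sideInd i₀ j else 0

def exD (mid : Fin n) (a b : ℤ) : Matrix (Fin n) (Fin n) ℤ := fun i j =>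
  if i = j then diagVec mid a (b + 2) i else 0

theorem diagVec_add_two (mid : Fin n) (a b : ℤ) (i : Fin n) :
    diagVec mid a (b + 2) i = diagVec mid a b i + if i = mid then 2 else 0 := by
  rw [diagVec, diagVec]
  split_ifs <;> ring

theorem sum_sideInd (i₀ : Fin n) : ∑ i, sideInd i₀ i = 2 := by
  simp [sideInd, Finset.sum_add_distrib]

theorem sideInd_rev (i₀ i : Fin n) : sideInd i₀ i.rev = sideInd i₀ i := by
  simp only [sideInd, Fin.rev_eq_iff, Fin.rev_rev]
  rw [add_comm]

namespace IsMiddle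

variable {i₀ mid : Fin n} {a b : ℤ}

theorem lt (h : IsMiddle i₀ mid) : i₀ < mid := by
  rw [Fin.lt_def, ← h.succ]
  omega

theorem rev_val (h : IsMiddle i₀ mid) : (i₀.rev : ℕ) = mid + 1 := by
  have h1 := h.mid_rev
  have h2 := h.succ
  rw [Fin.ext_iff, Fin.val_rev] at h1
  rw [Fin.val_rev]
  omega

theorem ne (h : IsMiddle i₀ mid) : i₀ ≠ mid := h.lt.ne

theorem rev_ne (h : IsMiddle i₀ mid) : i₀.rev ≠ mid := by
  have := h.rev_val
  rw [Ne, Fin.ext_iff]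
  omega

theorem ne_rev (h : IsMiddle i₀ mid) : i₀ ≠ i₀.rev := by
  have := h.rev_val
  have := h.succ
  rw [Ne, Fin.ext_iff]
  omega

theorem rev_eq (h : IsMiddle i₀ mid) (i : Fin n) : i.rev = mid ↔ i = mid := by
  rw [Fin.rev_eq_iff, h.mid_rev]

theorem sideInd_mid (h : IsMiddle i₀ mid) : sideInd i₀ mid = 0 := by
  simp [sideInd, h.ne.symm, h.rev_ne.symm]

theorem diagVec_rev (h : IsMiddle i₀ mid) (a b : ℤ) (i : Fin n) :
    diagVec mid a b i.rev = diagVec mid a b i := by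
  simp only [diagVec, h.rev_eq]

theorem sum_exA_row (i : Fin n) :
    ∑ j, exA i₀ mid a b i j = diagVec mid a b i + sideInd i₀ i := by
  simp [exA, Finset.sum_add_distrib]

theorem sum_exA_col (j : Fin n) : ∑ i, exA i₀ mid a b i j = diagVec mid a (b + 2) j := by
  simp only [exA, Finset.sum_add_distrib, diagVec_add_two]
  split_ifs <;> simp [sum_sideInd]

theorem sum_exB_row (i : Fin n) : ∑ j, exB i₀ mid a b i j = diagVec mid a (b + 2) i := by
  simp only [exB, Finset.sum_add_distrib, diagVec_add_two]
  split_ifs <;> simp [sum_sideInd]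

theorem sum_exB_col (j : Fin n) :
    ∑ i, exB i₀ mid a b i j = diagVec mid a b j + sideInd i₀ j := by
  simp [exB, Finset.sum_add_distrib]

theorem sum_exC_row (i : Fin n) : ∑ j, exC i₀ mid a b i j = diagVec mid a (b + 2) i := by
  simp only [exC, Finset.sum_add_distrib, diagVec_add_two]
  split_ifs <;> simp [sum_sideInd]

theorem sum_exC_col (j : Fin n) : ∑ i, exC i₀ mid a b i j = diagVec mid a (b + 2) j := by
  simp only [exC, Finset.sum_add_distrib, diagVec_add_two]
  split_ifs
  · simp [sum_sideInd]
    ring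
  · simp

theorem sum_exD_row (i : Fin n) : ∑ j, exD mid a b i j = diagVec mid a (b + 2) i := by
  simp [exD]

theorem sum_exD_col (j : Fin n) : ∑ i, exD mid a b i j = diagVec mid a (b + 2) j := by
  simp [exD]

theorem sideInd_eq (h : IsMiddle i₀ mid) (i : Fin n) :
    sideInd i₀ i = if i = i₀ ∨ i = i₀.rev then 1 else 0 := by
  have := h.ne_rev
  rw [sideInd]
  split_ifs <;> simp_all

theorem exA_offDiag (h : IsMiddle i₀ mid) {i j : Fin n} (hij : i ≠ j) :
    exA i₀ mid a b i j = if (i = i₀ ∧ j = mid) ∨ (i = i₀.rev ∧ j = mid.rev) then 1 else 0 := by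
  rw [exA, if_neg hij, zero_add, h.sideInd_eq, h.mid_rev]
  simp only [and_comm (b := j = mid), ← and_or_left, ite_and]

theorem exB_offDiag (h : IsMiddle i₀ mid) {i j : Fin n} (hij : i ≠ j) :
    exB i₀ mid a b i j = if (i = mid ∧ j = i₀) ∨ (i = mid.rev ∧ j = i₀.rev) then 1 else 0 := by
  rw [exB, if_neg hij, zero_add, h.sideInd_eq, h.mid_rev]
  simp only [← and_or_left, ite_and]

theorem exC_offDiag (h : IsMiddle i₀ mid) {i j : Fin n} (hij : i ≠ j) :
    exC i₀ mid a b i j =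
      if ((i = i₀ ∨ i = i₀.rev) ∧ j = mid) ∨ (i = mid ∧ (j = i₀ ∨ j = i₀.rev)) then 1 else 0 := by
  have h1 := h.ne
  have h2 := h.rev_ne
  rw [exC, if_neg hij, zero_add, h.sideInd_eq, h.sideInd_eq]
  by_cases hj : j = mid
  · subst hj
    simp [hij, h1.symm, h2.symm]
  · simp [hj, ite_and]

/-- The hypothesis says that `x` arises from `y` by moving one unit from the centre to each
neighbour. So the block boundaries agree except for the two ends of the middle block, each of which
is displaced by one. -/
theorem sum_Iio (h : IsMiddle i₀ mid) {x y : Fin n → ℤ}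
    (hxy : ∀ I : Finset (Fin n), ∑ i ∈ I, x i + (if mid ∈ I then 2 else 0) =
      ∑ i ∈ I, y i + (if i₀ ∈ I then 1 else 0) + if i₀.rev ∈ I then 1 else 0) (i : Fin n) :
    ∑ j ∈ Finset.Iio i, x j = ∑ j ∈ Finset.Iio i, y j + (if i = mid then 1 else 0) -
      if i = i₀.rev then 1 else 0 := by
  have h1 := h.succ
  have h2 := h.rev_val
  have h3 := hxy (Finset.Iio i)
  simp only [Finset.mem_Iio, Fin.lt_def] at h3
  simp only [Fin.ext_iff]
  split_ifs at h3 ⊢ <;> omega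

theorem sum_Iic (h : IsMiddle i₀ mid) {x y : Fin n → ℤ}
    (hxy : ∀ I : Finset (Fin n), ∑ i ∈ I, x i + (if mid ∈ I then 2 else 0) =
      ∑ i ∈ I, y i + (if i₀ ∈ I then 1 else 0) + if i₀.rev ∈ I then 1 else 0) (i : Fin n) :
    ∑ j ∈ Finset.Iic i, x j = ∑ j ∈ Finset.Iic i, y j + (if i = i₀ then 1 else 0) -
      if i = mid then 1 else 0 := by
  have h1 := h.succ
  have h2 := h.rev_val
  have h3 := hxy (Finset.Iic i)
  simp only [Finset.mem_Iic, Fin.le_def] at h3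
  simp only [Fin.ext_iff]
  split_ifs at h3 ⊢ <;> omega

/-- The block maps of the row and the column composition of the first matrix. -/
theorem exists_moveDatum (h : IsMiddle i₀ mid) {lam μ : Wt n d} (ha : 0 < a) (hb : 0 < b)
    (hb' : Odd b) (hlam : ∀ i, (lam.1 i : ℤ) = diagVec mid a b i + sideInd i₀ i)
    (hμ : ∀ i, (μ.1 i : ℤ) = diagVec mid a (b + 2) i) :
    ∃ κ' κ, ∃ k a' : ℕ, IsBlockMap d lam.1 κ' ∧ IsBlockMap d μ.1 κ ∧
      MoveDatum κ' κ i₀ mid k a' ∧ (a' : ℤ) = a ∧ 2 * (k : ℤ) = b + 1 := by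
  obtain ⟨κ', h'⟩ := exists_isBlockMap (wt_sum lam)
  obtain ⟨κ, hκ⟩ := exists_isBlockMap (wt_sum μ)
  have hsucc := h.succ
  have hrv := h.rev_val
  have hne := h.ne
  have hne2 := h.rev_ne
  have hne3 := h.ne_rev
  obtain ⟨k, hk⟩ : ∃ k : ℕ, 2 * (k : ℤ) = b + 1 := by
    obtain ⟨c, hc⟩ := hb'
    exact ⟨(c + 1).toNat, by omega⟩
  obtain ⟨a', ha'⟩ : ∃ a' : ℕ, (a' : ℤ) = a := ⟨a.toNat, by omega⟩
  have hmid : μ.1 mid = 2 * k + 1 := by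
    have := hμ mid
    rw [diagVec, if_pos rfl] at this
    omega
  have hi₀ : μ.1 i₀ = a' := by
    have := hμ i₀
    rw [diagVec, if_neg h.ne] at this
    omega
  have hIio : ∑ j ∈ Finset.Iio mid, μ.1 j = ∑ j ∈ Finset.Iic i₀, μ.1 j := by
    congr 1
    ext j
    rw [Finset.mem_Iio, Finset.mem_Iic, Fin.lt_def, Fin.le_def]
    omega
  have hIic : ∀ i : Fin n, ∑ j ∈ Finset.Iic i, μ.1 j = (∑ j ∈ Finset.Iio i, μ.1 j) + μ.1 i := by
    intro i
    rw [← Finset.Iio_insert, Finset.sum_insert (by simp), add_comm]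
  -- By symmetry the parts before and after the centre have the same sum, so the middle block is
  -- centred at the position `d`.
  have htot : 2 * (∑ j ∈ Finset.Iio mid, μ.1 j) + μ.1 mid = 2 * d + 1 := by
    have h1 : ∑ j ∈ Finset.Ioi mid, μ.1 j = ∑ j ∈ Finset.Iio mid, μ.1 j := by
      refine Finset.sum_bij' (fun j _ => j.rev) (fun j _ => j.rev) ?_ ?_ ?_ ?_ ?_
      · intro j hj
        rw [Finset.mem_Ioi] at hj
        rw [Finset.mem_Iio, ← h.mid_rev, Fin.rev_lt_rev]
        exact hj
      · intro j hj
        rw [Finset.mem_Iio] at hj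
        rw [Finset.mem_Ioi, ← h.mid_rev, Fin.rev_lt_rev]
        exact hj
      · simp
      · simp
      · intro j _
        rw [wt_rev]
    have h2 := wt_sum μ
    have h3 : (Finset.univ : Finset (Fin n)) = Finset.Iic mid ∪ Finset.Ioi mid := by
      ext j
      simp [le_or_gt]
    have h4 : ∑ j ∈ Finset.Iic mid ∪ Finset.Ioi mid, μ.1 j = 2 * d + 1 := by
      rw [← h3]
      exact h2
    rw [Finset.sum_union, hIic, h1] at h4
    · omega
    · rw [Finset.disjoint_left]
      intro j hj
      simpa using hj
  have hL0 : ∑ j ∈ Finset.Iio mid, μ.1 j = d - k := by omega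
  have hU0 : ∑ j ∈ Finset.Iio i₀, μ.1 j + a' = d - k := by
    rw [← hL0, hIio, hIic, hi₀]
  have hUr : ∑ j ∈ Finset.Iio i₀.rev, μ.1 j = d + k + 1 := by
    have h1 : Finset.Iio i₀.rev = Finset.Iic mid := by
      ext j
      rw [Finset.mem_Iio, Finset.mem_Iic, Fin.lt_def, Fin.le_def]
      omega
    rw [h1, hIic]
    omega
  have hr : μ.1 i₀.rev = a' := by rw [wt_rev, hi₀]
  have hlamsum : ∀ I : Finset (Fin n), ∑ i ∈ I, (lam.1 i : ℤ) + (if mid ∈ I then 2 else 0) =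
      ∑ i ∈ I, (μ.1 i : ℤ) + (if i₀ ∈ I then 1 else 0) + if i₀.rev ∈ I then 1 else 0 := by
    intro I
    simp only [hlam, hμ, diagVec_add_two, sideInd, Finset.sum_add_distrib, Finset.sum_ite_eq']
    ring
  have hk0 : 0 < k := by omega
  refine ⟨κ', κ, k, a', h', hκ, ⟨hκ.mono, h'.mono, hκ.rev (wt_rev μ), h.lt, h.mid_rev, hk0,
    by omega, by omega, ?_, ?_, ?_⟩, ha', hk⟩
  · intro x
    rw [← hκ.mem_block, block, Finset.mem_filter, hIic, hL0, hmid]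
    simp only [Finset.mem_univ, true_and]
    omega
  · intro x
    rw [← hκ.mem_block, block, Finset.mem_filter, hIic, hi₀]
    simp only [Finset.mem_univ, true_and]
    omega
  · intro t ht
    -- The blocks of `κ'` are described by the partial sums of `μ`, corrected at the two ends of the
    -- middle block.
    have key : ∀ (x : Fin (2 * d + 1)) (i : Fin n),
        (∑ j ∈ Finset.Iio i, (μ.1 j : ℤ)) + (if i = mid then 1 else 0) -
          (if i = i₀.rev then 1 else 0) ≤ (x : ℤ) →
        (x : ℤ) < (∑ j ∈ Finset.Iio i, (μ.1 j : ℤ)) + μ.1 i + (if i = i₀ then 1 else 0) -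
          (if i = mid then 1 else 0) → κ' x = i := by
      intro x i h1 h2
      rw [← h'.mem_block, block, Finset.mem_filter]
      refine ⟨Finset.mem_univ _, ?_⟩
      have h5 := hIic i
      zify at h5 ⊢
      rw [h.sum_Iio hlamsum, h.sum_Iic hlamsum, h5]
      exact ⟨h1, h2⟩
    zify at hL0 hU0 hUr
    ext1 x
    by_cases hx1 : x = t
    · rw [hx1, move_self]
      apply key
      · rw [if_neg hne, if_neg hne3]
        omega
      · rw [if_neg hne, if_pos rfl]
        omega
    by_cases hx2 : x = t.rev
    · have htr : t ≠ t.rev := by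
        rw [Ne, Fin.ext_iff, Fin.val_rev]
        omega
      rw [hx2, move_rev_self htr]
      have htv : ((t.rev : Fin (2 * d + 1)) : ℕ) = d + k := by
        rw [Fin.val_rev]
        omega
      apply key
      · rw [if_neg hne2, if_pos rfl, hUr, htv]
        push_cast
        omega
      · rw [if_neg hne2, if_neg hne3.symm, hUr, htv]
        push_cast
        omega
    · rw [move_of_ne hx1 hx2]
      have h1 := (hκ.mem_block x (κ x)).2 rfl
      rw [block, Finset.mem_filter, hIic] at h1
      obtain ⟨-, h1, h2⟩ := h1
      rw [Fin.ext_iff] at hx1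
      rw [Fin.ext_iff, Fin.val_rev] at hx2
      zify at h1 h2
      by_cases hc : κ x = mid
      · rw [hc] at h1 h2 ⊢
        apply key
        · rw [if_pos rfl, if_neg hne2.symm]
          omega
        · rw [if_pos rfl, if_neg hne.symm]
          omega
      · apply key
        · rw [if_neg hc]
          split_ifs <;> omega
        · rw [if_neg hc]
          split_ifs <;> omega

end IsMiddle

end

section

variable {n d : ℕ}

/-! ### The finite level -/

theorem barSchur_add (X Y : SchurMat n d) : barSchur (X + Y) = barSchur X + barSchur Y := by
  ext1 lam μ
  exact barHecke_add _ _

theorem barSchur_smul (c : Qv) (X : SchurMat n d) : barSchur (c • X) = barQ c • barSchur X := by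
  ext1 lam μ
  exact barHecke_smul _ _

theorem barSchur_mul (X Y : SchurMat n d) : barSchur (X * Y) = barSchur X * barSchur Y := by
  ext1 lam μ
  change barHecke ((X * Y) lam μ) = _
  rw [Matrix.mul_apply, Matrix.mul_apply, barHecke_sum]
  exact Finset.sum_congr rfl fun ρ _ => barHecke_mul _ _

theorem wt_ext {lam μ : Wt n d} (h : ∀ i, (lam.1 i : ℤ) = μ.1 i) : lam = μ :=
  Subtype.ext (funext fun i => by exact_mod_cast h i)

/-- The coefficient of the diagonal matrix in the product of the example. -/
def prodCoeff (a b : ℤ) : Qv := v ^ (-(a + b)) * qInt (b + 1)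

namespace IsMiddle

variable {i₀ mid : Fin n} {a b : ℤ}

theorem exists_row_wt (h : IsMiddle i₀ mid) {μ : Wt n d} (ha : 0 < a) (hb : 0 < b)
    (hμ : ∀ i, (μ.1 i : ℤ) = diagVec mid a (b + 2) i) :
    ∃ lam : Wt n d, ∀ i, (lam.1 i : ℤ) = diagVec mid a b i + sideInd i₀ i := by
  have h0 : ∀ i, ((diagVec mid a b i + sideInd i₀ i).toNat : ℤ) =
      diagVec mid a b i + sideInd i₀ i := by
    intro i
    refine Int.toNat_of_nonneg ?_
    rw [diagVec, sideInd]
    split_ifs <;> omega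
  have h1 : ∑ i, (diagVec mid a b i + sideInd i₀ i).toNat = 2 * d + 1 := by
    rw [← wt_sum μ, ← Nat.cast_inj (R := ℤ)]
    push_cast
    simp only [h0, hμ, diagVec_add_two, Finset.sum_add_distrib, sum_sideInd]
    simp
  refine ⟨⟨fun i => (diagVec mid a b i + sideInd i₀ i).toNat, ?_⟩, h0⟩
  simp only [Finset.mem_filter, Finset.mem_piAntidiag, Finset.mem_univ, implies_true, and_true]
  exact ⟨h1, fun i => by rw [h.diagVec_rev, sideInd_rev]⟩

theorem exD_self {μ : Wt n d} {κ : Fin (2 * d + 1) → Fin n}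
    (hκ : IsBlockMap d μ.1 κ) (hμ : ∀ i, (μ.1 i : ℤ) = diagVec mid a (b + 2) i) :
    std n d (exD mid a b) μ μ = idem κ := by
  refine std_diag hκ (fun i => by rw [sum_exD_row, hμ]) fun i j hij => ?_
  rw [exD, if_neg hij]

theorem barSchur_exD :
    barSchur (std n d (exD mid a b)) = std n d (exD mid a b) := by
  ext1 lam μ
  change barHecke _ = _
  by_cases hz : std n d (exD mid a b) lam μ = 0
  · rw [hz, barHecke_zero]
  obtain ⟨h1, h2⟩ := sum_of_std_ne_zero hz
  simp only [sum_exD_row, sum_exD_col] at h1 h2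
  obtain rfl : lam = μ := wt_ext fun i => by rw [← h1, ← h2]
  obtain ⟨κ, hκ⟩ := exists_isBlockMap (wt_sum lam)
  rw [exD_self hκ fun i => (h1 i).symm, barHecke_idem hκ.mono (hκ.rev (wt_rev lam))]

theorem barSchur_exA (h : IsMiddle i₀ mid) (ha : 0 < a) (hb : 0 < b) (hb' : Odd b) :
    barSchur (std n d (exA i₀ mid a b)) = std n d (exA i₀ mid a b) := by
  ext1 lam μ
  change barHecke _ = _
  by_cases hz : std n d (exA i₀ mid a b) lam μ = 0
  · rw [hz, barHecke_zero]
  obtain ⟨h1, h2⟩ := sum_of_std_ne_zero hz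
  simp only [sum_exA_row, sum_exA_col] at h1 h2
  obtain ⟨κ', κ, k, a', hl, hm, hM, -, -⟩ :=
    h.exists_moveDatum ha hb hb' (fun i => (h1 i).symm) fun i => (h2 i).symm
  exact hM.bar_std_left hl hm (fun i => by rw [sum_exA_row, h1]) fun i j => h.exA_offDiag

theorem barSchur_exB (h : IsMiddle i₀ mid) (ha : 0 < a) (hb : 0 < b) (hb' : Odd b) :
    barSchur (std n d (exB i₀ mid a b)) = std n d (exB i₀ mid a b) := by
  ext1 lam μ
  change barHecke _ = _
  by_cases hz : std n d (exB i₀ mid a b) lam μ = 0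
  · rw [hz, barHecke_zero]
  obtain ⟨h1, h2⟩ := sum_of_std_ne_zero hz
  simp only [sum_exB_row, sum_exB_col] at h1 h2
  obtain ⟨κ', κ, k, a', hl, hm, hM, -, -⟩ :=
    h.exists_moveDatum ha hb hb' (fun i => (h2 i).symm) fun i => (h1 i).symm
  exact hM.bar_std_mid hl hm (fun i => by rw [sum_exB_row, h1]) fun i j => h.exB_offDiag

/-- Row and column sums leave a single intermediate composition in the matrix product. There `2 k =
b + 1` turns the coefficient of the idempotent into `prodCoeff a b`. -/
theorem exB_mul_exA (h : IsMiddle i₀ mid) (ha : 0 < a) (hb : 0 < b) (hb' : Odd b) :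
    std n d (exB i₀ mid a b) * std n d (exA i₀ mid a b) =
      std n d (exC i₀ mid a b) + prodCoeff a b • std n d (exD mid a b) := by
  ext1 lam μ
  rw [Matrix.mul_apply, Matrix.add_apply, Matrix.smul_apply]
  by_cases hlm : (∀ i, (lam.1 i : ℤ) = diagVec mid a (b + 2) i) ∧
      ∀ i, (μ.1 i : ℤ) = diagVec mid a (b + 2) i
  · obtain ⟨hl, hm⟩ := hlm
    obtain rfl : lam = μ := wt_ext fun i => by rw [hl, hm]
    obtain ⟨ρ, hρ⟩ := h.exists_row_wt ha hb hm
    obtain ⟨κ', κ, k, a', hl', hm', hM, ha', hk⟩ := h.exists_moveDatum ha hb hb' hρ hm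
    have hk0 := hM.k_pos
    rw [Finset.sum_eq_single ρ, hM.std_mid_mul_std_left (MC := exC i₀ mid a b) hl' hm'
      (fun i => by rw [sum_exA_row, hρ]) (fun i j => h.exA_offDiag)
      (fun i => by rw [sum_exB_row, hm]) (fun i j => h.exB_offDiag)
      (fun i => by rw [sum_exC_row, hm]) (fun i j => h.exC_offDiag), exD_self hm' hm]
    · congr 2
      rw [prodCoeff, qNat_eq, qInt, ← hk, ← ha']
      congr 2
      push_cast [Nat.cast_sub (show 1 ≤ 2 * k by omega)]
      omega
    · intro σ _ hne
      by_cases hz : std n d (exA i₀ mid a b) σ lam = 0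
      · rw [hz, mul_zero]
      · obtain ⟨h1, -⟩ := sum_of_std_ne_zero hz
        simp only [sum_exA_row] at h1
        exact absurd (wt_ext fun i => by rw [← h1, hρ]) hne
    · intro h0
      exact absurd (Finset.mem_univ _) h0
  · have h1 : ∀ ρ, std n d (exB i₀ mid a b) lam ρ * std n d (exA i₀ mid a b) ρ μ = 0 := by
      intro ρ
      by_cases hz : std n d (exB i₀ mid a b) lam ρ = 0
      · rw [hz, zero_mul]
      by_cases hz' : std n d (exA i₀ mid a b) ρ μ = 0
      · rw [hz', mul_zero]
      obtain ⟨h2, -⟩ := sum_of_std_ne_zero hz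
      obtain ⟨-, h3⟩ := sum_of_std_ne_zero hz'
      simp only [sum_exB_row, sum_exA_col] at h2 h3
      exact absurd ⟨fun i => (h2 i).symm, fun i => (h3 i).symm⟩ hlm
    have h2 : std n d (exC i₀ mid a b) lam μ = 0 := by
      by_contra hz
      obtain ⟨h2, h3⟩ := sum_of_std_ne_zero hz
      simp only [sum_exC_row, sum_exC_col] at h2 h3
      exact absurd ⟨fun i => (h2 i).symm, fun i => (h3 i).symm⟩ hlm
    have h3 : std n d (exD mid a b) lam μ = 0 := by
      by_contra hz
      obtain ⟨h2, h3⟩ := sum_of_std_ne_zero hz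
      simp only [sum_exD_row, sum_exD_col] at h2 h3
      exact absurd ⟨fun i => (h2 i).symm, fun i => (h3 i).symm⟩ hlm
    rw [h2, h3, smul_zero, add_zero]
    exact Finset.sum_eq_zero fun ρ _ => h1 ρ

/-- No direct computation is needed: bar fixes both factors of the product formula, hence its
right-hand side, and the diagonal term is known. -/
theorem barSchur_exC (h : IsMiddle i₀ mid) (ha : 0 < a) (hb : 0 < b) (hb' : Odd b) :
    barSchur (std n d (exC i₀ mid a b)) = std n d (exC i₀ mid a b) +
      (prodCoeff a b - barQ (prodCoeff a b)) • std n d (exD mid a b) := by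
  have h1 := congrArg barSchur (h.exB_mul_exA (d := d) ha hb hb')
  rw [barSchur_mul, h.barSchur_exA ha hb hb', h.barSchur_exB ha hb hb', h.exB_mul_exA ha hb hb',
    barSchur_add, barSchur_smul, barSchur_exD] at h1
  rw [sub_smul, ← add_sub_assoc, h1, add_sub_cancel_right]

/-! ### The matrices as elements of `Ξ̃` -/

theorem diagVec_odd (h : IsMiddle i₀ mid) (hb : Odd b) {i : Fin n} (hi : i.rev = i) :
    Odd (diagVec mid a b i) := by
  rwa [diagVec, if_pos ((rev_eq_iff h.mid_rev i).1 hi)]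

theorem sideInd_nonneg (i₀ i : Fin n) : 0 ≤ sideInd i₀ i := by
  rw [sideInd]
  positivity

/-- The first matrix of the example. -/
def txA (h : IsMiddle i₀ mid) (a : ℤ) (hb : Odd b) : TXi n :=
  ⟨exA i₀ mid a b, by
    refine ⟨fun i j hij => ?_, fun i hi => ?_, fun i j => ?_⟩
    · rw [exA, if_neg hij]
      have := sideInd_nonneg i₀ i
      positivity
    · rw [exA, if_pos rfl, (rev_eq_iff h.mid_rev i).1 hi, h.sideInd_mid]
      simpa [diagVec] using hb
    · simp only [exA, h.diagVec_rev, sideInd_rev, h.rev_eq, Fin.rev_inj]⟩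

/-- The second matrix of the example. -/
def txB (h : IsMiddle i₀ mid) (a : ℤ) (hb : Odd b) : TXi n :=
  ⟨exB i₀ mid a b, by
    refine ⟨fun i j hij => ?_, fun i hi => ?_, fun i j => ?_⟩
    · rw [exB, if_neg hij]
      have := sideInd_nonneg i₀ j
      positivity
    · rw [exB, if_pos rfl, (rev_eq_iff h.mid_rev i).1 hi, h.sideInd_mid]
      simpa [diagVec] using hb
    · simp only [exB, h.diagVec_rev, sideInd_rev, h.rev_eq, Fin.rev_inj]⟩

/-- The leading matrix of the product. -/
def txC (h : IsMiddle i₀ mid) (a : ℤ) (hb : Odd b) : TXi n :=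
  ⟨exC i₀ mid a b, by
    refine ⟨fun i j hij => ?_, fun i hi => ?_, fun i j => ?_⟩
    · rw [exC, if_neg hij]
      have := sideInd_nonneg i₀ i
      have := sideInd_nonneg i₀ j
      positivity
    · rw [exC, if_pos rfl, (rev_eq_iff h.mid_rev i).1 hi, h.sideInd_mid]
      simpa [diagVec] using hb
    · simp only [exC, h.diagVec_rev, sideInd_rev, h.rev_eq, Fin.rev_inj]⟩

/-- The diagonal matrix below the leading matrix of the product. -/
def txD (h : IsMiddle i₀ mid) (a : ℤ) (hb : Odd b) : TXi n :=
  ⟨exD mid a b, by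
    refine ⟨fun i j hij => ?_, fun i hi => ?_, fun i j => ?_⟩
    · rw [exD, if_neg hij]
    · rw [exD, if_pos rfl]
      exact h.diagVec_odd (hb.add_even even_two) hi
    · simp only [exD, h.diagVec_rev, Fin.rev_inj]⟩

theorem diagVec_shift (mid : Fin n) (a b : ℤ) (p : ℤ) (i : Fin n) :
    diagVec mid (a + p) (b + p) i = diagVec mid a b i + p := by
  rw [diagVec, diagVec]
  split_ifs <;> rfl

theorem shift_txA (h : IsMiddle i₀ mid) (hb : Odd b) (p : ℕ) :
    shift p (h.txA a hb) = exA i₀ mid (a + p) (b + p) := by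
  ext i j
  rw [shift_apply]
  simp only [txA, exA, diagVec_shift]
  split_ifs <;> ring

theorem shift_txB (h : IsMiddle i₀ mid) (hb : Odd b) (p : ℕ) :
    shift p (h.txB a hb) = exB i₀ mid (a + p) (b + p) := by
  ext i j
  rw [shift_apply]
  simp only [txB, exB, diagVec_shift]
  split_ifs <;> ring

theorem shift_txC (h : IsMiddle i₀ mid) (hb : Odd b) (p : ℕ) :
    shift p (h.txC a hb) = exC i₀ mid (a + p) (b + p) := by
  ext i j
  rw [shift_apply]
  simp only [txC, exC, diagVec_shift]
  split_ifs <;> ring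

theorem shift_txD (h : IsMiddle i₀ mid) (hb : Odd b) (p : ℕ) :
    shift p (h.txD a hb) = exD mid (a + p) (b + p) := by
  ext i j
  rw [shift_apply]
  simp only [txD, exD, add_right_comm _ (p : ℤ) 2, diagVec_shift]
  split_ifs <;> ring

end IsMiddle

/-! ### The stable limits -/

theorem evalLaurent_zero_left (x : Qv) : evalLaurent 0 x = 0 := by simp [evalLaurent]

theorem stableLimit_pair (hn : Odd n) {F : (p d : ℕ) → SchurMat n d} {X Y : TXi n}
    {g : ℤ →₀ Qv} (p₀ : ℕ) (hF : ∀ p ≥ p₀, Even p → ∀ d, F p d = std n d (shift p X) +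
      evalLaurent g (v ^ (-(p : ℤ))) • std n d (shift p Y)) :
    stableLimit F = Finsupp.single X 1 + Finsupp.single Y (evalLaurent g 1) := by
  have h1 : ∀ x : Qv, evalLaurent (Finsupp.single 0 1) x = 1 := by simp [evalLaurent]
  have h : HasStableExpansion F
      (Finsupp.single X (Finsupp.single 0 1) + Finsupp.single Y g) := by
    refine ⟨p₀, fun p hp hpe d => ?_⟩
    rw [hF p hp hpe, Finsupp.sum_add_index', Finsupp.sum_single_index, Finsupp.sum_single_index,
      h1, one_smul]
    · rw [evalLaurent_zero_left, zero_smul]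
    · rw [evalLaurent_zero_left, zero_smul]
    · intro Z
      rw [evalLaurent_zero_left, zero_smul]
    · intro Z g g'
      rw [evalLaurent_add, add_smul]
  classical
  ext1 Z
  rw [stableLimit_eq hn h, Finsupp.add_apply, Finsupp.add_apply, evalLaurent_add,
    Finsupp.single_apply, Finsupp.single_apply, Finsupp.single_apply, Finsupp.single_apply]
  congr 1
  · split_ifs
    · rw [h1]
    · rw [evalLaurent_zero_left]
  · split_ifs
    · rfl
    · rw [evalLaurent_zero_left]

theorem stableLimit_single (hn : Odd n) {F : (p d : ℕ) → SchurMat n d} {X : TXi n}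
    (p₀ : ℕ) (hF : ∀ p ≥ p₀, Even p → ∀ d, F p d = std n d (shift p X)) :
    stableLimit F = Finsupp.single X 1 := by
  rw [stableLimit_pair hn (Y := X) (g := 0) p₀, evalLaurent_zero_left, Finsupp.single_zero,
    add_zero]
  intro p hp hpe d
  rw [hF p hp hpe, evalLaurent_zero_left, zero_smul, add_zero]

/-- The coefficient of the diagonal matrix, as a Laurent polynomial in `v' = v^{-p}`. -/
theorem exists_prodCoeff_laurent (a b : ℤ) :
    ∃ g : ℤ →₀ Qv, ∀ p : ℤ, evalLaurent g (v ^ (-p)) = prodCoeff (a + p) (b + p) := by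
  -- Expanding the definition, `prodCoeff (a + p) (b + p)` equals `(v^{b-a+2} - v^{-(a+b)} v'^2) /
  -- (v² - 1)` with `v' = v^{-p}`.
  refine ⟨Finsupp.single 0 (v ^ (b - a + 2) / (v ^ 2 - 1)) -
    Finsupp.single 2 (v ^ (-(a + b)) / (v ^ 2 - 1)), fun p => ?_⟩
  rw [evalLaurent_sub, evalLaurent_single, evalLaurent_single, zpow_zero, mul_one, prodCoeff, qInt,
    ← zpow_mul, div_mul_eq_mul_div, ← zpow_add₀ v_ne_zero, ← sub_div, ← mul_div_assoc, mul_sub,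
    mul_one, ← zpow_add₀ v_ne_zero]
  ring_nf

/-- Conjugation sends `v'` to its inverse, whence the exponent `-2`. -/
theorem exists_barQ_prodCoeff_laurent (a b : ℤ) :
    ∃ g : ℤ →₀ Qv, ∀ p : ℤ, evalLaurent g (v ^ (-p)) = barQ (prodCoeff (a + p) (b + p)) := by
  refine ⟨Finsupp.single 0 (v ^ (-(b - a + 2)) / (v ^ (-2 : ℤ) - 1)) -
    Finsupp.single (-2) (v ^ (a + b) / (v ^ (-2 : ℤ) - 1)), fun p => ?_⟩
  have h2 : barQ (v ^ 2) = v ^ (-2 : ℤ) := barQ_pow 2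
  rw [evalLaurent_sub, evalLaurent_single, evalLaurent_single, zpow_zero, mul_one, prodCoeff, qInt,
    map_mul, map_div₀, map_sub, map_sub, map_one, h2, barQ_zpow, barQ_zpow,
    ← zpow_mul, div_mul_eq_mul_div, ← zpow_add₀ v_ne_zero, ← sub_div, ← mul_div_assoc, mul_sub,
    mul_one, ← zpow_add₀ v_ne_zero]
  ring_nf

namespace IsMiddle

variable {i₀ mid : Fin n} {a b : ℤ}

theorem barStd_txA (h : IsMiddle i₀ mid) (hn : Odd n) (hb : Odd b) :
    barStd (h.txA a hb) = Finsupp.single (h.txA a hb) 1 := by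
  -- From this bound on `a + p` and `b + p` are positive, as the finite level requires; `p` even
  -- keeps `b + p` odd.
  refine stableLimit_single hn (a.natAbs + b.natAbs + 1) fun p hp hpe d => ?_
  rw [shift_txA]
  exact h.barSchur_exA (by omega) (by omega) (hb.add_even (by exact_mod_cast hpe))

theorem barStd_txB (h : IsMiddle i₀ mid) (hn : Odd n) (hb : Odd b) :
    barStd (h.txB a hb) = Finsupp.single (h.txB a hb) 1 := by
  refine stableLimit_single hn (a.natAbs + b.natAbs + 1) fun p hp hpe d => ?_
  rw [shift_txB]
  exact h.barSchur_exB (by omega) (by omega) (hb.add_even (by exact_mod_cast hpe))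

theorem barStd_txD (h : IsMiddle i₀ mid) (hn : Odd n) (hb : Odd b) :
    barStd (h.txD a hb) = Finsupp.single (h.txD a hb) 1 := by
  refine stableLimit_single hn 0 fun p hp hpe d => ?_
  rw [shift_txD]
  exact barSchur_exD

theorem barStd_txC (h : IsMiddle i₀ mid) (hn : Odd n) (hb : Odd b) :
    barStd (h.txC a hb) = Finsupp.single (h.txC a hb) 1 +
      Finsupp.single (h.txD a hb) (prodCoeff a b - barQ (prodCoeff a b)) := by
  obtain ⟨g, hg⟩ := exists_prodCoeff_laurent a b
  obtain ⟨g', hg'⟩ := exists_barQ_prodCoeff_laurent a b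
  have h1 := hg 0
  have h2 := hg' 0
  rw [neg_zero, zpow_zero, add_zero, add_zero] at h1 h2
  rw [← h2, ← h1, ← evalLaurent_sub]
  refine stableLimit_pair hn (a.natAbs + b.natAbs + 1) fun p hp hpe d => ?_
  rw [shift_txC, shift_txD, evalLaurent_sub, hg, hg']
  exact h.barSchur_exC (by omega) (by omega) (hb.add_even (by exact_mod_cast hpe))

theorem mulStd_txB_txA (h : IsMiddle i₀ mid) (hn : Odd n) (hb : Odd b) :
    mulStd (h.txB a hb) (h.txA a hb) = Finsupp.single (h.txC a hb) 1 +
      Finsupp.single (h.txD a hb) (prodCoeff a b) := by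
  obtain ⟨g, hg⟩ := exists_prodCoeff_laurent a b
  have h1 := hg 0
  rw [neg_zero, zpow_zero, add_zero, add_zero] at h1
  rw [← h1]
  refine stableLimit_pair hn (a.natAbs + b.natAbs + 1) fun p hp hpe d => ?_
  rw [shift_txA, shift_txB, shift_txC, shift_txD, hg]
  exact h.exB_mul_exA (by omega) (by omega) (hb.add_even (by exact_mod_cast hpe))

end IsMiddle

end

section

/-! ### Laurent polynomials with nonnegative coefficients -/

theorem NLaurent_add {f g : Qv} (hf : f ∈ NLaurent) (hg : g ∈ NLaurent) : f + g ∈ NLaurent := by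
  obtain ⟨c, rfl⟩ := hf
  obtain ⟨c', rfl⟩ := hg
  refine ⟨c + c', ?_⟩
  rw [Finsupp.sum_add_index']
  · simp
  · intro k m m'
    push_cast
    ring

theorem sum_zpow_mem_NLaurent {ι : Type*} (s : Finset ι) (f : ι → ℤ) :
    ∑ j ∈ s, v ^ f j ∈ NLaurent := by
  classical
  induction s using Finset.induction_on with
  | empty => exact ⟨0, by simp⟩
  | insert j s hj ih =>
    rw [Finset.sum_insert hj]
    exact NLaurent_add ⟨Finsupp.single (f j) 1, by simp⟩ ih

theorem negLattice_zero : (0 : Qv) ∈ negLattice := ⟨0, by simp⟩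

theorem negLattice_add {f g : Qv} (hf : f ∈ negLattice) (hg : g ∈ negLattice) :
    f + g ∈ negLattice := by
  obtain ⟨c, rfl⟩ := hf
  obtain ⟨c', rfl⟩ := hg
  refine ⟨c + c', ?_⟩
  rw [Finsupp.sum_add_index']
  · simp
  · intro k m m'
    push_cast
    ring

theorem negLattice_neg {f : Qv} (hf : f ∈ negLattice) : -f ∈ negLattice := by
  obtain ⟨c, rfl⟩ := hf
  refine ⟨-c, ?_⟩
  rw [Finsupp.sum_neg_index (by simp), Finsupp.sum, Finsupp.sum, ← Finset.sum_neg_distrib]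
  refine Finset.sum_congr rfl fun k _ => ?_
  push_cast
  ring

theorem sum_zpow_mem_negLattice {ι : Type*} (s : Finset ι) (f : ι → ℤ) (hf : ∀ j ∈ s, f j < 0) :
    ∑ j ∈ s, v ^ f j ∈ negLattice := by
  classical
  induction s using Finset.induction_on with
  | empty => exact negLattice_zero
  | insert j s hj ih =>
    rw [Finset.sum_insert hj]
    refine negLattice_add ⟨Finsupp.single (-f j - 1).toNat 1, ?_⟩
      (ih fun k hk => hf k (Finset.mem_insert_of_mem hk))
    have h1 := hf j (Finset.mem_insert_self j s)
    rw [Finsupp.sum_single_index (by simp), Int.cast_one, one_mul]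
    congr 1
    omega

theorem v_zpow_sq_sub_one_ne_zero : v ^ (-2 : ℤ) - 1 ≠ 0 := by
  intro h
  have := @v_zpow_injective (-2) 0 (by simpa [sub_eq_zero] using h)
  omega

theorem barQ_qInt (m : ℤ) : barQ (qInt m) = v ^ (-2 * (m - 1)) * qInt m := by
  have h2 : barQ (v ^ 2) = v ^ (-2 : ℤ) := barQ_pow 2
  rw [qInt, map_div₀, map_sub, map_sub, map_one, h2, barQ_zpow, div_eq_iff v_zpow_sq_sub_one_ne_zero,
    ← mul_div_assoc, div_mul_eq_mul_div, eq_div_iff v_sq_sub_one_ne_zero, ← zpow_natCast v 2]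
  simp only [mul_sub, sub_mul, mul_one, one_mul, ← zpow_add₀ v_ne_zero]
  ring_nf
  rw [zpow_zero]
  ring

/-- This is `v² + v⁴ + ⋯ + v^{2m}`: conjugate quantum integers at negative arguments have
nonpositive coefficients, which is the source of the failure of positivity. -/
theorem neg_barQ_qInt_neg (m : ℕ) : -barQ (qInt (-(m : ℤ))) = v ^ 2 * qNat m := by
  rw [barQ_qInt, qInt, qNat_eq, ← mul_div_assoc, ← mul_div_assoc, ← neg_div]
  congr 1
  rw [← zpow_natCast v 2]
  simp only [mul_sub, mul_one, ← zpow_add₀ v_ne_zero]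
  ring_nf

theorem zpow_mul_neg_barQ_qInt_neg (k : ℤ) (m : ℕ) :
    v ^ k * -barQ (qInt (-(m : ℤ))) = ∑ j ∈ Finset.range m, v ^ (k + 2 + 2 * (j : ℤ)) := by
  rw [neg_barQ_qInt_neg, qNat, Finset.mul_sum, Finset.mul_sum]
  refine Finset.sum_congr rfl fun j _ => ?_
  rw [← pow_mul, ← zpow_natCast, ← zpow_natCast, ← zpow_add₀ v_ne_zero, ← zpow_add₀ v_ne_zero]
  congr 1
  push_cast
  ring

theorem barQ_prodCoeff (a b : ℤ) :
    barQ (prodCoeff a b) = v ^ (a + b) * barQ (qInt (b + 1)) := by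
  rw [prodCoeff, map_mul, barQ_zpow, neg_neg]

/-- Together with `barQ_prodCoeff` this writes the coefficient and its conjugate as multiples of the
same conjugate quantum integer, with the factors `v^{b-a}` and `v^{a+b}`. -/
theorem prodCoeff_eq (a b : ℤ) : prodCoeff a b = v ^ (b - a) * barQ (qInt (b + 1)) := by
  rw [prodCoeff, barQ_qInt, ← mul_assoc, ← zpow_add₀ v_ne_zero]
  congr 2
  ring

/-! ### The order -/

variable {n : ℕ}

/-- The sum of the entries weakly to the north-east of a position. -/
def cornerSum (A : TXi n) (i j : Fin n) : ℤ := ∑ r ∈ Finset.Iic i, ∑ s ∈ Finset.Ici j, A.1 r s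

theorem cornerSum_eq (A : TXi n) (i j : Fin n) : cornerSum A i j =
    A.1 i j + ∑ p ∈ (Finset.Iic i ×ˢ Finset.Ici j).erase (i, j), A.1 p.1 p.2 := by
  refine (Finset.sum_product (Finset.Iic i) (Finset.Ici j)
    (fun p : Fin n × Fin n => A.1 p.1 p.2)).symm.trans ?_
  exact (Finset.add_sum_erase _ (fun p : Fin n × Fin n => A.1 p.1 p.2)
    (a := (i, j)) (Finset.mem_product.2 ⟨Finset.mem_Iic.2 le_rfl, Finset.mem_Ici.2 le_rfl⟩)).symm

theorem mem_corner_erase {i j : Fin n} {p : Fin n × Fin n} :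
    p ∈ (Finset.Iic i ×ˢ Finset.Ici j).erase (i, j) ↔
      p.1 ≤ i ∧ j ≤ p.2 ∧ (p.1 < i ∨ j < p.2) := by
  rw [Finset.mem_erase, Finset.mem_product, Finset.mem_Iic, Finset.mem_Ici, Ne, Prod.ext_iff]
  simp only [Fin.le_def, Fin.lt_def, Fin.ext_iff]
  omega

theorem le_cornerSum (A : TXi n) {i j : Fin n} (hij : i < j) : A.1 i j ≤ cornerSum A i j := by
  rw [cornerSum_eq, le_add_iff_nonneg_right]
  refine Finset.sum_nonneg fun p hp => A.2.1 _ _ ?_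
  rw [mem_corner_erase] at hp
  exact (hp.1.trans_lt (hij.trans_le hp.2.1)).ne

/-- Strictly above the diagonal, every other entry of the corner lies at distance at least two from
the diagonal. -/
theorem cornerSum_of_tridiagonal {A : TXi n} (hA : ∀ i j : Fin n, (i : ℕ) + 1 < j → A.1 i j = 0)
    {i j : Fin n} (hij : i < j) : cornerSum A i j = A.1 i j := by
  rw [cornerSum_eq, add_eq_left]
  refine Finset.sum_eq_zero fun p hp => hA _ _ ?_
  rw [mem_corner_erase] at hp
  simp only [Fin.le_def, Fin.lt_def] at hp hij
  omega

/-- An element of `Ξ̃` is determined by its entries above the diagonal and its row sums. -/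
theorem txi_ext {A B : TXi n} (h : ∀ i j, i < j → A.1 i j = B.1 i j)
    (hrow : ∀ i, ∑ j, A.1 i j = ∑ j, B.1 i j) : A = B := by
  have hne : ∀ i j, i ≠ j → A.1 i j = B.1 i j := by
    intro i j hij
    rcases lt_or_gt_of_ne hij with hlt | hlt
    · exact h i j hlt
    · rw [← A.2.2.2, ← B.2.2.2]
      exact h _ _ (Fin.rev_lt_rev.2 hlt)
  refine Subtype.ext (Matrix.ext fun i j => ?_)
  by_cases hij : i = j
  · subst hij
    have h1 := hrow i
    rw [← Finset.add_sum_erase _ _ (Finset.mem_univ i),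
      ← Finset.add_sum_erase _ (fun j => B.1 i j) (Finset.mem_univ i),
      Finset.sum_congr rfl fun j hj => hne i j (Finset.ne_of_mem_erase hj).symm] at h1
    exact add_right_cancel h1
  · exact hne i j hij

theorem eq_of_cornerSum_eq {A B : TXi n} (h : ∀ i j, i < j → cornerSum A i j = cornerSum B i j)
    (hrow : ∀ i, ∑ j, A.1 i j = ∑ j, B.1 i j) : A = B := by
  refine txi_ext ?_ hrow
  -- Induction on the distance to the north-east corner: all other entries of the corner at `(i, j)`
  -- are nearer to it and already known.
  have key : ∀ N : ℕ, ∀ i j : Fin n, i < j → (i : ℕ) + (n - j) = N → A.1 i j = B.1 i j := by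
    intro N
    induction N using Nat.strong_induction_on with
    | _ N ih =>
      intro i j hij hN
      have h1 := h i j hij
      rw [cornerSum_eq, cornerSum_eq, Finset.sum_congr rfl fun p hp => ?_] at h1
      · exact add_right_cancel h1
      · rw [mem_corner_erase] at hp
        refine ih _ ?_ p.1 p.2 (hp.1.trans_lt (hij.trans_le hp.2.1)) rfl
        have := p.2.2
        simp only [Fin.le_def, Fin.lt_def] at hp
        omega
  exact fun i j hij => key _ i j hij rfl

/-- A linear functional strictly increasing along the order. -/
def cornerTotal (A : TXi n) : ℤ := ∑ i, ∑ j ∈ Finset.Ioi i, cornerSum A i j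

theorem Below.eq_of_cornerTotal_le {A B : TXi n} (h : Below A B)
    (hle : cornerTotal B ≤ cornerTotal A) : A = B := by
  have h1 : ∀ i, ∀ j ∈ Finset.Ioi i, cornerSum A i j ≤ cornerSum B i j := fun i j hj =>
    h.1 i j (Finset.mem_Ioi.1 hj)
  have h2 : ∀ i ∈ (Finset.univ : Finset (Fin n)), ∑ j ∈ Finset.Ioi i, cornerSum A i j ≤
      ∑ j ∈ Finset.Ioi i, cornerSum B i j := fun i _ => Finset.sum_le_sum (h1 i)
  have h3 := (Finset.sum_eq_sum_iff_of_le h2).1 (le_antisymm (Finset.sum_le_sum h2) hle)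
  refine eq_of_cornerSum_eq (fun i j hij => ?_) h.2.1
  exact (Finset.sum_eq_sum_iff_of_le (h1 i)).1 (h3 i (Finset.mem_univ i)) j (Finset.mem_Ioi.2 hij)

/-! ### The stably canonical basis -/

theorem cb_spec {A : TXi n} (h : HasCB A) : IsStablyCanonical A (cb A) := by
  rw [cb, dif_pos h]
  exact h.choose_spec.1

theorem cb_eq {A : TXi n} {x : Uj n} (h : IsStablyCanonical A x)
    (hu : ∀ y, IsStablyCanonical A y → y = x) : HasCB A ∧ cb A = x := by
  have h1 : HasCB A := ⟨x, h, hu⟩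
  exact ⟨h1, hu _ (cb_spec h1)⟩

/-- The stably canonical basis elements are linearly independent. -/
theorem eq_zero_of_sum_cb_eq_zero {f : TXi n →₀ Qv} (hf : ∀ C, f C ≠ 0 → HasCB C)
    (h : (f.sum fun C c => c • cb C) = 0) : f = 0 := by
  by_contra hne
  -- At an index of the support with maximal `cornerTotal` no other basis element of the sum has a
  -- coefficient, so the coefficient there is `f C` itself.
  obtain ⟨C, hC, hmax⟩ := f.support.exists_max_image cornerTotal (Finsupp.support_nonempty_iff.2 hne)
  have h1 := DFunLike.congr_fun h C
  rw [Finsupp.sum, Finsupp.finsetSum_apply, Finset.sum_eq_single C] at h1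
  · rw [Finsupp.smul_apply, (cb_spec (hf C (Finsupp.mem_support_iff.1 hC))).2.1, smul_eq_mul,
      mul_one] at h1
    exact Finsupp.mem_support_iff.1 hC h1
  · intro C' hC' hne'
    by_contra h2
    rw [Finsupp.smul_apply, smul_eq_mul] at h2
    have h3 := (cb_spec (hf C' (Finsupp.mem_support_iff.1 hC'))).2.2 C hne'.symm
    exact hne'.symm ((h3.2 (right_ne_zero_of_mul h2)).eq_of_cornerTotal_le (hmax C' hC'))
  · intro h2
    exact absurd hC h2

theorem IsStructureConstants.unique {B A : TXi n} {g g' : TXi n →₀ Qv}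
    (h : IsStructureConstants B A g) (h' : IsStructureConstants B A g') : g' = g := by
  rw [← sub_eq_zero]
  refine eq_zero_of_sum_cb_eq_zero (fun C hC => ?_) ?_
  · by_cases h1 : g C = 0
    · refine h'.2.2.1 C fun h2 => hC ?_
      rw [Finsupp.sub_apply, h1, h2, sub_zero]
    · exact h.2.2.1 C h1
  · rw [Finsupp.sum_sub_index fun C c c' => sub_smul c c' (cb C), ← h.2.2.2, ← h'.2.2.2, sub_self]

theorem bar_single (A : TXi n) (c : Qv) : bar (Finsupp.single A c) = barQ c • barStd A := by
  rw [bar, Finsupp.sum_single_index]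
  rw [map_zero, zero_smul]

theorem bar_add (x y : Uj n) : bar (x + y) = bar x + bar y := by
  rw [bar, Finsupp.sum_add_index']
  · rfl
  · intro A
    rw [map_zero, zero_smul]
  · intro A c c'
    rw [map_add, add_smul]

/-- The stably canonical basis element of a minimal element of the order. -/
theorem cb_of_minimal {X : TXi n} (hmin : ∀ A', Below A' X → A' = X)
    (hbar : barStd X = Finsupp.single X 1) : HasCB X ∧ cb X = Finsupp.single X 1 := by
  classical
  refine cb_eq ⟨?_, ?_, fun A' hA' => ?_⟩ fun y hy => ?_
  · rw [bar_single, hbar, map_one, one_smul]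
  · rw [Finsupp.single_eq_same]
  · rw [Finsupp.single_apply, if_neg hA'.symm]
    exact ⟨negLattice_zero, fun h => absurd rfl h⟩
  · ext1 Z
    by_cases hZ : Z = X
    · rw [hZ, hy.2.1, Finsupp.single_eq_same]
    · rw [Finsupp.single_apply, if_neg (Ne.symm hZ)]
      by_contra h0
      exact hZ (hmin Z ((hy.2.2 Z hZ).2 h0))

/-- The stably canonical basis element of an element with one minimal element below. -/
theorem cb_of_cover {X Y : TXi n} (hXY : Y ≠ X) (hbelow : Below Y X)
    (hmin : ∀ A', Below A' X → A' = X ∨ A' = Y) {c : Qv}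
    (hX : barStd X = Finsupp.single X 1 + Finsupp.single Y (c - barQ c))
    (hY : barStd Y = Finsupp.single Y 1) (hc : c ∈ negLattice) :
    HasCB X ∧ cb X = Finsupp.single X 1 + Finsupp.single Y c := by
  classical
  have hbar : ∀ e : Qv, bar (Finsupp.single X 1 + Finsupp.single Y e) =
      Finsupp.single X 1 + Finsupp.single Y (c - barQ c + barQ e) := by
    intro e
    rw [bar_add, bar_single, bar_single, hX, hY, map_one, one_smul, Finsupp.smul_single,
      smul_eq_mul, mul_one, add_assoc, ← Finsupp.single_add]
  refine cb_eq ⟨?_, ?_, fun A' hA' => ?_⟩ fun y hy => ?_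
  · rw [hbar, sub_add_cancel]
  · rw [Finsupp.add_apply, Finsupp.single_eq_same, Finsupp.single_apply, if_neg hXY, add_zero]
  · rw [Finsupp.add_apply, Finsupp.single_apply, if_neg hA'.symm, zero_add, Finsupp.single_apply]
    split_ifs with h
    · exact ⟨hc, fun _ => h ▸ hbelow⟩
    · exact ⟨negLattice_zero, fun h => absurd rfl h⟩
  · have h1 : y = Finsupp.single X 1 + Finsupp.single Y (y Y) := by
      ext1 Z
      rw [Finsupp.add_apply, Finsupp.single_apply, Finsupp.single_apply]
      by_cases hZ : Z = X
      · rw [hZ, hy.2.1, if_pos rfl, if_neg hXY, add_zero]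
      rw [if_neg (Ne.symm hZ), zero_add]
      split_ifs with hZ'
      · rw [hZ']
      · by_contra h0
        exact (hmin Z ((hy.2.2 Z hZ).2 h0)).elim hZ (Ne.symm hZ')
    have h2 := DFunLike.congr_fun hy.1 Y
    rw [h1, hbar] at h2
    simp only [Finsupp.add_apply, Finsupp.single_apply, if_neg hXY.symm, zero_add, if_true] at h2
    -- Two candidates differ at `Y` by a bar-invariant element of `v⁻¹ ℤ[v⁻¹]`, which is zero.
    have h3 : y Y - c = 0 := by
      refine eq_zero_of_mem_negLattice ?_ ?_
      · rw [sub_eq_add_neg]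
        exact negLattice_add (hy.2.2 Y hXY).1 (negLattice_neg hc)
      · rw [map_sub]
        linear_combination h2
    rw [h1, sub_eq_zero.1 h3]

end

section

variable {n : ℕ}

namespace IsMiddle

variable {i₀ mid : Fin n} {a b : ℤ}

/-! ### The order below the matrices of the example -/

/-- The entries above the diagonal vanish outside of the two neighbours of the centre. -/
def NearCentre (i₀ mid : Fin n) (Z : TXi n) : Prop :=
  ∀ i j, i < j → ¬ (i = i₀ ∧ j = mid) → ¬ (i = mid ∧ j = i₀.rev) → Z.1 i j = 0

theorem nearCentre_txA (h : IsMiddle i₀ mid) (hb : Odd b) : NearCentre i₀ mid (h.txA a hb) := by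
  intro i j hij h1 _
  change exA i₀ mid a b i j = 0
  rw [h.exA_offDiag hij.ne, if_neg]
  rintro (h2 | ⟨rfl, rfl⟩)
  · exact h1 h2
  · have := h.lt
    rw [Fin.rev_lt_rev] at hij
    exact absurd hij this.not_gt

theorem nearCentre_txB (h : IsMiddle i₀ mid) (hb : Odd b) : NearCentre i₀ mid (h.txB a hb) := by
  intro i j hij _ h1
  change exB i₀ mid a b i j = 0
  rw [h.exB_offDiag hij.ne, if_neg]
  rintro (⟨rfl, rfl⟩ | ⟨rfl, rfl⟩)
  · exact absurd hij h.lt.not_gt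
  · exact h1 ⟨h.mid_rev, rfl⟩

theorem nearCentre_txC (h : IsMiddle i₀ mid) (hb : Odd b) : NearCentre i₀ mid (h.txC a hb) := by
  intro i j hij h1 h3
  change exC i₀ mid a b i j = 0
  rw [h.exC_offDiag hij.ne, if_neg]
  rintro (⟨rfl | rfl, rfl⟩ | ⟨rfl, rfl | rfl⟩)
  · exact h1 ⟨rfl, rfl⟩
  · have := h.rev_val
    rw [Fin.lt_def] at hij
    omega
  · exact absurd hij h.lt.not_gt
  · exact h3 ⟨rfl, rfl⟩

theorem nearCentre_txD (h : IsMiddle i₀ mid) (hb : Odd b) : NearCentre i₀ mid (h.txD a hb) := by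
  intro i j hij _ _
  exact if_neg hij.ne

/-- The difference of the central row and the central column sum. -/
theorem sum_mid_sub (h : IsMiddle i₀ mid) {Z : TXi n} (hZ : NearCentre i₀ mid Z) :
    ∑ j, Z.1 mid j - ∑ i, Z.1 i mid = 2 * (Z.1 mid i₀.rev - Z.1 i₀ mid) := by
  have hrow : ∀ j, Z.1 mid j = (if j = mid then Z.1 mid mid else 0) +
      Z.1 mid i₀.rev * sideInd i₀ j := by
    intro j
    rw [h.sideInd_eq]
    rcases lt_trichotomy j mid with hj | rfl | hj
    · have h1 : Z.1 mid j = Z.1 mid j.rev := by rw [← Z.2.2.2, h.mid_rev]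
      rw [if_neg hj.ne, zero_add]
      by_cases hj' : j = i₀
      · rw [if_pos (Or.inl hj'), mul_one, h1, hj']
      · have h2 : mid < j.rev := by
          rw [← h.mid_rev, Fin.rev_lt_rev]
          exact hj
        rw [h1, hZ mid j.rev h2 (fun hc => h.ne hc.1.symm) fun hc => hj' (Fin.rev_inj.1 hc.2),
          if_neg, mul_zero]
        rintro (hc | hc)
        · exact hj' hc
        · have := h.rev_val
          rw [hc, Fin.lt_def] at hj
          omega
    · rw [if_pos rfl, if_neg, mul_zero, add_zero]
      rintro (hc | hc)
      · exact h.ne hc.symm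
      · exact h.rev_ne hc.symm
    · rw [if_neg hj.ne', zero_add]
      by_cases hj' : j = i₀.rev
      · rw [if_pos (Or.inr hj'), mul_one, hj']
      · rw [hZ mid j hj (fun hc => h.ne hc.1.symm) fun hc => hj' hc.2, if_neg, mul_zero]
        rintro (hc | hc)
        · rw [hc] at hj
          exact absurd hj h.lt.not_gt
        · exact hj' hc
  have hcol : ∀ i, Z.1 i mid = (if i = mid then Z.1 mid mid else 0) +
      Z.1 i₀ mid * sideInd i₀ i := by
    intro i
    rw [h.sideInd_eq]
    rcases lt_trichotomy i mid with hi | rfl | hi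
    · rw [if_neg hi.ne, zero_add]
      by_cases hi' : i = i₀
      · rw [if_pos (Or.inl hi'), mul_one, hi']
      · rw [hZ i mid hi (fun hc => hi' hc.1) fun hc => hi.ne hc.1, if_neg, mul_zero]
        rintro (hc | hc)
        · exact hi' hc
        · have := h.rev_val
          rw [hc, Fin.lt_def] at hi
          omega
    · rw [if_pos rfl, if_neg, mul_zero, add_zero]
      rintro (hc | hc)
      · exact h.ne hc.symm
      · exact h.rev_ne hc.symm
    · have h1 : Z.1 i mid = Z.1 i.rev mid := by rw [← Z.2.2.2, h.mid_rev]
      rw [if_neg hi.ne', zero_add]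
      by_cases hi' : i = i₀.rev
      · rw [if_pos (Or.inr hi'), mul_one, h1, hi', Fin.rev_rev]
      · have h2 : i.rev < mid := by
          rw [← h.mid_rev, Fin.rev_lt_rev]
          exact hi
        rw [h1, hZ i.rev mid h2 (fun hc => hi' (by rw [← hc.1, Fin.rev_rev])) fun hc => h2.ne hc.1,
          if_neg, mul_zero]
        rintro (hc | hc)
        · rw [hc] at hi
          exact absurd hi h.lt.not_gt
        · exact hi' hc
  rw [Finset.sum_congr rfl fun j _ => hrow j, Finset.sum_congr rfl fun i _ => hcol i]
  simp only [Finset.sum_add_distrib, ← Finset.mul_sum, sum_sideInd]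
  ring

/-- The corner sums of `X` are its entries, and an entry of `Z` is at most its corner sum; so `Z` is
bounded entrywise above the diagonal by `X`. The central row and column sums then fix the difference
of the two remaining entries. -/
theorem below_nearCentre (h : IsMiddle i₀ mid) {X Z : TXi n} (hX : NearCentre i₀ mid X)
    (hZX : Below Z X) : NearCentre i₀ mid Z ∧ Z.1 i₀ mid ≤ X.1 i₀ mid ∧
      Z.1 mid i₀.rev ≤ X.1 mid i₀.rev ∧
      Z.1 mid i₀.rev - Z.1 i₀ mid = X.1 mid i₀.rev - X.1 i₀ mid := by
  have hlt : mid < i₀.rev := by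
    rw [Fin.lt_def, h.rev_val]
    omega
  have hle : ∀ i j, i < j → Z.1 i j ≤ X.1 i j := by
    intro i j hij
    have h1 := cornerSum_of_tridiagonal (A := X) (fun r s hrs => hX r s (by rw [Fin.lt_def]; omega)
      (by
        rintro ⟨rfl, rfl⟩
        have := h.succ
        omega)
      (by
        rintro ⟨rfl, rfl⟩
        have := h.rev_val
        omega)) hij
    rw [← h1]
    exact (le_cornerSum Z hij).trans (hZX.1 i j hij)
  have hZ : NearCentre i₀ mid Z := fun i j hij h1 h2 =>
    le_antisymm ((hle i j hij).trans (hX i j hij h1 h2).le) (Z.2.1 i j hij.ne)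
  refine ⟨hZ, hle _ _ h.lt, hle _ _ hlt, ?_⟩
  have h1 := h.sum_mid_sub hZ
  rw [hZX.2.1, hZX.2.2, h.sum_mid_sub hX] at h1
  omega

theorem eq_of_nearCentre {X Z : TXi n} (hX : NearCentre i₀ mid X) (hZ : NearCentre i₀ mid Z)
    (h1 : Z.1 i₀ mid = X.1 i₀ mid) (h2 : Z.1 mid i₀.rev = X.1 mid i₀.rev)
    (hrow : ∀ i, ∑ j, Z.1 i j = ∑ j, X.1 i j) : Z = X := by
  refine txi_ext (fun i j hij => ?_) hrow
  by_cases h3 : i = i₀ ∧ j = mid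
  · rw [h3.1, h3.2, h1]
  by_cases h4 : i = mid ∧ j = i₀.rev
  · rw [h4.1, h4.2, h2]
  rw [hX i j hij h3 h4, hZ i j hij h3 h4]

theorem txA_right (h : IsMiddle i₀ mid) (hb : Odd b) : (h.txA a hb).1 mid i₀.rev = 0 := by
  change exA i₀ mid a b mid i₀.rev = 0
  rw [h.exA_offDiag h.rev_ne.symm, if_neg]
  rintro (hc | hc)
  · exact h.ne hc.1.symm
  · exact h.rev_ne hc.1.symm

theorem txB_left (h : IsMiddle i₀ mid) (hb : Odd b) : (h.txB a hb).1 i₀ mid = 0 := by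
  change exB i₀ mid a b i₀ mid = 0
  rw [h.exB_offDiag h.ne, if_neg]
  rintro (hc | hc)
  · exact h.ne hc.1
  · exact h.rev_ne hc.2.symm

theorem txC_left (h : IsMiddle i₀ mid) (hb : Odd b) : (h.txC a hb).1 i₀ mid = 1 := by
  change exC i₀ mid a b i₀ mid = 1
  rw [h.exC_offDiag h.ne, if_pos (Or.inl ⟨Or.inl rfl, rfl⟩)]

theorem txC_right (h : IsMiddle i₀ mid) (hb : Odd b) : (h.txC a hb).1 mid i₀.rev = 1 := by
  change exC i₀ mid a b mid i₀.rev = 1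
  rw [h.exC_offDiag h.rev_ne.symm, if_pos (Or.inr ⟨rfl, Or.inr rfl⟩)]

theorem txD_left (h : IsMiddle i₀ mid) (hb : Odd b) : (h.txD a hb).1 i₀ mid = 0 :=
  if_neg h.ne

theorem txD_right (h : IsMiddle i₀ mid) (hb : Odd b) : (h.txD a hb).1 mid i₀.rev = 0 :=
  if_neg h.rev_ne.symm

theorem txC_row (h : IsMiddle i₀ mid) (hb : Odd b) (i : Fin n) :
    ∑ j, (h.txC a hb).1 i j = ∑ j, (h.txD a hb).1 i j :=
  (sum_exC_row i).trans (sum_exD_row i).symm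

theorem txC_col (h : IsMiddle i₀ mid) (hb : Odd b) (j : Fin n) :
    ∑ i, (h.txC a hb).1 i j = ∑ i, (h.txD a hb).1 i j :=
  (sum_exC_col j).trans (sum_exD_col j).symm

theorem txD_ne_txC (h : IsMiddle i₀ mid) (hb : Odd b) : h.txD a hb ≠ h.txC a hb := by
  intro heq
  have h1 := h.txC_left (a := a) hb
  rw [← heq, h.txD_left hb] at h1
  exact zero_ne_one h1

theorem txD_below_txC (h : IsMiddle i₀ mid) (hb : Odd b) : Below (h.txD a hb) (h.txC a hb) := by
  refine ⟨fun i j hij => ?_, fun i => (h.txC_row hb i).symm, fun j => (h.txC_col hb j).symm⟩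
  change cornerSum (h.txD a hb) i j ≤ cornerSum (h.txC a hb) i j
  rw [cornerSum_of_tridiagonal (fun r s hrs => if_neg (by rintro rfl; omega)) hij]
  refine le_trans ?_ (le_cornerSum _ hij)
  have h1 : (h.txD a hb).1 i j = 0 := if_neg hij.ne
  rw [h1]
  exact (h.txC a hb).2.1 i j hij.ne

/-! ### The stably canonical basis elements of the example -/

theorem cb_txA (h : IsMiddle i₀ mid) (hn : Odd n) (hb : Odd b) :
    HasCB (h.txA a hb) ∧ cb (h.txA a hb) = Finsupp.single (h.txA a hb) 1 := by
  refine cb_of_minimal (fun Z hZ => ?_) (h.barStd_txA hn hb)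
  obtain ⟨h1, h2, h3, h4⟩ := h.below_nearCentre (h.nearCentre_txA hb) hZ
  have h5 := Z.2.1 mid i₀.rev h.rev_ne.symm
  rw [h.txA_right] at h3 h4
  exact eq_of_nearCentre (h.nearCentre_txA hb) h1 (by omega) (by rw [h.txA_right]; omega) hZ.2.1

theorem cb_txB (h : IsMiddle i₀ mid) (hn : Odd n) (hb : Odd b) :
    HasCB (h.txB a hb) ∧ cb (h.txB a hb) = Finsupp.single (h.txB a hb) 1 := by
  refine cb_of_minimal (fun Z hZ => ?_) (h.barStd_txB hn hb)
  obtain ⟨h1, h2, h3, h4⟩ := h.below_nearCentre (h.nearCentre_txB hb) hZ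
  have h5 := Z.2.1 i₀ mid h.ne
  rw [h.txB_left] at h2 h4
  exact eq_of_nearCentre (h.nearCentre_txB hb) h1 (by rw [h.txB_left]; omega) (by omega) hZ.2.1

theorem cb_txD (h : IsMiddle i₀ mid) (hn : Odd n) (hb : Odd b) :
    HasCB (h.txD a hb) ∧ cb (h.txD a hb) = Finsupp.single (h.txD a hb) 1 := by
  refine cb_of_minimal (fun Z hZ => ?_) (h.barStd_txD hn hb)
  obtain ⟨h1, h2, h3, h4⟩ := h.below_nearCentre (h.nearCentre_txD hb) hZ
  have h5 := Z.2.1 i₀ mid h.ne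
  rw [h.txD_left] at h2 h4
  exact eq_of_nearCentre (h.nearCentre_txD hb) h1 (by rw [h.txD_left]; omega) (by omega) hZ.2.1

theorem cb_txC (h : IsMiddle i₀ mid) (hn : Odd n) (hb : Odd b) (hab : a < b) (hb2 : b ≤ -2) :
    HasCB (h.txC a hb) ∧ cb (h.txC a hb) = Finsupp.single (h.txC a hb) 1 +
      Finsupp.single (h.txD a hb) (-barQ (prodCoeff a b)) := by
  refine cb_of_cover (h.txD_ne_txC hb) (h.txD_below_txC hb) (fun Z hZ => ?_) ?_
    (h.barStd_txD hn hb) ?_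
  · obtain ⟨h1, h2, h3, h4⟩ := h.below_nearCentre (h.nearCentre_txC hb) hZ
    have h5 := Z.2.1 i₀ mid h.ne
    rw [h.txC_left] at h2 h4
    rw [h.txC_right] at h3 h4
    -- The two entries are equal and at most 1: the value 1 gives `C` and the value 0 gives `D`.
    by_cases h6 : Z.1 i₀ mid = 1
    · exact Or.inl (eq_of_nearCentre (h.nearCentre_txC hb) h1 (by rw [h.txC_left]; omega)
        (by rw [h.txC_right]; omega) hZ.2.1)
    · exact Or.inr (eq_of_nearCentre (h.nearCentre_txD hb) h1 (by rw [h.txD_left]; omega)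
        (by rw [h.txD_right]; omega) fun i => (hZ.2.1 i).trans (h.txC_row hb i))
  · have h1 : barQ (barQ (prodCoeff a b)) = prodCoeff a b := by
      rw [barQ_prodCoeff, map_mul, barQ_zpow, barQ_qInt, map_mul, barQ_zpow, barQ_qInt, prodCoeff,
        ← mul_assoc (v ^ (-(-2 * (b + 1 - 1)))), ← zpow_add₀ v_ne_zero, neg_add_cancel, zpow_zero,
        one_mul]
    rw [h.barStd_txC hn hb, map_neg, h1]
    congr 2
    ring
  -- The negated conjugate is the sum of `v^{a+b+2+2j}` for `j < m = -b - 1`. Its largest possible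
  -- exponent is `a - b - 2`, negative because `a < b`.
  · obtain ⟨m, hm⟩ : ∃ m : ℕ, b + 1 = -(m : ℤ) := ⟨(-b - 1).toNat, by omega⟩
    rw [barQ_prodCoeff, ← mul_neg, hm, zpow_mul_neg_barQ_qInt_neg]
    refine sum_zpow_mem_negLattice _ _ fun j hj => ?_
    rw [Finset.mem_range] at hj
    omega

/-- With `c = prodCoeff a b` the product is `[C] + c [D]`. Replacing `[C]` by `{C} + c̄ [D]` leaves
the coefficient `c + c̄`. -/
theorem mul_cb_txB_cb_txA (h : IsMiddle i₀ mid) (hn : Odd n) (hb : Odd b) (hab : a < b)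
    (hb2 : b ≤ -2) : mul (cb (h.txB a hb)) (cb (h.txA a hb)) = cb (h.txC a hb) +
      ((v ^ (b + a) + v ^ (b - a)) * barQ (qInt (b + 1))) • cb (h.txD a hb) := by
  rw [(h.cb_txA hn hb).2, (h.cb_txB hn hb).2, (h.cb_txC hn hb hab hb2).2, (h.cb_txD hn hb).2, mul,
    Finsupp.sum_single_index, Finsupp.sum_single_index, h.mulStd_txB_txA hn hb, mul_one, one_smul,
    Finsupp.smul_single, smul_eq_mul, mul_one, add_assoc, ← Finsupp.single_add, barQ_prodCoeff,
    prodCoeff_eq]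
  · congr 2
    rw [add_comm a b]
    ring
  · rw [mul_zero, zero_smul]
  · rw [Finsupp.sum_single_index] <;> rw [zero_mul, zero_smul]

/-- The negative is a sum of two positive elements. If the coefficient were positive too it would
vanish, and then so would each summand; but each is a power of `v` times a nonzero quantum integer.
-/
theorem coeff_not_mem_NLaurent (hb2 : b ≤ -2) :
    (v ^ (b + a) + v ^ (b - a)) * barQ (qInt (b + 1)) ∉ NLaurent := by
  obtain ⟨m, hm⟩ : ∃ m : ℕ, b + 1 = -(m : ℤ) := ⟨(-b - 1).toNat, by omega⟩
  have hpos : ∀ k : ℤ, v ^ k * -barQ (qInt (b + 1)) ∈ NLaurent := by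
    intro k
    rw [hm, zpow_mul_neg_barQ_qInt_neg]
    exact sum_zpow_mem_NLaurent _ _
  intro h1
  have h2 : -((v ^ (b + a) + v ^ (b - a)) * barQ (qInt (b + 1))) =
      v ^ (b + a) * -barQ (qInt (b + 1)) + v ^ (b - a) * -barQ (qInt (b + 1)) := by ring
  have h3 := eq_zero_of_neg_mem_NLaurent h1 (h2 ▸ NLaurent_add (hpos _) (hpos _))
  rw [h3, neg_zero] at h2
  have h4 := eq_zero_of_neg_mem_NLaurent (hpos (b + a)) (by
    rw [neg_eq_of_add_eq_zero_right h2.symm]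
    exact hpos _)
  rw [hm, neg_barQ_qInt_neg] at h4
  exact mul_ne_zero (v_zpow_ne_zero _) (mul_ne_zero (pow_ne_zero _ v_ne_zero)
    (qNat_ne_zero (by omega))) h4

end IsMiddle

/-! ### Specialization to `n = 3` and failure of positivity for all odd `n ≥ 3` -/

theorem exists_isMiddle (hn : Odd n) (h3 : 3 ≤ n) : ∃ i₀ mid : Fin n, IsMiddle i₀ mid := by
  obtain ⟨mid, hmid⟩ := exists_rev_eq hn
  have h1 : 0 < (mid : ℕ) := by
    rw [Fin.ext_iff, Fin.val_rev] at hmid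
    omega
  exact ⟨⟨mid - 1, by omega⟩, mid, hmid, by simp only; omega⟩

theorem isMiddle_three : IsMiddle (0 : Fin 3) 1 := ⟨rfl, rfl⟩

theorem txA_three (a b : ℤ) (hb : Odd b) : isMiddle_three.txA a hb = matA a b hb := by
  refine Subtype.ext (Matrix.ext fun i j => ?_)
  change exA 0 1 a b i j = _
  fin_cases i <;> fin_cases j <;> simp [exA, diagVec, sideInd, matA, Fin.ext_iff]

theorem txB_three (a b : ℤ) (hb : Odd b) : isMiddle_three.txB a hb = matB a b hb := by
  refine Subtype.ext (Matrix.ext fun i j => ?_)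
  change exB 0 1 a b i j = _
  fin_cases i <;> fin_cases j <;> simp [exB, diagVec, sideInd, matB, Fin.ext_iff]

theorem txC_three (a b : ℤ) (hb : Odd b) : isMiddle_three.txC a hb = matC a b hb := by
  refine Subtype.ext (Matrix.ext fun i j => ?_)
  change exC 0 1 a b i j = _
  fin_cases i <;> fin_cases j <;> simp [exC, diagVec, sideInd, matC, Fin.ext_iff]

theorem txD_three (a b : ℤ) (hb : Odd b) : isMiddle_three.txD a hb = matD a b hb := by
  refine Subtype.ext (Matrix.ext fun i j => ?_)
  change exD 1 a b i j = _
  fin_cases i <;> fin_cases j <;> simp [exD, diagVec, matD, Fin.ext_iff]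

/-- The structure constants are not always positive. -/
theorem exists_not_positive (hn : Odd n) (h3 : 3 ≤ n) :
    ∃ (B A : TXi n) (g : TXi n →₀ Qv), IsStructureConstants B A g ∧
      (∀ g' : TXi n →₀ Qv, IsStructureConstants B A g' → g' = g) ∧
      ∃ C : TXi n, g C ∉ NLaurent := by
  classical
  obtain ⟨i₀, mid, h⟩ := exists_isMiddle hn h3
  -- The values `b = -3` and `a = -5` are one choice with `b` odd and `a < b ≤ -2`.
  have hb : Odd (-3 : ℤ) := by decide
  have hC := h.cb_txC (a := -5) hn hb (by norm_num) (by norm_num)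
  have hD := h.cb_txD (a := -5) hn hb
  set c : Qv := (v ^ (-3 + -5 : ℤ) + v ^ (-3 - -5 : ℤ)) * barQ (qInt (-3 + 1)) with hc
  have hg : IsStructureConstants (h.txB (-5) hb) (h.txA (-5) hb)
      (Finsupp.single (h.txC (-5) hb) 1 + Finsupp.single (h.txD (-5) hb) c) := by
    refine ⟨(h.cb_txB hn hb).1, (h.cb_txA hn hb).1, fun Z hZ => ?_, ?_⟩
    · rw [Finsupp.add_apply, Finsupp.single_apply, Finsupp.single_apply] at hZ
      split_ifs at hZ with h1 h2 h2
      · exact h1 ▸ hC.1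
      · exact h1 ▸ hC.1
      · exact h2 ▸ hD.1
      · exact absurd (add_zero _) hZ
    · rw [h.mul_cb_txB_cb_txA hn hb (by norm_num) (by norm_num), Finsupp.sum_add_index',
        Finsupp.sum_single_index, Finsupp.sum_single_index, one_smul]
      · rw [zero_smul]
      · rw [zero_smul]
      · intro Z
        rw [zero_smul]
      · intro Z x y
        rw [add_smul]
  refine ⟨_, _, _, hg, fun g' hg' => hg.unique hg', h.txD (-5) hb, ?_⟩
  rw [Finsupp.add_apply, Finsupp.single_apply, if_neg (h.txD_ne_txC hb).symm, zero_add,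
    Finsupp.single_eq_same]
  exact IsMiddle.coeff_not_mem_NLaurent (by norm_num)

end

end JSchur

end

theorem mainTheorem9 :
    (∀ n : ℕ, Odd n → 3 ≤ n →
      ∃ (B A : JSchur.TXi n) (g : JSchur.TXi n →₀ JSchur.Qv),
        JSchur.IsStructureConstants B A g ∧
        (∀ g' : JSchur.TXi n →₀ JSchur.Qv, JSchur.IsStructureConstants B A g' → g' = g) ∧
        ∃ C : JSchur.TXi n, g C ∉ JSchur.NLaurent) ∧
    (∀ (a b : ℤ) (hb : Odd b), a < b → b ≤ -2 →
      JSchur.HasCB (JSchur.matA a b hb) ∧ JSchur.HasCB (JSchur.matB a b hb) ∧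
      JSchur.HasCB (JSchur.matC a b hb) ∧ JSchur.HasCB (JSchur.matD a b hb) ∧
      JSchur.mul (JSchur.cb (JSchur.matB a b hb)) (JSchur.cb (JSchur.matA a b hb)) =
        JSchur.cb (JSchur.matC a b hb) +
          ((JSchur.v ^ (b + a) + JSchur.v ^ (b - a)) * JSchur.barQ (JSchur.qInt (b + 1))) •
            JSchur.cb (JSchur.matD a b hb) ∧
      -JSchur.barQ (JSchur.qInt (b + 1)) ∈ JSchur.NLaurent) := by
  refine ⟨fun n hn h3 => JSchur.exists_not_positive hn h3, fun a b hb hab hb2 => ?_⟩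
  have hn : Odd 3 := by decide
  rw [← JSchur.txA_three, ← JSchur.txB_three, ← JSchur.txC_three, ← JSchur.txD_three]
  refine ⟨(JSchur.isMiddle_three.cb_txA hn hb).1, (JSchur.isMiddle_three.cb_txB hn hb).1,
    (JSchur.isMiddle_three.cb_txC hn hb hab hb2).1, (JSchur.isMiddle_three.cb_txD hn hb).1,
    JSchur.isMiddle_three.mul_cb_txB_cb_txA hn hb hab hb2, ?_⟩
  obtain ⟨m, hm⟩ : ∃ m : ℕ, b + 1 = -(m : ℤ) := ⟨(-b - 1).toNat, by omega⟩
  have h1 := JSchur.zpow_mul_neg_barQ_qInt_neg 0 m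
  rw [zpow_zero, one_mul, ← hm] at h1
  rw [h1]
  exact JSchur.sum_zpow_mem_NLaurent _ _
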